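/- **Notation.** Let $\mathbb T^3=\mathbb R^3/\mathbb Z^3$ with its Haar probability measure, $e(k)=3-\sum_{i=1}^3\cos(2\pi k_i)$, and let $\widehat{\phi}\in L^2(\mathbb T^3)$ be the Fourier transform of $\phi\in\ell^2(\mathbb Z^3)$, i.e. the unitary extension of $\widehat\phi(k)=\sum_{x}\phi(x)e^{-2\pi i k\cdot x}$. For a complex-valued Schwartz function $J\in\mathcal S(\mathbb R^3\times\mathbb T^3)$ let $\widehat J$ be its Fourier transform in the first variable, $\widehat J(\xi,v)=\int_{\mathbb R^3}J(X,v)e^{-2\pi i\xi\cdot X}\,dX$, and $\widehat{J_\eta}(\xi,v)=\eta^{-3}\widehat J(\xi/\eta,v)$. Let $I$ be the rectangle with vertices $-1,7,7-i,-1-i$, traversed clockwise, and $\overline I$ its complex conjugate, traversed counterclockwise. **Pairings.** Let $n_1,n_2\ge 0$ be integers, $\overline n=n_1+n_2$. There are two one-particle lines $j=1,2$; line $j$ carries momenta $k^{(j)}_0,\dots,k^{(j)}_{\overline n+1}\in\mathbb T^3$ and $\overline n$ interactions, one at each position $l\in\{0,\dots,\overline n\}\setminus\{n_1\}$ (between $k^{(j)}_l$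 and $k^{(j)}_{l+1}$). A pairing $\pi$ is a partition of the $2\overline n$ interactions into pairs (contractions). A contraction of two interactions $l\neq l'$ of the same line $j$ is called internal and contributes $\delta(k^{(j)}_{l+1}-k^{(j)}_l+k^{(j)}_{l'+1}-k^{(j)}_{l'})$; a contraction of interaction $l$ of line $1$ with interaction $l'$ of line $2$ is called a transfer contraction and contributes $\delta(k^{(1)}_{l+1}-k^{(1)}_l-k^{(2)}_{l'+1}+k^{(2)}_{l'})$. Let $\delta_\pi$ be the product of these $\overline n$ delta functions on $\mathbb T^3$. The pairing is connected, $\pi\in\Pi^{conn}_{n_1,n_2}$, if it has at least one transfer contraction. It has a generalized crossing on line $j$ if line $j$ has internal contractions $\{l_1,l_2\}$ and $\{i_1,i_2\}$ with $l_1<i_1<l_2<i_2$, or an internal contraction $\{l_1,l_2\}$ and an end $i_1$ of a transfer contraction with $l_1<i_1<l_2$. **Amplitude.** Let $\lambda>0$, $\eta=\lambda^2$, $t\ge0$, $0<\varepsilon<1$, $\varepsilon_j=(-1)^j\varepsilon$, $\phi_0\in\ell^2(\mathbb Z^3)$, and $$K^{(j)}(k^{(j)},\alpha_j,\beta_j,\varepsilon)=\prod_{l=0}^{n_1}\frac1{e(k^{(j)}_l)-\alpha_j+i\varepsilon_j}\prod_{l=n_1+1}^{\overline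 n+1}\frac1{e(k^{(j)}_l)-\beta_j-i\varepsilon_j}.$$ The amplitude of $\pi$ is $$\begin{aligned}\mathrm{Amp}(\pi)=\frac{e^{4\varepsilon t}\lambda^{2\overline n}}{(2\pi)^4}&\int_I d\alpha_1\int_{\overline I}d\beta_1\int_{\overline I}d\alpha_2\int_I d\beta_2\,e^{-it(\alpha_1-\beta_1-\alpha_2+\beta_2)}\int_{(\mathbb T^3)^{2\overline n+4}}dk^{(1)}dk^{(2)}\,\delta_\pi(k^{(1)},k^{(2)})\\&\int_{\mathbb R^3}d\xi^{(1)}\int_{\mathbb R^3}d\xi^{(2)}\,\prod_{j=1}^{2}\delta\big(k^{(j)}_{n_1+1}-k^{(j)}_{n_1}-\xi^{(j)}\big)\;\widehat{J_\eta}\big(\xi^{(1)},k^{(1)}_{n_1}+\tfrac{\xi^{(1)}}2\big)\overline{\widehat{J_\eta}\big(\xi^{(2)},k^{(2)}_{n_1}+\tfrac{\xi^{(2)}}2\big)}\\&K^{(1)}(k^{(1)},\alpha_1,\beta_1,\varepsilon)\,K^{(2)}(k^{(2)},\alpha_2,\beta_2,\varepsilon)\;\widehat{\phi_0}(k^{(1)}_0)\overline{\widehat{\phi_0}(k^{(1)}_{\overline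 n+1})}\;\overline{\widehat{\phi_0}(k^{(2)}_0)}\widehat{\phi_0}(k^{(2)}_{\overline n+1}),\end{aligned}$$ where all delta functions are those of the torus $\mathbb T^3$ (so $\delta(k^{(j)}_{n_1+1}-k^{(j)}_{n_1}-\xi^{(j)})$ fixes $k^{(j)}_{n_1+1}=k^{(j)}_{n_1}+\xi^{(j)}$ modulo $\mathbb Z^3$). Explicitly, the $k$-integral with the delta functions is the integral over $k^{(1)}_0,k^{(2)}_0$ and one momentum difference $k^{(j)}_{l+1}-k^{(j)}_l\in\mathbb T^3$ for each pair of $\pi$, the other momentum difference of the pair being determined by its delta function. **Lemma 4.3.** For every $J\in\mathcal S(\mathbb R^3\times\mathbb T^3)$ there is a constant $0<c<\infty$, depending only on $J$, such that for all $n_1,n_2\ge0$, every $\pi\in\Pi^{conn}_{n_1,n_2}$ that has a generalized crossing on the $j$-th one-particle line for some $j\in\{1,2\}$, all $\lambda>0$ (with $\eta=\lambda^2$), all $t\ge0$, all $0<\varepsilon\le\frac13$ and all $\phi_0\in\ell^2(\mathbb Z^3)$, $$|\mathrm{Amp}(\pi)|\le e^{4\varepsilon t}\lambda^{2\overline n}\varepsilon^{\frac15-\overline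 n}\,|c\log\varepsilon|^{\overline n+5}\,\|\phi_0\|_{\ell^2}^4 .$$ -/

import Mathlib

open MeasureTheory
open scoped FourierTransform ContDiff ComplexConjugate

noncomputable section

namespace LatticeSchrodinger

/-- The unit torus `𝕋³ = ℝ³/ℤ³`; its `volume` is the Haar probability measure. -/
abbrev T3 : Type := UnitAddTorus (Fin 3)

/-- Euclidean space `ℝ³`. -/
abbrev E3 : Type := EuclideanSpace ℝ (Fin 3)

/-- The space `ℓ²(ℤ³)` of complex wave functions on the lattice. -/
abbrev L2Z3 : Type := lp (fun _ : Fin 3 → ℤ => ℂ) 2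

/-- The quotient map `ℝ³ → 𝕋³`. -/
def toTorus (x : E3) : T3 := fun i => ((x i : ℝ) : UnitAddCircle)

/-- The function `x ↦ cos (2πx)` has period `1`. -/
theorem periodic_cos_two_pi : Function.Periodic (fun x : ℝ => Real.cos (2 * Real.pi * x)) 1 := by
  intro x
  simp only [mul_add, mul_one]
  exact Real.cos_add_two_pi _

/-- The kinetic energy `e(k) = 3 - ∑ⱼ cos (2πkⱼ)` on `𝕋³`. -/
def kineticEnergy (k : T3) : ℝ := 3 - ∑ i : Fin 3, periodic_cos_two_pi.lift (k i)

/-- The Fourier transform `ℓ²(ℤ³) → L²(𝕋³)`, the unitary extension of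
`ψ ↦ (k ↦ ∑ₓ ψ(x) exp (-2πi k·x))`. Mathlib's Hilbert basis consists of the characters
`k ↦ exp (2πi k·x)`, whence the reflection of the argument. -/
def latticeFourier (ψ : L2Z3) (k : T3) : ℂ :=
  (UnitAddTorus.mFourierBasis (d := Fin 3)).repr.symm ψ (-k)

/-- `J` belongs to the Schwartz space `𝓢(ℝ³ × 𝕋³)`: its lift to `ℝ³ × ℝ³` is smooth, and all
derivatives decay faster than any power of the first variable, uniformly in the second one. -/
def IsSchwartz (J : E3 → T3 → ℂ) : Prop :=
  ContDiff ℝ ∞ (fun p : E3 × E3 => J p.1 (toTorus p.2)) ∧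
    ∀ a b : ℕ, ∃ C : ℝ, ∀ X v : E3,
      ‖X‖ ^ a * ‖iteratedFDeriv ℝ b (fun p : E3 × E3 => J p.1 (toTorus p.2)) (X, v)‖ ≤ C

/-- `Ĵ_η(ξ, v) = η⁻³ Ĵ(ξ/η, v)`, with the Fourier transform taken in the first variable. -/
def scaledFourier (J : E3 → T3 → ℂ) (η : ℝ) (ξ : E3) (v : T3) : ℂ :=
  ((η ^ 3)⁻¹ : ℝ) * 𝓕 (fun X : E3 => J X v) (η⁻¹ • ξ)

/-- The integral of `f` along the straight segment from `a` to `b`. -/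
def segmentIntegral (f : ℂ → ℂ) (a b : ℂ) : ℂ :=
  ∫ s in (0 : ℝ)..1, (b - a) * f (a + s * (b - a))

/-- The integral along `I`, the rectangle with vertices `-1, 7, 7 - i, -1 - i`, clockwise. -/
def integralI (f : ℂ → ℂ) : ℂ :=
  segmentIntegral f (-1) 7 + segmentIntegral f 7 (7 - Complex.I) +
    segmentIntegral f (7 - Complex.I) (-1 - Complex.I) + segmentIntegral f (-1 - Complex.I) (-1)

/-- The integral along the complex conjugate of `I`, counterclockwise. -/
def integralIbar (f : ℂ → ℂ) : ℂ :=
  segmentIntegral f (-1) 7 + segmentIntegral f 7 (7 + Complex.I) +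
    segmentIntegral f (7 + Complex.I) (-1 + Complex.I) + segmentIntegral f (-1 + Complex.I) (-1)

/-- The positions of the `n₁ + n₂` interactions on a one-particle line with momenta
`k₀, …, k_{n₁+n₂+1}`: the interaction at `l` sits between `k_l` and `k_{l+1}`. The position
`l = n₁` is excluded, as the test function sits there. -/
abbrev Position (n₁ n₂ : ℕ) : Type := {l : Fin (n₁ + n₂ + 1) // (l : ℕ) ≠ n₁}

/-- An interaction with the potential: the one-particle line it belongs to (`0` for the first and
`1` for the second line) and its position there. -/
abbrev Bullet (n₁ n₂ : ℕ) : Type := Fin 2 × Position n₁ n₂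

/-- A pairing of the `2 (n₁ + n₂)` interactions, given by its map to partners. -/
structure Pairing (n₁ n₂ : ℕ) where
  partner : Bullet n₁ n₂ → Bullet n₁ n₂
  partner_partner : ∀ b, partner (partner b) = b
  partner_ne : ∀ b, partner b ≠ b

namespace Pairing

variable {n₁ n₂ : ℕ}

/-- The pairing has at least one transfer contraction, that is, a contraction between the two
one-particle lines. -/
def IsConnected (π : Pairing n₁ n₂) : Prop := ∃ b, (π.partner b).1 ≠ b.1

/-- The pairing has a generalized crossing on the line `j`: either two internal contractions
`l₁ — l₂` and `i₁ — i₂` of that line cross, or a transfer contraction ends on that line between the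
endpoints of an internal contraction `l₁ — l₂`. -/
def HasGeneralizedCrossing (π : Pairing n₁ n₂) (j : Fin 2) : Prop :=
  (∃ l₁ i₁ l₂ i₂ : Position n₁ n₂, π.partner (j, l₁) = (j, l₂) ∧ π.partner (j, i₁) = (j, i₂) ∧
      l₁ < i₁ ∧ i₁ < l₂ ∧ l₂ < i₂) ∨
    ∃ l₁ i₁ l₂ : Position n₁ n₂, π.partner (j, l₁) = (j, l₂) ∧ (π.partner (j, i₁)).1 ≠ j ∧
      l₁ < i₁ ∧ i₁ < l₂

/-- `b` is the first interaction of its pair: its partner lies on the second line if the pair is a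
transfer contraction, and further to the right if it is an internal contraction. -/
def IsFirst (π : Pairing n₁ n₂) (b : Bullet n₁ n₂) : Prop :=
  b.1 < (π.partner b).1 ∨ (b.1 = (π.partner b).1 ∧ b.2 < (π.partner b).2)

/-- Each pair has exactly one first interaction. -/
theorem isFirst_partner_iff (π : Pairing n₁ n₂) (b : Bullet n₁ n₂) :
    π.IsFirst (π.partner b) ↔ ¬ π.IsFirst b := by
  have h := π.partner_ne b
  unfold IsFirst
  rw [π.partner_partner]
  rcases lt_trichotomy b.1 (π.partner b).1 with h1 | h1 | h1
  · simp [h1, h1.ne', h1.not_gt]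
  · have h2 : (π.partner b).2 ≠ b.2 := fun h2 => h (Prod.ext h1.symm h2)
    simp only [h1, lt_irrefl, true_and, false_or, not_lt]
    exact ⟨fun h3 => h3.le, fun h3 => lt_of_le_of_ne h3 h2⟩
  · simp [h1, h1.ne', h1.not_gt]

/-- The first interactions, which label the `n₁ + n₂` pairs. -/
abbrev Pair (π : Pairing n₁ n₂) : Type := {b : Bullet n₁ n₂ // π.IsFirst b}

instance (π : Pairing n₁ n₂) : Fintype π.Pair := Fintype.ofFinite _

open Classical in
/-- The momentum difference `k_{l+1} - k_l` at an interaction, if `q` gives the differences at the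
first interactions of all pairs: an internal delta makes the two differences of a pair add up to
`0`, a transfer delta makes them equal. -/
def bulletMomentum (π : Pairing n₁ n₂) (q : π.Pair → T3) (b : Bullet n₁ n₂) : T3 :=
  if h : π.IsFirst b then q ⟨b, h⟩
  else
    let p : T3 := q ⟨π.partner b, (π.isFirst_partner_iff b).2 h⟩
    if (π.partner b).1 = b.1 then -p else p

/-- The independent variables that are left after the delta functions in the amplitude have been
integrated out: the momenta `k₀` of both lines, one momentum difference per pair, and the variables
`ξ` of both lines. -/
abbrev Config (π : Pairing n₁ n₂) : Type := (Fin 2 → T3) × (π.Pair → T3) × (Fin 2 → E3)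

/-- The difference `k_{l+1} - k_l` on the line `j`, equal to `ξ` modulo `ℤ³` for `l = n₁`. -/
def momentumStep (π : Pairing n₁ n₂) (x : π.Config) (j : Fin 2) (l : Fin (n₁ + n₂ + 1)) : T3 :=
  if h : (l : ℕ) = n₁ then toTorus (x.2.2 j) else π.bulletMomentum x.2.1 (j, ⟨l, h⟩)

/-- The momentum `k_l` on the line `j`. -/
def momentum (π : Pairing n₁ n₂) (x : π.Config) (j : Fin 2) (l : Fin (n₁ + n₂ + 2)) : T3 :=
  x.1 j + ∑ i : Fin (n₁ + n₂ + 1) with i.castSucc < l, π.momentumStep x j i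

theorem momentum_succ_sub (π : Pairing n₁ n₂) (x : π.Config) (j : Fin 2)
    (l : Fin (n₁ + n₂ + 1)) :
    π.momentum x j l.succ - π.momentum x j l.castSucc = π.momentumStep x j l := by
  have h : (Finset.univ.filter fun i : Fin (n₁ + n₂ + 1) => i.castSucc < l.succ) =
      insert l (Finset.univ.filter fun i : Fin (n₁ + n₂ + 1) => i.castSucc < l.castSucc) := by
    ext i
    simp [Fin.castSucc_lt_succ_iff, le_iff_eq_or_lt]
  unfold momentum
  rw [h, Finset.sum_insert (by simp)]
  abel

/-- The support of the delta function at the test function: `k_{n₁+1} - k_{n₁} = ξ`. -/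
theorem momentum_delta_xi (π : Pairing n₁ n₂) (x : π.Config) (j : Fin 2)
    (l : Fin (n₁ + n₂ + 1)) (hl : (l : ℕ) = n₁) :
    π.momentum x j l.succ - π.momentum x j l.castSucc = toTorus (x.2.2 j) := by
  rw [momentum_succ_sub, momentumStep, dif_pos hl]

/-- The support of an internal delta function. -/
theorem momentum_delta_internal (π : Pairing n₁ n₂) (x : π.Config) (j : Fin 2)
    (l l' : Position n₁ n₂) (h : π.partner (j, l) = (j, l')) :
    (π.momentum x j l.1.succ - π.momentum x j l.1.castSucc) +
      (π.momentum x j l'.1.succ - π.momentum x j l'.1.castSucc) = 0 := by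
  have h' : π.partner (j, l') = (j, l) := by rw [← h, π.partner_partner]
  have hf := π.isFirst_partner_iff (j, l)
  rw [h] at hf
  simp only [momentum_succ_sub, momentumStep, dif_neg l.2, dif_neg l'.2]
  by_cases hl : π.IsFirst (j, l)
  · have hl' : ¬ π.IsFirst (j, l') := fun h2 => hf.1 h2 hl
    simp [bulletMomentum, hl, hl', h']
  · have hl' : π.IsFirst (j, l') := hf.2 hl
    simp [bulletMomentum, hl, hl', h]

/-- The support of a transfer delta function. -/
theorem momentum_delta_transfer (π : Pairing n₁ n₂) (x : π.Config)
    (l l' : Position n₁ n₂) (h : π.partner (0, l) = (1, l')) :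
    (π.momentum x 0 l.1.succ - π.momentum x 0 l.1.castSucc) -
      (π.momentum x 1 l'.1.succ - π.momentum x 1 l'.1.castSucc) = 0 := by
  have h' : π.partner (1, l') = (0, l) := by rw [← h, π.partner_partner]
  have hl : π.IsFirst (0, l) := by simp [IsFirst, h]
  have hl' : ¬ π.IsFirst (1, l') := by simp [IsFirst, h']
  simp only [momentum_succ_sub, momentumStep, dif_neg l.2, dif_neg l'.2]
  simp [bulletMomentum, hl, hl', h']

end Pairing

/-- The sign convention `ε₁ = -ε` on the first and `ε₂ = ε` on the second line. -/
def signedEps (ε : ℝ) (j : Fin 2) : ℝ := (-1) ^ ((j : ℕ) + 1) * ε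

/-- The product `K⁽ʲ⁾` of all resolvents on the line `j`. -/
def resolventProduct (n₁ n₂ : ℕ) (j : Fin 2) (k : Fin (n₁ + n₂ + 2) → T3) (α β : ℂ) (ε : ℝ) : ℂ :=
  ∏ l : Fin (n₁ + n₂ + 2),
    if (l : ℕ) ≤ n₁ then 1 / (kineticEnergy (k l) - α + Complex.I * signedEps ε j)
    else 1 / (kineticEnergy (k l) - β - Complex.I * signedEps ε j)

/-- The factor of the line `j` that carries the test function,
`Ĵ_η(ξ, (k_{n₁} + k_{n₁+1})/2)`. Here `k_{n₁+1} = k_{n₁} + ξ` with `ξ ∈ ℝ³`, so that the midpoint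
is the well-defined point `k_{n₁} + ξ/2` of the torus. -/
def testFactor {n₁ n₂ : ℕ} (J : E3 → T3 → ℂ) (η : ℝ) (π : Pairing n₁ n₂) (x : π.Config)
    (j : Fin 2) : ℂ :=
  scaledFourier J η (x.2.2 j)
    (π.momentum x j ⟨n₁, by omega⟩ + toTorus ((2⁻¹ : ℝ) • x.2.2 j))

/-- The amplitude `Amp(π)` for the coupling constant `lam`, the scale `η = lam²`, the time `t`, the
regularization `ε` and the initial state `φ₀`. -/
def amplitude {n₁ n₂ : ℕ} (J : E3 → T3 → ℂ) (lam t ε : ℝ) (φ₀ : L2Z3) (π : Pairing n₁ n₂) : ℂ :=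
  (Real.exp (4 * ε * t) * lam ^ (2 * (n₁ + n₂)) / (2 * Real.pi) ^ 4 : ℝ) *
    integralI fun α₁ => integralIbar fun β₁ => integralIbar fun α₂ => integralI fun β₂ =>
      Complex.exp (-Complex.I * t * (α₁ - β₁ - α₂ + β₂)) *
        ∫ x : π.Config,
          testFactor J (lam ^ 2) π x 0 * conj (testFactor J (lam ^ 2) π x 1) *
          resolventProduct n₁ n₂ 0 (π.momentum x 0) α₁ β₁ ε *
          resolventProduct n₁ n₂ 1 (π.momentum x 1) α₂ β₂ ε *
          (latticeFourier φ₀ (π.momentum x 0 0) *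
            conj (latticeFourier φ₀ (π.momentum x 0 (Fin.last _))) *
            conj (latticeFourier φ₀ (π.momentum x 1 0)) *
            latticeFourier φ₀ (π.momentum x 1 (Fin.last _)))

end LatticeSchrodinger

end

section

open MeasureTheory Set
open scoped ENNReal Topology

namespace LatticeSchrodinger

/-! Write `n̄ = n₁ + n₂` and `N = n̄ + 1`. On the contours each resolvent is at most `12 / (|e(k) -
Re z| + ε)`, the exponential has modulus at most one, and the test functions are dominated by a
function of `ξ` whose integral does not depend on `η`. The inequality `xy ≤ x² + y²` separates the
wave functions at the two initial momenta from those at the two final ones, and reversing both lines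
(`PairedLines.reverse`) reduces the second case to the first. It remains to integrate `2(n̄ + 2)`
regularized resolvents over `n̄` pair momenta and four energies, uniformly in the initial momenta
and in `ξ`.

Every pair is opened at one of its two interactions, and the momentum right after the opening is its
loop momentum. The passage to loop momenta is triangular and preserves the measure. One resolvent
per loop momentum and one per energy can be integrated at the price of a logarithm each; bounding
the `n̄` others by `1/ε` would give `ε ^ (-n̄)`. The crossing improves this. There is a minimal one
(`PairedLines.exists_minimal_crossing`): interactions `b < s` such that `b` opens a pair, `s` closes
a pair opened before `b`, and everything in between is contracted in between. The enclosed steps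
cancel, so the momentum after `s` is `w_b ± w_f + c`, with `w_b`, `w_f` the loop momenta of the two
pairs and `c` depending only on pairs opened before the one closed at `s`. Integrating the three
resolvents at `w_b`, `w_f` and `w_b ± w_f + c` jointly costs `ε ^ (-4/5)` instead of `1/ε` up to
logarithms, which is the gain `ε ^ (1/5)`.

The analytic core is `lintegral_two_resolvents_le`. With the third coordinate fixed, the two
energies `e(k)` and `e(k + q)` serve as new coordinates. The fibres of this map have at most four
points outside one value (`encard_cosPair_fiber_le`), and its Jacobian is small only on a small set.
The resulting bound is uniform in both energies; its only singularity in `q` is `|sin 2πq₀| ^ (-κ)`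
with `κ < 1`, which the third resolvent integrates (`lintegral_resolvent_mul_crossBound_le`).

The energies complicate the order of integration, since those after the test function are themselves
integrated and may occur in the extra resolvent. The order `PairedLines.rank` is chosen so that the
resolvents used for these energies depend only on loop momenta opened before the test function;
`lintegral_crossing_le` treats the possible positions of the crossing. -/

/-- The area formula as an inequality: if almost every point has at most `N` preimages in `S`,
then `∫_S |det f'| g ∘ f ≤ N ∫ g`. -/
theorem lintegral_abs_det_mul_le_of_encard_le {E : Type*} [NormedAddCommGroup E]
    [NormedSpace ℝ E] [FiniteDimensional ℝ E] [MeasurableSpace E] [BorelSpace E]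
    (μ : Measure E) [μ.IsAddHaarMeasure] {S : Set E} (hS : MeasurableSet S) {f : E → E}
    {f' : E → E →L[ℝ] E} (hf : ∀ x ∈ S, HasStrictFDerivAt f (f' x) x)
    (hdet : ∀ x ∈ S, (f' x).det ≠ 0) {Z : Set E} (hZ : μ Z = 0) {N : ℕ}
    (hN : ∀ y ∉ Z, (S ∩ f ⁻¹' {y}).encard ≤ N) {g : E → ℝ≥0∞} (hg : Measurable g) :
    ∫⁻ x in S, ENNReal.ofReal |(f' x).det| * g (f x) ∂μ ≤ N * ∫⁻ y, g y ∂μ := by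
  have : CompleteSpace E := FiniteDimensional.complete ℝ E
  -- The inverse function theorem gives local injectivity. Countably many of the neighbourhoods
  -- cover `S`, and making them disjoint permits the injective change of variables on each piece.
  have hU : ∀ x ∈ S, ∃ U : Set E, IsOpen U ∧ x ∈ U ∧ InjOn f U := by
    intro x hx
    have h1 : HasStrictFDerivAt f
        (((f' x).toContinuousLinearEquivOfDetNeZero (hdet x hx) : E ≃L[ℝ] E) : E →L[ℝ] E) x := by
      have : (((f' x).toContinuousLinearEquivOfDetNeZero (hdet x hx) : E ≃L[ℝ] E) : E →L[ℝ] E)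
          = f' x := by ext; simp
      rw [this]; exact hf x hx
    exact ⟨(h1.toOpenPartialHomeomorph f).source, (h1.toOpenPartialHomeomorph f).open_source,
      h1.mem_toOpenPartialHomeomorph_source, (h1.toOpenPartialHomeomorph f).injOn⟩
  choose! U hUo hUx hUi using hU
  obtain ⟨t, htS, htc, htU⟩ := TopologicalSpace.countable_cover_nhdsWithin (f := U) (s := S)
    fun x hx => mem_nhdsWithin_of_mem_nhds ((hUo x hx).mem_nhds (hUx x hx))
  rcases t.eq_empty_or_nonempty with rfl | hne
  · have : S = ∅ := by simpa using htU
    simp [this]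
  obtain ⟨e, rfl⟩ := htc.exists_eq_range hne
  have heS : ∀ n, e n ∈ S := fun n => htS (mem_range_self n)
  set A : ℕ → Set E := fun n => S ∩ disjointed (fun n => U (e n)) n with hA
  have hAm : ∀ n, MeasurableSet (A n) := fun n =>
    hS.inter (MeasurableSet.disjointed (fun n => (hUo _ (heS n)).measurableSet) n)
  have hAd : Pairwise (Function.onFun Disjoint A) := fun i j hij =>
    ((disjoint_disjointed (fun n => U (e n))) hij).mono inter_subset_right inter_subset_right
  have hAS : ⋃ n, A n = S := by
    rw [hA, ← inter_iUnion, iUnion_disjointed]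
    exact inter_eq_left.2 (by simpa using htU)
  have hAi : ∀ n, InjOn f (A n) := fun n =>
    (hUi _ (heS n)).mono (inter_subset_right.trans (disjointed_subset _ _))
  have hAf : ∀ n, ∀ x ∈ A n, HasFDerivWithinAt f (f' x) (A n) x := fun n x hx =>
    (hf x hx.1).hasFDerivAt.hasFDerivWithinAt
  have hAim : ∀ n, MeasurableSet (f '' A n) := fun n =>
    measurable_image_of_fderivWithin (hAm n) (hAf n) (hAi n)
  calc ∫⁻ x in S, ENNReal.ofReal |(f' x).det| * g (f x) ∂μ
      = ∑' n, ∫⁻ x in A n, ENNReal.ofReal |(f' x).det| * g (f x) ∂μ := by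
        rw [← lintegral_iUnion hAm hAd, hAS]
    _ = ∑' n, ∫⁻ y, (f '' A n).indicator g y ∂μ := by
        congr 1; ext n
        rw [← lintegral_image_eq_lintegral_abs_det_fderiv_mul μ (hAm n) (hAf n) (hAi n) g,
          lintegral_indicator (hAim n)]
    _ = ∫⁻ y, ∑' n, (f '' A n).indicator g y ∂μ :=
        (lintegral_tsum fun n => (hg.indicator (hAim n)).aemeasurable).symm
    _ ≤ ∫⁻ y, N * g y ∂μ := by
        refine lintegral_mono_ae ?_
        have hZ' : ∀ᵐ y ∂μ, y ∉ Z := measure_eq_zero_iff_ae_notMem.1 hZ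
        filter_upwards [hZ'] with y hy
        -- The pieces are disjoint, so `y` lies in no more of their images than it has preimages.
        have h1 : ∀ n, (f '' A n).indicator g y
            = ({n | y ∈ f '' A n} : Set ℕ).indicator (fun _ => (1 : ℝ≥0∞)) n * g y := by
          intro n
          by_cases h : y ∈ f '' A n
          · rw [indicator_of_mem h, indicator_of_mem (by exact h), one_mul]
          · rw [indicator_of_notMem h, indicator_of_notMem (by exact h), zero_mul]
        simp_rw [h1]
        rw [ENNReal.tsum_mul_right]
        gcongr
        rw [← tsum_subtype, ENNReal.tsum_set_one]
        have h2 : ({n | y ∈ f '' A n} : Set ℕ).encard ≤ N := by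
          refine le_trans ?_ (hN y hy)
          have hc : ∀ n ∈ ({n | y ∈ f '' A n} : Set ℕ), ∃ x, x ∈ A n ∧ f x = y := fun n hn => hn
          choose! x hx hxy using hc
          refine encard_le_encard_of_injOn (f := x) (fun n hn => ⟨(hx n hn).1, hxy n hn⟩) ?_
          intro n hn m hm hnm
          by_contra hne
          exact (disjoint_left.1 (hAd hne) (hx n hn)) (hnm ▸ hx m hm)
        exact_mod_cast h2
    _ = N * ∫⁻ y, g y ∂μ := lintegral_const_mul _ hg

/-! ### The circle, its trigonometric functions and the dispersion relation -/

/-- The unit circle `ℝ / ℤ`. -/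
abbrev T1 : Type := UnitAddCircle

instance : IsProbabilityMeasure (volume : Measure T1) := ⟨by
  simp⟩

instance : (volume : Measure T3).IsAddHaarMeasure :=
  inferInstanceAs ((Measure.pi fun _ : Fin 3 => (volume : Measure T1)).IsAddHaarMeasure)

theorem periodic_sin_two_pi : Function.Periodic (fun x : ℝ => Real.sin (2 * Real.pi * x)) 1 := by
  intro x
  simp only [mul_add, mul_one]
  exact Real.sin_add_two_pi _

/-- The function `cos (2πx)` on the circle. -/
noncomputable def tcos : T1 → ℝ := periodic_cos_two_pi.lift

/-- The function `sin (2πx)` on the circle. -/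
noncomputable def tsin : T1 → ℝ := periodic_sin_two_pi.lift

@[simp] theorem tcos_coe (x : ℝ) : tcos (x : T1) = Real.cos (2 * Real.pi * x) := rfl

@[simp] theorem tsin_coe (x : ℝ) : tsin (x : T1) = Real.sin (2 * Real.pi * x) := rfl

theorem tsin_add (x y : T1) : tsin (x + y) = tsin x * tcos y + tcos x * tsin y := by
  induction x using QuotientAddGroup.induction_on
  induction y using QuotientAddGroup.induction_on
  rename_i x y
  have := Real.sin_add (2 * Real.pi * x) (2 * Real.pi * y)
  rw [← mul_add] at this
  exact this

theorem tcos_neg (x : T1) : tcos (-x) = tcos x := by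
  induction x using QuotientAddGroup.induction_on
  rename_i x
  have := Real.cos_neg (2 * Real.pi * x)
  rw [← mul_neg] at this
  exact this

theorem tsin_neg (x : T1) : tsin (-x) = -tsin x := by
  induction x using QuotientAddGroup.induction_on
  rename_i x
  have := Real.sin_neg (2 * Real.pi * x)
  rw [← mul_neg] at this
  exact this

theorem tsin_sq_add_tcos_sq (x : T1) : tsin x ^ 2 + tcos x ^ 2 = 1 := by
  induction x using QuotientAddGroup.induction_on
  exact Real.sin_sq_add_cos_sq _

theorem abs_tcos_le_one (x : T1) : |tcos x| ≤ 1 :=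
  abs_le_one_iff_mul_self_le_one.2 (by nlinarith [tsin_sq_add_tcos_sq x, sq_nonneg (tsin x)])

theorem continuous_tcos : Continuous tcos :=
  (by fun_prop : Continuous fun x : ℝ => Real.cos (2 * Real.pi * x)).quotient_lift _

theorem continuous_tsin : Continuous tsin :=
  (by fun_prop : Continuous fun x : ℝ => Real.sin (2 * Real.pi * x)).quotient_lift _

@[fun_prop] theorem measurable_tcos : Measurable tcos := continuous_tcos.measurable

@[fun_prop] theorem measurable_tsin : Measurable tsin := continuous_tsin.measurable

theorem kineticEnergy_eq (k : T3) :
    kineticEnergy k = 3 - (tcos (k 0) + tcos (k 1) + tcos (k 2)) := by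
  rw [kineticEnergy, Fin.sum_univ_three]
  rfl

theorem kineticEnergy_neg (k : T3) : kineticEnergy (-k) = kineticEnergy k := by
  simp only [kineticEnergy_eq, Pi.neg_apply, tcos_neg]

@[fun_prop] theorem measurable_kineticEnergy : Measurable kineticEnergy := by
  have : kineticEnergy = fun k => 3 - (tcos (k 0) + tcos (k 1) + tcos (k 2)) :=
    funext kineticEnergy_eq
  rw [this]
  fun_prop

theorem kineticEnergy_mem (k : T3) : kineticEnergy k ∈ Icc (0 : ℝ) 6 := by
  have h0 := abs_le.1 (abs_tcos_le_one (k 0))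
  have h1 := abs_le.1 (abs_tcos_le_one (k 1))
  have h2 := abs_le.1 (abs_tcos_le_one (k 2))
  rw [kineticEnergy_eq]
  constructor <;> linarith

/-! ### Regularized inverses and logarithmic integrals -/

/-- The regularized inverse `1 / (|x| + ε)`, as an extended nonnegative real. -/
noncomputable def regInv (ε x : ℝ) : ℝ≥0∞ := ENNReal.ofReal (|x| + ε)⁻¹

@[fun_prop] theorem measurable_regInv (ε : ℝ) : Measurable (regInv ε) := by
  unfold regInv
  fun_prop

theorem regInv_neg (ε x : ℝ) : regInv ε (-x) = regInv ε x := by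
  simp [regInv]

theorem regInv_le {ε : ℝ} (hε : 0 < ε) (x : ℝ) : regInv ε x ≤ ENNReal.ofReal ε⁻¹ := by
  refine ENNReal.ofReal_le_ofReal (inv_anti₀ hε ?_)
  linarith [abs_nonneg x]

theorem regInv_le_one {ε : ℝ} (hε : 0 < ε) {x : ℝ} (hx : 1 ≤ |x|) : regInv ε x ≤ 1 := by
  rw [← ENNReal.ofReal_one]
  refine ENNReal.ofReal_le_ofReal (inv_le_one_of_one_le₀ ?_)
  linarith

/-- The logarithmic factor `|log ε|`, as an extended nonnegative real. -/
noncomputable def ell (ε : ℝ) : ℝ≥0∞ := ENNReal.ofReal (-Real.log ε)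

/-- This is where `ε ≤ 1/3` meets `e < 3`. It lets bounded terms be absorbed into logarithms. -/
theorem one_le_neg_log {ε : ℝ} (hε : 0 < ε) (hε3 : ε ≤ 1 / 3) : 1 ≤ -Real.log ε := by
  have h1 : Real.log ε ≤ Real.log (1 / 3) := Real.log_le_log hε hε3
  have h2 : Real.log (1 / 3) = - Real.log 3 := by rw [one_div, Real.log_inv]
  have h3 : (1 : ℝ) ≤ Real.log 3 := by
    rw [Real.le_log_iff_exp_le (by norm_num)]
    exact (Real.exp_one_lt_d9.trans (by norm_num)).le
  linarith

theorem one_le_ell {ε : ℝ} (hε : 0 < ε) (hε3 : ε ≤ 1 / 3) : 1 ≤ ell ε := by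
  rw [ell, ← ENNReal.ofReal_one]
  exact ENNReal.ofReal_le_ofReal (one_le_neg_log hε hε3)

theorem lintegral_regInv_Icc_zero {ε : ℝ} (hε : 0 < ε) (hε3 : ε ≤ 1 / 3) :
    ∫⁻ t in Icc (-1 : ℝ) 1, regInv ε t ≤ 4 * ell ε := by
  have hint : ∀ a b : ℝ, IntervalIntegrable (fun t => (|t| + ε)⁻¹) volume a b := fun a b =>
    (Continuous.inv₀ (by fun_prop) fun t => by positivity).intervalIntegrable _ _
  have h1 : ∫⁻ t in Icc (-1 : ℝ) 1, regInv ε t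
      = ENNReal.ofReal (∫ t in (-1 : ℝ)..1, (|t| + ε)⁻¹) := by
    rw [intervalIntegral.integral_of_le (by norm_num), ← integral_Icc_eq_integral_Ioc,
      ofReal_integral_eq_lintegral_ofReal]
    · rfl
    · exact (intervalIntegrable_iff_integrableOn_Icc_of_le (by norm_num)).1 (hint _ _)
    · exact ae_of_all _ fun t => by positivity
  have h2 : ∫ t in (0 : ℝ)..1, (|t| + ε)⁻¹ = Real.log ((1 + ε) / ε) := by
    rw [intervalIntegral.integral_congr (g := fun t => (t + ε)⁻¹)]
    · rw [intervalIntegral.integral_comp_add_right (fun t => t⁻¹), integral_inv_of_pos]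
      · simp
      · simpa
      · positivity
    · intro t ht
      rw [uIcc_of_le zero_le_one] at ht
      simp [abs_of_nonneg ht.1]
  have h3 : ∫ t in (-1 : ℝ)..0, (|t| + ε)⁻¹ = Real.log ((1 + ε) / ε) := by
    rw [← h2]
    have := intervalIntegral.integral_comp_neg (a := 0) (b := 1) (fun t : ℝ => (|t| + ε)⁻¹)
    simpa using this.symm
  have h4 : Real.log ((1 + ε) / ε) ≤ 2 * (-Real.log ε) := by
    rw [Real.log_div (by positivity) hε.ne']
    have := one_le_neg_log hε hε3
    have h5 := Real.log_le_sub_one_of_pos (show 0 < 1 + ε by positivity)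
    linarith
  rw [h1, ← intervalIntegral.integral_add_adjacent_intervals (hint (-1) 0) (hint 0 1), h2, h3, ell,
    ← ENNReal.ofReal_ofNat, ← ENNReal.ofReal_mul (by norm_num)]
  refine ENNReal.ofReal_le_ofReal ?_
  linarith

/-- The region `|t + c| ≤ 1` produces the logarithm; elsewhere the integrand is at most one.
Uniformity in `c` is what makes all later bounds uniform in the energies. -/
theorem lintegral_regInv_add_le {ε : ℝ} (hε : 0 < ε) (hε3 : ε ≤ 1 / 3) (S : Set ℝ) (c : ℝ) :
    ∫⁻ t in S, regInv ε (t + c) ≤ 4 * ell ε + volume S := by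
  have h1 : ∀ t : ℝ, regInv ε (t + c)
      ≤ (Icc (-1 : ℝ) 1).indicator (regInv ε) (t + c) + 1 := by
    intro t
    by_cases h : t + c ∈ Icc (-1 : ℝ) 1
    · rw [indicator_of_mem h]; exact le_self_add
    · rw [indicator_of_notMem h, zero_add]
      refine regInv_le_one hε ?_
      by_contra h2
      exact h (abs_le.1 (not_le.1 h2).le)
  have hm : Measurable ((Icc (-1 : ℝ) 1).indicator (regInv ε)) :=
    (measurable_regInv ε).indicator measurableSet_Icc
  calc ∫⁻ t in S, regInv ε (t + c)
      ≤ ∫⁻ t in S, ((Icc (-1 : ℝ) 1).indicator (regInv ε) (t + c) + 1) := lintegral_mono h1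
    _ = (∫⁻ t in S, (Icc (-1 : ℝ) 1).indicator (regInv ε) (t + c)) + volume S := by
        rw [lintegral_add_right _ measurable_const, lintegral_one, Measure.restrict_apply_univ]
    _ ≤ (∫⁻ t, (Icc (-1 : ℝ) 1).indicator (regInv ε) (t + c)) + volume S := by
        gcongr; exact Measure.restrict_le_self
    _ ≤ 4 * ell ε + volume S := by
        rw [lintegral_add_right_eq_self (fun t => (Icc (-1 : ℝ) 1).indicator (regInv ε) t),
          lintegral_indicator measurableSet_Icc]
        gcongr
        exact lintegral_regInv_Icc_zero hε hε3

/-! ### One-dimensional integrals over the circle with sine weights -/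

theorem ennreal_rpow_anti {z : ℝ} (hz : z ≤ 0) {x y : ℝ≥0∞} (h : x ≤ y) : y ^ z ≤ x ^ z := by
  rw [← neg_neg z, ENNReal.rpow_neg y, ENNReal.rpow_neg x]
  exact ENNReal.inv_le_inv.2 (ENNReal.rpow_le_rpow h (neg_nonneg.2 hz))

theorem lintegral_T1 (t : ℝ) (f : T1 → ℝ≥0∞) :
    ∫⁻ x : T1, f x = ∫⁻ x in Ioc t (t + 1), f (x : T1) :=
  (UnitAddCircle.lintegral_preimage t f).symm

/-- Change of variables on an arc where the cosine is injective; the factor `2π` of the derivative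
exceeds one and is dropped. -/
theorem lintegral_abs_sin_mul_comp_cos_le {S : Set ℝ} (hS : MeasurableSet S)
    (hinj : InjOn (fun x : ℝ => Real.cos (2 * Real.pi * x)) S) (g : ℝ → ℝ≥0∞) :
    ∫⁻ x in S, ENNReal.ofReal |Real.sin (2 * Real.pi * x)| * g (Real.cos (2 * Real.pi * x))
      ≤ ∫⁻ t in Icc (-1 : ℝ) 1, g t := by
  have hd : ∀ x ∈ S, HasDerivWithinAt (fun x : ℝ => Real.cos (2 * Real.pi * x))
      (-Real.sin (2 * Real.pi * x) * (2 * Real.pi)) S x := by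
    intro x _
    have := ((hasDerivAt_id x).const_mul (2 * Real.pi)).cos
    simpa using this.hasDerivWithinAt
  have h1 := lintegral_image_eq_lintegral_abs_deriv_mul hS hd hinj g
  calc ∫⁻ x in S, ENNReal.ofReal |Real.sin (2 * Real.pi * x)| * g (Real.cos (2 * Real.pi * x))
      ≤ ∫⁻ x in S, ENNReal.ofReal |-Real.sin (2 * Real.pi * x) * (2 * Real.pi)|
          * g (Real.cos (2 * Real.pi * x)) := by
        refine lintegral_mono fun x => mul_le_mul_left (ENNReal.ofReal_le_ofReal ?_) _
        rw [abs_mul, abs_neg]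
        refine le_mul_of_one_le_right (abs_nonneg _) ?_
        rw [abs_of_pos Real.two_pi_pos]
        linarith [Real.pi_gt_three]
    _ = ∫⁻ t in (fun x : ℝ => Real.cos (2 * Real.pi * x)) '' S, g t := h1.symm
    _ ≤ ∫⁻ t in Icc (-1 : ℝ) 1, g t := by
        refine lintegral_mono_set ?_
        rintro _ ⟨x, -, rfl⟩
        exact ⟨Real.neg_one_le_cos _, Real.cos_le_one _⟩

/-- Substituting `t = cos (2πx)`. -/
theorem lintegral_tsin_mul_comp_tcos_le (g : ℝ → ℝ≥0∞) :
    ∫⁻ x : T1, ENNReal.ofReal |tsin x| * g (tcos x) ≤ 2 * ∫⁻ t in Icc (-1 : ℝ) 1, g t := by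
  have hpi := Real.pi_pos
  have h1 : InjOn (fun x : ℝ => Real.cos (2 * Real.pi * x)) (Icc 0 (1 / 2)) := by
    intro x hx y hy hxy
    have := Real.injOn_cos ⟨by nlinarith [hx.1], by nlinarith [hx.2]⟩
      ⟨by nlinarith [hy.1], by nlinarith [hy.2]⟩ hxy
    exact mul_left_cancel₀ Real.two_pi_pos.ne' this
  have h2 : InjOn (fun x : ℝ => Real.cos (2 * Real.pi * x)) (Icc (-(1 / 2)) 0) := by
    intro x hx y hy hxy
    have hx' : -x ∈ Icc (0 : ℝ) (1 / 2) := ⟨by linarith [hx.2], by linarith [hx.1]⟩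
    have hy' : -y ∈ Icc (0 : ℝ) (1 / 2) := ⟨by linarith [hy.2], by linarith [hy.1]⟩
    have := h1 hx' hy' (by simpa using hxy)
    exact neg_injective this
  rw [lintegral_T1 (-(1 / 2))]
  simp only [tsin_coe, tcos_coe]
  have hsub : Ioc (-(1 / 2) : ℝ) (-(1 / 2) + 1) ⊆ Icc (-(1 / 2)) 0 ∪ Icc 0 (1 / 2) := by
    intro x hx
    rcases le_total x 0 with h | h
    · exact Or.inl ⟨hx.1.le, h⟩
    · exact Or.inr ⟨h, by linarith [hx.2]⟩
  refine (lintegral_mono_set hsub).trans ((lintegral_union_le _ _ _).trans ?_)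
  rw [two_mul (∫⁻ t in Icc (-1 : ℝ) 1, g t)]
  exact add_le_add (lintegral_abs_sin_mul_comp_cos_le measurableSet_Icc h2 g)
    (lintegral_abs_sin_mul_comp_cos_le measurableSet_Icc h1 g)

theorem lintegral_regInv_Icc_le {ε : ℝ} (hε : 0 < ε) (hε3 : ε ≤ 1 / 3) {a b : ℝ} (c : ℝ)
    {n : ℕ} (hab : b - a ≤ n) : ∫⁻ t in Icc a b, regInv ε (t + c) ≤ (4 + n) * ell ε := by
  refine (lintegral_regInv_add_le hε hε3 _ c).trans ?_
  rw [Real.volume_Icc, add_mul]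
  gcongr
  calc ENNReal.ofReal (b - a) ≤ ENNReal.ofReal n := ENNReal.ofReal_le_ofReal hab
    _ = n * 1 := by simp
    _ ≤ n * ell ε := by gcongr; exact one_le_ell hε hε3

/-- The weight `|sin|` is the Jacobian of the cosine up to a constant, so it cancels the
singularities at the turning points and leaves a pure logarithm. -/
theorem lintegral_tsin_mul_regInv_le {ε : ℝ} (hε : 0 < ε) (hε3 : ε ≤ 1 / 3) (c : ℝ) :
    ∫⁻ x : T1, ENNReal.ofReal |tsin x| * regInv ε (tcos x + c) ≤ 12 * ell ε := by
  refine (lintegral_tsin_mul_comp_tcos_le fun t => regInv ε (t + c)).trans ?_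
  have := lintegral_regInv_Icc_le hε hε3 (a := -1) (b := 1) c (n := 2) (by norm_num)
  calc _ ≤ 2 * ((4 + (2 : ℕ)) * ell ε) := by gcongr
    _ = 12 * ell ε := by rw [← mul_assoc]; norm_num

/-- The integral of `|sin (2πx)| ^ (-κ)` over the circle. -/
noncomputable def sinInt (κ : ℝ) : ℝ≥0∞ := ∫⁻ x : T1, ENNReal.ofReal |tsin x| ^ (-κ)

theorem lintegral_abs_rpow_lt_top {κ : ℝ} (hκ : κ < 1) :
    ∫⁻ y in Icc (-1 : ℝ) 1, ENNReal.ofReal |y| ^ (-κ) < ⊤ := by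
  have h1 : ∫⁻ y in Icc (0 : ℝ) 1, ENNReal.ofReal |y| ^ (-κ) < ⊤ := by
    have hi : IntegrableOn (fun y : ℝ => y ^ (-κ)) (Ioc 0 1) :=
      (intervalIntegrable_iff_integrableOn_Ioc_of_le zero_le_one).1
        (intervalIntegral.intervalIntegrable_rpow' (by linarith))
    rw [setLIntegral_congr Ioc_ae_eq_Icc.symm]
    refine lt_of_le_of_lt (le_of_eq ?_) hi.lintegral_lt_top
    refine setLIntegral_congr_fun measurableSet_Ioc fun y hy => ?_
    rw [abs_of_pos hy.1, ENNReal.ofReal_rpow_of_pos hy.1]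
  have h2 : ∫⁻ y in Icc (-1 : ℝ) 0, ENNReal.ofReal |y| ^ (-κ)
      = ∫⁻ y in Icc (0 : ℝ) 1, ENNReal.ofReal |y| ^ (-κ) := by
    have := (Measure.measurePreserving_neg (volume : Measure ℝ)).setLIntegral_comp_preimage
      (s := Icc (0 : ℝ) 1) measurableSet_Icc
      (f := fun y => ENNReal.ofReal |y| ^ (-κ)) (by fun_prop)
    simpa using this
  have h3 : Icc (-1 : ℝ) 1 ⊆ Icc (-1) 0 ∪ Icc 0 1 := by
    intro x hx
    rcases le_total x 0 with h | h
    · exact Or.inl ⟨hx.1, h⟩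
    · exact Or.inr ⟨h, hx.2⟩
  refine ((lintegral_mono_set h3).trans (lintegral_union_le _ _ _)).trans_lt ?_
  rw [h2]
  exact ENNReal.add_lt_top.2 ⟨h1, h1⟩

/-- Near each of its zeros `0` and `±1/2` the sine is bounded below linearly by concavity. The
alternatives name the zero concerned, so that negative powers of the sine are dominated by a sum of
three power singularities. -/
theorem le_abs_sin_two_pi {x : ℝ} (hx : |x| ≤ 1 / 2) :
    |x| ≤ |Real.sin (2 * Real.pi * x)| ∨ |x - 1 / 2| ≤ |Real.sin (2 * Real.pi * x)| ∨
      |x + 1 / 2| ≤ |Real.sin (2 * Real.pi * x)| := by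
  have hpi := Real.pi_pos
  have key : ∀ y : ℝ, 0 ≤ y → y ≤ 1 / 4 → |y| ≤ |Real.sin (2 * Real.pi * y)| := by
    intro y h0 h1
    have := Real.mul_le_sin (x := 2 * Real.pi * y) (by positivity) (by nlinarith)
    have h2 : 2 / Real.pi * (2 * Real.pi * y) = 4 * y := by field_simp; ring
    rw [h2] at this
    rw [abs_of_nonneg h0]
    exact le_trans (by linarith) (this.trans (le_abs_self _))
  have key2 : ∀ y : ℝ, 0 ≤ y → y ≤ 1 / 2 → |y| ≤ |Real.sin (2 * Real.pi * y)| ∨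
      |y - 1 / 2| ≤ |Real.sin (2 * Real.pi * y)| := by
    intro y h0 h1
    rcases le_total y (1 / 4) with h | h
    · exact Or.inl (key y h0 h)
    · right
      have := key (1 / 2 - y) (by linarith) (by linarith)
      have h3 : 2 * Real.pi * (1 / 2 - y) = Real.pi - 2 * Real.pi * y := by ring
      rw [h3, Real.sin_pi_sub, abs_sub_comm] at this
      exact this
  rcases le_total 0 x with h | h
  · rcases key2 x h (by rwa [abs_of_nonneg h] at hx) with h | h
    · exact Or.inl h
    · exact Or.inr (Or.inl h)
  · rcases key2 (-x) (by linarith) (by rwa [abs_of_nonpos h] at hx) with h | h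
    · left; simpa using h
    · right; right
      rw [show -x - 1 / 2 = -(x + 1 / 2) by ring, abs_neg] at h
      simpa using h

theorem sinInt_lt_top {κ : ℝ} (hκ0 : 0 ≤ κ) (hκ : κ < 1) : sinInt κ < ⊤ := by
  have hanti : ∀ {x y : ℝ}, x ≤ y → ENNReal.ofReal y ^ (-κ) ≤ ENNReal.ofReal x ^ (-κ) :=
    fun h => ennreal_rpow_anti (by linarith) (ENNReal.ofReal_le_ofReal h)
  have hI : ∀ c : ℝ, |c| ≤ 1 / 2 →
      ∫⁻ x in Ioc (-(1 / 2) : ℝ) (-(1 / 2) + 1), ENNReal.ofReal |x + c| ^ (-κ) < ⊤ := by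
    intro c hc
    refine lt_of_le_of_lt ?_ (lintegral_abs_rpow_lt_top hκ)
    have h1 := abs_le.1 hc
    calc _ ≤ ∫⁻ x in (fun x : ℝ => x + c) ⁻¹' Icc (-1 : ℝ) 1, ENNReal.ofReal |x + c| ^ (-κ) := by
          refine lintegral_mono_set fun x hx => ?_
          exact ⟨by linarith [hx.1], by linarith [hx.2]⟩
      _ = _ := (measurePreserving_add_right (volume : Measure ℝ) c).setLIntegral_comp_preimage
          measurableSet_Icc (f := fun y => ENNReal.ofReal |y| ^ (-κ)) (by fun_prop)
  rw [sinInt, lintegral_T1 (-(1 / 2))]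
  have hpt : ∀ x ∈ Ioc (-(1 / 2) : ℝ) (-(1 / 2) + 1), ENNReal.ofReal |tsin (x : T1)| ^ (-κ) ≤
      ENNReal.ofReal |x + 0| ^ (-κ) + (ENNReal.ofReal |x + (-(1 / 2))| ^ (-κ)
        + ENNReal.ofReal |x + 1 / 2| ^ (-κ)) := by
    intro x hx
    rw [tsin_coe, add_zero]
    rcases le_abs_sin_two_pi (x := x) (abs_le.2 ⟨by linarith [hx.1], by linarith [hx.2]⟩)
      with h | h | h
    · exact (hanti h).trans le_self_add
    · exact (hanti h).trans (le_self_add.trans le_add_self)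
    · exact (hanti h).trans (le_add_self.trans le_add_self)
  refine (setLIntegral_mono' measurableSet_Ioc hpt).trans_lt ?_
  rw [lintegral_add_left (by fun_prop), lintegral_add_left (by fun_prop)]
  exact ENNReal.add_lt_top.2 ⟨hI 0 (by norm_num), ENNReal.add_lt_top.2
    ⟨hI _ (by norm_num [abs_of_pos]), hI _ (by rw [abs_of_pos]; norm_num)⟩⟩

theorem ae_tsin_ne_zero : ∀ᵐ x : T1, tsin x ≠ 0 := by
  have h := ae_lt_top (μ := (volume : Measure T1)) (f := fun x => ENNReal.ofReal |tsin x| ^ (-(1 / 2) : ℝ))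
    (by fun_prop) (sinInt_lt_top (κ := 1 / 2) (by norm_num) (by norm_num)).ne
  filter_upwards [h] with x hx h0
  simp [h0] at hx

theorem exists_polar (A B : ℝ) : ∃ φ : T1, A = √(A ^ 2 + B ^ 2) * tcos φ ∧
    B = √(A ^ 2 + B ^ 2) * tsin φ := by
  refine ⟨((Complex.arg ⟨A, B⟩ / (2 * Real.pi) : ℝ) : T1), ?_⟩
  have h : 2 * Real.pi * (Complex.arg ⟨A, B⟩ / (2 * Real.pi)) = Complex.arg ⟨A, B⟩ := by
    field_simp
  have hn : ‖(⟨A, B⟩ : ℂ)‖ = √(A ^ 2 + B ^ 2) := by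
    rw [Complex.norm_def, Complex.normSq_mk]
    ring_nf
  rw [tcos_coe, tsin_coe, h, ← hn]
  exact ⟨(Complex.norm_mul_cos_arg (⟨A, B⟩ : ℂ)).symm, (Complex.norm_mul_sin_arg (⟨A, B⟩ : ℂ)).symm⟩

/-- In polar form the combination is `r sin (x - φ)` with `r ≥ |B|`, and the translation by `φ`
preserves the integral. The absence of `A` from the bound is what allows its use for the Jacobian
below. -/
theorem lintegral_lin_trig_rpow_le {κ : ℝ} (hκ0 : 0 ≤ κ) (A B : ℝ) :
    ∫⁻ x : T1, ENNReal.ofReal |A * tsin x - B * tcos x| ^ (-κ)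
      ≤ ENNReal.ofReal |B| ^ (-κ) * sinInt κ := by
  obtain ⟨φ, hA, hB⟩ := exists_polar A B
  set r := √(A ^ 2 + B ^ 2) with hr
  have hBr : |B| ≤ r := Real.abs_le_sqrt (by nlinarith [sq_nonneg A])
  have h1 : ∀ x : T1, A * tsin x - B * tcos x = r * tsin (x + -φ) := by
    intro x
    rw [tsin_add, tcos_neg, tsin_neg]
    linear_combination (tsin x) * hA - tcos x * hB
  have hr0 : 0 ≤ r := Real.sqrt_nonneg _
  calc _ ≤ ∫⁻ x : T1, ENNReal.ofReal |B| ^ (-κ) * ENNReal.ofReal |tsin (x + -φ)| ^ (-κ) := by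
        refine lintegral_mono fun x => ?_
        rw [h1, abs_mul, abs_of_nonneg hr0, ENNReal.ofReal_mul hr0, ENNReal.rpow_neg,
          ENNReal.mul_rpow_of_nonneg _ _ hκ0]
        -- If `r = 0` then `B = 0`, and for `κ > 0` the right-hand side is infinite.
        rcases eq_or_ne r 0 with h0 | h0
        · have hB0 : B = 0 := abs_eq_zero.1 (le_antisymm (h0 ▸ hBr) (abs_nonneg _))
          rcases hκ0.eq_or_lt with rfl | hκ
          · simp
          · have hb : ENNReal.ofReal |B| ^ (-κ) = ⊤ := by simp [hB0, hκ]
            rw [hb, ENNReal.top_mul]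
            · exact le_top
            · rw [ENNReal.rpow_neg]
              simp only [ne_eq, ENNReal.inv_eq_zero, ENNReal.rpow_eq_top_iff]
              simp [hκ.not_gt]
        · have hrp : 0 < r := lt_of_le_of_ne hr0 (Ne.symm h0)
          rw [ENNReal.mul_inv, ← ENNReal.rpow_neg, ← ENNReal.rpow_neg]
          · gcongr ?_ * _
            exact ennreal_rpow_anti (by linarith) (ENNReal.ofReal_le_ofReal hBr)
          · left; simp [hrp, ENNReal.rpow_eq_zero_iff, hκ0.not_gt]
          · left; exact ENNReal.rpow_ne_top_of_nonneg hκ0 ENNReal.ofReal_ne_top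
    _ = _ := by
        rw [lintegral_const_mul _ (by fun_prop),
          lintegral_add_right_eq_self (fun x : T1 => ENNReal.ofReal |tsin x| ^ (-κ)), sinInt]

/-- One-dimensional bound for the resolvent with a weight `|sin| ^ γ`. -/
theorem lintegral_tsin_rpow_mul_regInv_le {ε : ℝ} (hε : 0 < ε) (hε3 : ε ≤ 1 / 3) {γ κ : ℝ}
    (hγ0 : 0 ≤ γ) (hγ1 : γ ≤ 1) (hκ0 : 0 ≤ κ) (hκ1 : κ ≤ 1) (c : ℝ) :
    ∫⁻ x : T1, ENNReal.ofReal |tsin x| ^ γ * regInv ε (tcos x + c)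
      ≤ ENNReal.ofReal ε ^ ((γ + κ) / 2 - 1) * (12 * ell ε + sinInt κ) := by
  set e := ENNReal.ofReal ε with he
  have he0 : e ≠ 0 := by simp [he, hε]
  have het : e ≠ ⊤ := ENNReal.ofReal_ne_top
  have he1 : e ≤ 1 := by rw [he, ENNReal.ofReal_le_one]; linarith
  have heinv : ENNReal.ofReal ε⁻¹ = e⁻¹ := ENNReal.ofReal_inv_of_pos hε
  -- The circle is split at `|sin| = ε ^ (1/2)`. Above it, `s ^ γ ≤ m ^ (γ - 1) * s` supplies the
  -- full Jacobian weight. Below it, the resolvent is bounded by `1/ε` and `s ^ γ ≤ m ^ (γ + κ) * s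
  -- ^ (-κ)` measures the smallness of the region.
  set m := e ^ (1 / 2 : ℝ) with hm
  have hm0 : m ≠ 0 := by simp [hm, he0, het]
  have hmt : m ≠ ⊤ := ENNReal.rpow_ne_top_of_nonneg (by norm_num) het
  have hpt : ∀ x : T1, tsin x ≠ 0 → ENNReal.ofReal |tsin x| ^ γ * regInv ε (tcos x + c) ≤
      m ^ (γ - 1) * (ENNReal.ofReal |tsin x| * regInv ε (tcos x + c))
        + m ^ (γ + κ) * e⁻¹ * ENNReal.ofReal |tsin x| ^ (-κ) := by
    intro x hx
    set s := ENNReal.ofReal |tsin x| with hs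
    have hs0 : s ≠ 0 := by simp [hs, hx]
    have hst : s ≠ ⊤ := ENNReal.ofReal_ne_top
    rcases le_total m s with h | h
    · refine le_trans ?_ le_self_add
      rw [← mul_assoc]
      gcongr
      calc s ^ γ = s ^ (γ - 1) * s := by
            conv_rhs => rw [← ENNReal.rpow_one s]
            rw [← ENNReal.rpow_mul, one_mul, ← ENNReal.rpow_add _ _ hs0 hst]; simp
        _ ≤ m ^ (γ - 1) * s := by
            gcongr ?_ * _
            exact ennreal_rpow_anti (by linarith) h
    · refine le_trans ?_ le_add_self
      rw [← heinv, mul_right_comm]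
      refine mul_le_mul' ?_ (regInv_le hε _)
      calc s ^ γ = s ^ (γ + κ) * s ^ (-κ) := by
            rw [← ENNReal.rpow_add _ _ hs0 hst]; ring_nf
        _ ≤ m ^ (γ + κ) * s ^ (-κ) := by gcongr
  calc _ ≤ ∫⁻ x : T1, (m ^ (γ - 1) * (ENNReal.ofReal |tsin x| * regInv ε (tcos x + c))
        + m ^ (γ + κ) * e⁻¹ * ENNReal.ofReal |tsin x| ^ (-κ)) := by
        refine lintegral_mono_ae ?_
        filter_upwards [ae_tsin_ne_zero] with x hx using hpt x hx
    _ = m ^ (γ - 1) * (∫⁻ x : T1, ENNReal.ofReal |tsin x| * regInv ε (tcos x + c))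
        + m ^ (γ + κ) * e⁻¹ * sinInt κ := by
        rw [lintegral_add_left (by fun_prop), lintegral_const_mul _ (by fun_prop),
          lintegral_const_mul _ (by fun_prop), sinInt]
    _ ≤ e ^ ((γ + κ) / 2 - 1) * (12 * ell ε) + e ^ ((γ + κ) / 2 - 1) * sinInt κ := by
        gcongr ?_ * ?_ + ?_ * _
        · rw [hm, ← ENNReal.rpow_mul]
          exact ENNReal.rpow_le_rpow_of_exponent_ge he1 (by linarith)
        · exact lintegral_tsin_mul_regInv_le hε hε3 c
        · rw [hm, ← ENNReal.rpow_mul, ← ENNReal.rpow_neg_one, ← ENNReal.rpow_add _ _ he0 het]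
          exact (congrArg _ (by ring)).le
    _ = _ := (mul_add _ _ _).symm

/-! ### Integrals over the three-dimensional torus and a single resolvent -/

theorem lintegral_pi_succAbove {n : ℕ} (i : Fin (n + 1)) {f : (Fin (n + 1) → T1) → ℝ≥0∞}
    (hf : Measurable f) :
    ∫⁻ k, f k = ∫⁻ v : Fin n → T1, ∫⁻ x : T1, f (i.insertNth x v) := by
  have h := (volume_preserving_piFinSuccAbove (fun _ : Fin (n + 1) => T1) i).symm
  rw [← h.lintegral_comp hf]
  have hm : Measurable fun p : T1 × (Fin n → T1) =>
      f ((MeasurableEquiv.piFinSuccAbove (fun _ : Fin (n + 1) => T1) i).symm p) :=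
    hf.comp (MeasurableEquiv.measurable _)
  exact lintegral_prod_symm' _ hm

theorem measurable_insertNth {n : ℕ} (i : Fin (n + 1)) :
    Measurable fun p : T1 × (Fin n → T1) => (i.insertNth p.1 p.2 : Fin (n + 1) → T1) :=
  (MeasurableEquiv.piFinSuccAbove (fun _ : Fin (n + 1) => T1) i).symm.measurable

theorem lintegral_prod_fin_two (g : T1 → ℝ≥0∞) (hg : Measurable g) :
    ∫⁻ v : Fin 2 → T1, ∏ j, g (v j) = (∫⁻ x, g x) * ∫⁻ x, g x := by
  have h := (volume_preserving_finTwoArrow T1).symm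
  rw [← h.lintegral_comp (by fun_prop)]
  have : ∀ p : T1 × T1, ∏ j, g ((MeasurableEquiv.finTwoArrow (α := T1)).symm p j) = g p.1 * g p.2 := by
    intro p
    rw [Fin.prod_univ_two]; rfl
  simp_rw [this]
  exact lintegral_prod_mul hg.aemeasurable hg.aemeasurable

theorem lintegral_pi_fin_three {f : T3 → ℝ≥0∞} (hf : Measurable f) :
    ∫⁻ k, f k = ∫⁻ z : T1, ∫⁻ y : T1, ∫⁻ x : T1, f ![x, y, z] := by
  rw [lintegral_pi_succAbove 0 hf]
  have h := (volume_preserving_finTwoArrow T1).symm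
  have hm : Measurable fun v : Fin 2 → T1 => ∫⁻ x : T1, f ((0 : Fin 3).insertNth x v) := by
    refine Measurable.lintegral_prod_left' (f := fun p : T1 × (Fin 2 → T1) =>
      f ((0 : Fin 3).insertNth p.1 p.2)) ?_
    exact hf.comp (measurable_insertNth 0)
  rw [← h.lintegral_comp hm]
  rw [Measure.volume_eq_prod]
  refine (lintegral_prod_symm' _ (hm.comp (MeasurableEquiv.measurable _))).trans ?_
  refine lintegral_congr fun z => lintegral_congr fun y => lintegral_congr fun x => ?_
  congr 1
  ext j
  fin_cases j <;> rfl

/-- The term of the largest `s i` alone suffices, since its other factors are at least `s i ^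
(-1/2)` each. This replaces a partition of the torus by the coordinate with the largest sine. -/
theorem one_le_sum_weights (s : Fin 3 → ℝ≥0∞) (h0 : ∀ i, s i ≠ 0) (ht : ∀ i, s i ≠ ⊤) :
    1 ≤ ∑ i, s i * ∏ j : Fin 2, s (i.succAbove j) ^ (-(1 / 2) : ℝ) := by
  obtain ⟨i, -, hi⟩ := Finset.exists_max_image Finset.univ s ⟨0, Finset.mem_univ _⟩
  refine le_trans ?_ (Finset.single_le_sum
    (f := fun i => s i * ∏ j : Fin 2, s (i.succAbove j) ^ (-(1 / 2) : ℝ))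
    (fun _ _ => zero_le) (Finset.mem_univ i))
  calc (1 : ℝ≥0∞) = s i * ∏ j : Fin 2, s i ^ (-(1 / 2) : ℝ) := by
        rw [Fin.prod_univ_two, ← ENNReal.rpow_add _ _ (h0 i) (ht i)]
        norm_num
        rw [ENNReal.rpow_neg_one, ENNReal.mul_inv_cancel (h0 i) (ht i)]
    _ ≤ _ := by
        refine mul_le_mul_right (Finset.prod_le_prod' fun j _ => ?_) _
        exact ennreal_rpow_anti (by norm_num) (hi _ (Finset.mem_univ _))

theorem ae_T3_tsin_ne_zero : ∀ᵐ k : T3, ∀ i, tsin (k i) ≠ 0 := by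
  rw [ae_all_iff]
  intro i
  have h : MeasurePreserving (fun k : T3 => k i) volume volume :=
    measurePreserving_eval (fun _ : Fin 3 => (volume : Measure T1)) i
  exact h.quasiMeasurePreserving.ae ae_tsin_ne_zero

theorem kineticEnergy_insertNth (i : Fin 3) (x : T1) (v : Fin 2 → T1) :
    kineticEnergy (i.insertNth x v : Fin 3 → T1) = 3 - (tcos x + ∑ j, tcos (v j)) := by
  have : kineticEnergy (i.insertNth x v : Fin 3 → T1)
      = 3 - ∑ l, tcos ((i.insertNth x v : Fin 3 → T1) l) := rfl
  rw [this, Fin.sum_univ_succAbove _ i]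
  simp

/-- The constant in the bound for the integral of one resolvent over the torus. -/
noncomputable def resConst : ℝ≥0∞ := 36 * (sinInt (1 / 2) * sinInt (1 / 2))

theorem resConst_ne_top : resConst ≠ ⊤ := by
  have := (sinInt_lt_top (κ := 1 / 2) (by norm_num) (by norm_num)).ne
  exact ENNReal.mul_ne_top (by norm_num) (ENNReal.mul_ne_top this this)

/-- The integral of one resolvent over the torus is logarithmic in `ε`. -/
theorem lintegral_resolvent_le {ε : ℝ} (hε : 0 < ε) (hε3 : ε ≤ 1 / 3) (a : ℝ) :
    ∫⁻ k : T3, regInv ε (kineticEnergy k - a) ≤ resConst * ell ε := by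
  set s : T1 → ℝ≥0∞ := fun x => ENNReal.ofReal |tsin x| with hs
  have hsm : Measurable s := by fun_prop
  have hterm : ∀ i : Fin 3, Measurable fun k : T3 => s (k i)
      * (∏ j : Fin 2, s (k (i.succAbove j)) ^ (-(1 / 2) : ℝ)) * regInv ε (kineticEnergy k - a) := by
    intro i; fun_prop
  -- All three sines vanish at some critical points of `e`, so a single coordinate does not serve
  -- everywhere. In the `i`-th term the factor `s (k i)` is the Jacobian weight for integrating the
  -- `i`-th coordinate, and the powers `-1/2` of the other two are integrable.
  calc ∫⁻ k : T3, regInv ε (kineticEnergy k - a)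
      ≤ ∫⁻ k : T3, ∑ i, s (k i) * (∏ j : Fin 2, s (k (i.succAbove j)) ^ (-(1 / 2) : ℝ))
          * regInv ε (kineticEnergy k - a) := by
        refine lintegral_mono_ae ?_
        filter_upwards [ae_T3_tsin_ne_zero] with k hk
        rw [← Finset.sum_mul]
        refine le_mul_of_one_le_left zero_le ?_
        exact one_le_sum_weights (fun i => s (k i)) (fun i => by simp [hs, hk i])
          fun i => ENNReal.ofReal_ne_top
    _ = ∑ i, ∫⁻ k : T3, s (k i) * (∏ j : Fin 2, s (k (i.succAbove j)) ^ (-(1 / 2) : ℝ))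
          * regInv ε (kineticEnergy k - a) := lintegral_finsetSum _ fun i _ => hterm i
    _ ≤ ∑ i : Fin 3, 12 * ell ε * (sinInt (1 / 2) * sinInt (1 / 2)) := by
        refine Finset.sum_le_sum fun i _ => ?_
        rw [lintegral_pi_succAbove i (hterm i)]
        calc _ ≤ ∫⁻ v : Fin 2 → T1, 12 * ell ε * ∏ j, s (v j) ^ (-(1 / 2) : ℝ) := by
              refine lintegral_mono fun v => ?_
              have h1 : ∀ x : T1, s ((i.insertNth x v : Fin 3 → T1) i)
                  * (∏ j : Fin 2, s ((i.insertNth x v : Fin 3 → T1) (i.succAbove j)) ^ (-(1 / 2) : ℝ))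
                  * regInv ε (kineticEnergy (i.insertNth x v : Fin 3 → T1) - a)
                  = (s x * regInv ε (tcos x + (∑ j, tcos (v j) - 3 + a)))
                    * ∏ j, s (v j) ^ (-(1 / 2) : ℝ) := by
                intro x
                rw [kineticEnergy_insertNth, ← regInv_neg]
                simp only [Fin.insertNth_apply_same, Fin.insertNth_apply_succAbove]
                rw [mul_right_comm]
                congr 3
                ring
              simp_rw [h1]
              rw [lintegral_mul_const _ (by fun_prop)]
              gcongr
              exact lintegral_tsin_mul_regInv_le hε hε3 _
          _ = _ := by
              rw [lintegral_const_mul _ (by fun_prop),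
                lintegral_prod_fin_two (fun x => s x ^ (-(1 / 2) : ℝ)) (by fun_prop)]
              rfl
    _ = resConst * ell ε := by
        rw [Finset.sum_const, resConst, Finset.card_univ, Fintype.card_fin, nsmul_eq_mul]
        push_cast
        ring

/-! ### Fibres and Jacobian of the map to the two energies -/

/-- The polynomial whose roots on the unit circle are the candidates for `exp (2πi θ₂)`. -/
noncomputable def fiberPoly (cx sx cy sy u v : ℝ) : Polynomial ℂ :=
  let d : ℂ := v - cx * u
  let P : ℂ := ((cx - cy : ℝ) - Complex.I * sy) / 2
  let Q : ℂ := ((cx - cy : ℝ) + Complex.I * sy) / 2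
  Polynomial.C (P ^ 2 + sx ^ 2 / 4) * Polynomial.X ^ 4
    + Polynomial.C (2 * d * P - u * sx ^ 2) * Polynomial.X ^ 3
    + Polynomial.C (d ^ 2 + 2 * P * Q - sx ^ 2 * (1 - u ^ 2 - 1 / 2)) * Polynomial.X ^ 2
    + Polynomial.C (2 * d * Q - u * sx ^ 2) * Polynomial.X
    + Polynomial.C (Q ^ 2 + sx ^ 2 / 4)

theorem natDegree_fiberPoly_le (cx sx cy sy u v : ℝ) :
    (fiberPoly cx sx cy sy u v).natDegree ≤ 4 := by
  have h : ∀ a b c d e : ℂ, (Polynomial.C a * Polynomial.X ^ 4 + Polynomial.C b * Polynomial.X ^ 3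
      + Polynomial.C c * Polynomial.X ^ 2 + Polynomial.C d * Polynomial.X
      + Polynomial.C e).natDegree ≤ 4 := by
    intro a b c d e
    compute_degree
  exact h _ _ _ _ _

/-- If the leading coefficient vanishes, then `sy ≠ 0` and `cx = cy`. The coefficient of `X ^ 3`
becomes `-i d sy - u sx ^ 2` with `d = v - cx u`, so its imaginary and real parts give `d = 0` and
`u = 0`. The origin has to be excluded: for equal shifts its fibre contains the curve `θ₂ = θ₁ +
1/2`. -/
theorem fiberPoly_ne_zero {cx sx cy sy u v : ℝ} (hsx : sx ≠ 0) (huv : (u, v) ≠ 0) :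
    fiberPoly cx sx cy sy u v ≠ 0 := by
  intro h
  have h4 := congrArg (fun p => Polynomial.coeff p 4) h
  have h3 := congrArg (fun p => Polynomial.coeff p 3) h
  simp only [fiberPoly, Polynomial.coeff_add, Polynomial.coeff_C_mul, Polynomial.coeff_X_pow,
    Polynomial.coeff_X, Polynomial.coeff_C, Polynomial.coeff_zero] at h4 h3
  norm_num at h4 h3
  have a1 := congrArg Complex.re h4
  have a2 := congrArg Complex.im h4
  have a3 := congrArg Complex.re h3
  have a4 := congrArg Complex.im h3
  have e2 : ((2 : ℂ)).re = 2 := rfl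
  simp [pow_two, Complex.add_re, Complex.mul_re, Complex.mul_im] at a1 a2 a3 a4
  have b1 : (cx - cy) ^ 2 - sy ^ 2 + sx ^ 2 = 0 := by nlinarith
  have b2 : (cx - cy) * sy = 0 := by nlinarith
  have hsx2 : 0 < sx ^ 2 := by positivity
  have b3 : sy ≠ 0 := by
    rintro rfl
    nlinarith [sq_nonneg (cx - cy)]
  have b4 : cx - cy = 0 := by
    rcases mul_eq_zero.1 b2 with h | h
    · exact h
    · exact absurd h b3
  have b5 : v - cx * u = 0 := a4.resolve_right b3
  have b6 : u * sx ^ 2 = 0 := by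
    rw [b4] at a3
    nlinarith
  have b7 : u = 0 := by
    rcases mul_eq_zero.1 b6 with h | h
    · exact h
    · exact absurd h hsx2.ne'
  apply huv
  subst b7
  simp at b5
  simp [b5]

/-- The hypothesis `hT` results from eliminating the first angle: the second equation determines
`sin θ₁ sin x`, whose square is rewritten with `sin² = 1 - cos²`. On the unit circle `2z cos θ₂ = z²
+ 1` and `2iz sin θ₂ = z² - 1`, so multiplication by `(2z)²` makes it polynomial in `z`. -/
theorem isRoot_fiberPoly {cx sx cy sy u v c2 s2 : ℝ} (h2 : s2 ^ 2 + c2 ^ 2 = 1)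
    (hT : (v - c2 * cy + s2 * sy - cx * (u - c2)) ^ 2 = sx ^ 2 * (1 - (u - c2) ^ 2)) :
    (fiberPoly cx sx cy sy u v).IsRoot (c2 + Complex.I * s2) := by
  have hc : ((s2 : ℂ)) ^ 2 + (c2 : ℂ) ^ 2 = 1 := by exact_mod_cast h2
  have hTc : ((v : ℂ) - c2 * cy + s2 * sy - cx * (u - c2)) ^ 2
      = sx ^ 2 * (1 - (u - c2) ^ 2) := by exact_mod_cast hT
  set z : ℂ := c2 + Complex.I * s2 with hz
  have hI := Complex.I_sq
  have hzc : z * (c2 - Complex.I * s2) = 1 := by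
    rw [hz]; linear_combination hc - (s2 : ℂ) ^ 2 * hI
  have e1 : 2 * z * c2 = z ^ 2 + 1 := by
    rw [hz]; linear_combination hc - (s2 : ℂ) ^ 2 * hI
  have e2 : 2 * Complex.I * z * s2 = z ^ 2 - 1 := by
    rw [hz]; linear_combination -hc + (s2 : ℂ) ^ 2 * hI
  have e3 : 2 * z * s2 = -Complex.I * (z ^ 2 - 1) := by
    linear_combination (-Complex.I) * e2 + 2 * z * s2 * hI
  have hz0 : z ≠ 0 := left_ne_zero_of_mul_eq_one hzc
  have key : 4 * (Polynomial.eval z (fiberPoly cx sx cy sy u v)) = 0 := by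
    have : (2 * z * ((v : ℂ) - c2 * cy + s2 * sy - cx * (u - c2))) ^ 2
        = sx ^ 2 * ((2 * z) ^ 2 - (2 * z * (u - c2)) ^ 2) := by
      linear_combination (2 * z) ^ 2 * hTc
    have r1 : 2 * z * ((v : ℂ) - c2 * cy + s2 * sy - cx * (u - c2))
        = 2 * z * (v - cx * u) + (cx - cy) * (z ^ 2 + 1) - Complex.I * sy * (z ^ 2 - 1) := by
      linear_combination (cx - cy : ℂ) * e1 + (sy : ℂ) * e3
    have r2 : 2 * z * ((u : ℂ) - c2) = 2 * z * u - (z ^ 2 + 1) := by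
      linear_combination -e1
    rw [r1, r2] at this
    simp only [fiberPoly, Polynomial.eval_add, Polynomial.eval_mul, Polynomial.eval_C,
      Polynomial.eval_pow, Polynomial.eval_X]
    push_cast
    linear_combination this
  rw [Polynomial.IsRoot.def]
  simpa using key

/-- The pair `(cos θ₁ + cos θ₂, cos (θ₁ + x) + cos (θ₂ + y))` in real coordinates. -/
noncomputable def cosPair (x y : ℝ) (p : ℝ × ℝ) : ℝ × ℝ :=
  (Real.cos (2 * Real.pi * p.1) + Real.cos (2 * Real.pi * p.2),
    Real.cos (2 * Real.pi * (p.1 + x)) + Real.cos (2 * Real.pi * (p.2 + y)))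

theorem cos_sin_two_pi_injOn {a b t : ℝ} (ha : a ∈ Ioc t (t + 1)) (hb : b ∈ Ioc t (t + 1))
    (hc : Real.cos (2 * Real.pi * a) = Real.cos (2 * Real.pi * b))
    (hs : Real.sin (2 * Real.pi * a) = Real.sin (2 * Real.pi * b)) : a = b := by
  have h1 : Real.cos (2 * Real.pi * a - 2 * Real.pi * b) = 1 := by
    rw [Real.cos_sub, hc, hs]
    nlinarith [Real.sin_sq_add_cos_sq (2 * Real.pi * b)]
  obtain ⟨n, hn⟩ := (Real.cos_eq_one_iff _).1 h1
  have h2 : (n : ℝ) = a - b := by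
    have := Real.two_pi_pos
    field_simp at hn
    nlinarith
  have h3 : |(n : ℝ)| < 1 := by
    rw [h2, abs_lt]
    constructor <;> linarith [ha.1, ha.2, hb.1, hb.2]
  have h4 : n = 0 := by
    have : |n| < 1 := by exact_mod_cast h3
    exact Int.abs_lt_one_iff.1 this
  rw [h4] at h2
  simp at h2
  linarith

/-- The second angle is a root of a nonzero polynomial of degree at most four and determines the
first: one equation yields `cos θ₁`, the other `sin θ₁` because `sin x ≠ 0`. -/
theorem encard_cosPair_fiber_le {x y t : ℝ} (hx : Real.sin (2 * Real.pi * x) ≠ 0) {w : ℝ × ℝ}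
    (hw : w ≠ 0) :
    ((Ioc t (t + 1) ×ˢ Ioc t (t + 1)) ∩ cosPair x y ⁻¹' {w}).encard ≤ (4 : ℕ) := by
  obtain ⟨u, v⟩ := w
  set cx := Real.cos (2 * Real.pi * x)
  set sx := Real.sin (2 * Real.pi * x)
  set cy := Real.cos (2 * Real.pi * y)
  set sy := Real.sin (2 * Real.pi * y)
  set F := fiberPoly cx sx cy sy u v
  have hF : F ≠ 0 := fiberPoly_ne_zero hx hw
  let φ : ℝ × ℝ → ℂ := fun p => Real.cos (2 * Real.pi * p.2) + Complex.I * Real.sin (2 * Real.pi * p.2)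
  have heq : ∀ p ∈ (Ioc t (t + 1) ×ˢ Ioc t (t + 1)) ∩ cosPair x y ⁻¹' {(u, v)},
      Real.cos (2 * Real.pi * p.1) = u - Real.cos (2 * Real.pi * p.2) ∧
      Real.cos (2 * Real.pi * p.1) * cx - Real.sin (2 * Real.pi * p.1) * sx
        = v - (Real.cos (2 * Real.pi * p.2) * cy - Real.sin (2 * Real.pi * p.2) * sy) := by
    rintro p ⟨-, hp⟩
    have hp' : cosPair x y p = (u, v) := hp
    have h1 := congrArg Prod.fst hp'
    have h2 := congrArg Prod.snd hp'
    simp only [cosPair, mul_add, Real.cos_add] at h1 h2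
    exact ⟨by linarith, by linarith⟩
  have hmaps : MapsTo φ ((Ioc t (t + 1) ×ˢ Ioc t (t + 1)) ∩ cosPair x y ⁻¹' {(u, v)})
      (F.roots.toFinset : Set ℂ) := by
    intro p hp
    obtain ⟨h1, h2⟩ := heq p hp
    rw [Finset.mem_coe, Multiset.mem_toFinset, Polynomial.mem_roots hF]
    refine isRoot_fiberPoly (Real.sin_sq_add_cos_sq _) ?_
    rw [← h1]
    have h3 := Real.sin_sq_add_cos_sq (2 * Real.pi * p.1)
    have h4 : v - Real.cos (2 * Real.pi * p.2) * cy + Real.sin (2 * Real.pi * p.2) * sy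
        - cx * Real.cos (2 * Real.pi * p.1) = -(Real.sin (2 * Real.pi * p.1) * sx) := by linarith
    rw [h4]
    linear_combination sx ^ 2 * h3
  have hinj : InjOn φ ((Ioc t (t + 1) ×ˢ Ioc t (t + 1)) ∩ cosPair x y ⁻¹' {(u, v)}) := by
    intro p hp q hq hpq
    have hre := congrArg Complex.re hpq
    have him := congrArg Complex.im hpq
    simp only [φ, Complex.add_re, Complex.add_im, Complex.mul_re, Complex.mul_im,
      Complex.ofReal_re, Complex.ofReal_im, Complex.I_re, Complex.I_im] at hre him
    norm_num at hre him
    obtain ⟨h1, h2⟩ := heq p hp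
    obtain ⟨h3, h4⟩ := heq q hq
    have hc : Real.cos (2 * Real.pi * p.1) = Real.cos (2 * Real.pi * q.1) := by
      rw [h1, h3, hre]
    have hs : Real.sin (2 * Real.pi * p.1) = Real.sin (2 * Real.pi * q.1) := by
      apply mul_right_cancel₀ hx
      rw [hc, hre, him] at h2
      linarith
    exact Prod.ext (cos_sin_two_pi_injOn hp.1.1 hq.1.1 hc hs)
      (cos_sin_two_pi_injOn hp.1.2 hq.1.2 hre him)
  refine (encard_le_encard_of_injOn hmaps hinj).trans ?_
  rw [encard_coe_eq_coe_finsetCard]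
  exact_mod_cast (Multiset.toFinset_card_le _).trans ((Polynomial.card_roots' F).trans
    (natDegree_fiberPoly_le _ _ _ _ _ _))

/-- The derivative of `cosPair`. -/
noncomputable def cosPairDeriv (x y : ℝ) (p : ℝ × ℝ) : ℝ × ℝ →L[ℝ] ℝ × ℝ :=
  (Matrix.toLin (.finTwoProd ℝ) (.finTwoProd ℝ)
    !![-Real.sin (2 * Real.pi * p.1) * (2 * Real.pi), -Real.sin (2 * Real.pi * p.2) * (2 * Real.pi);
      -Real.sin (2 * Real.pi * (p.1 + x)) * (2 * Real.pi),
      -Real.sin (2 * Real.pi * (p.2 + y)) * (2 * Real.pi)]).toContinuousLinearMap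

theorem hasStrictFDerivAt_cosPair (x y : ℝ) (p : ℝ × ℝ) :
    HasStrictFDerivAt (cosPair x y) (cosPairDeriv x y p) p := by
  unfold cosPairDeriv
  rw [Matrix.toLin_finTwoProd_toContinuousLinearMap]
  have hd : ∀ c a : ℝ, HasStrictDerivAt (fun s : ℝ => Real.cos (2 * Real.pi * (s + c)))
      (-Real.sin (2 * Real.pi * (a + c)) * (2 * Real.pi)) a := by
    intro c a
    have := (((hasStrictDerivAt_id a).add_const c).const_mul (2 * Real.pi)).cos
    simpa using this
  have hd0 : ∀ a : ℝ, HasStrictDerivAt (fun s : ℝ => Real.cos (2 * Real.pi * s))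
      (-Real.sin (2 * Real.pi * a) * (2 * Real.pi)) a := by
    intro a; simpa using hd 0 a
  exact HasStrictFDerivAt.prodMk
    (((hd0 p.1).comp_hasStrictFDerivAt p hasStrictFDerivAt_fst).add
      ((hd0 p.2).comp_hasStrictFDerivAt p hasStrictFDerivAt_snd))
    (((hd x p.1).comp_hasStrictFDerivAt p hasStrictFDerivAt_fst).add
      ((hd y p.2).comp_hasStrictFDerivAt p hasStrictFDerivAt_snd))

/-- The Jacobian of `cosPair` up to the factor `(2π)²`. -/
noncomputable def cosJac (x y : T1) (a b : T1) : ℝ :=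
  tsin a * tsin (b + y) - tsin b * tsin (a + x)

theorem det_cosPairDeriv (x y : ℝ) (p : ℝ × ℝ) :
    (cosPairDeriv x y p).det = (2 * Real.pi) ^ 2 * cosJac x y p.1 p.2 := by
  have h1 : tsin ((p.1 : T1) + (x : T1)) = Real.sin (2 * Real.pi * (p.1 + x)) := rfl
  have h2 : tsin ((p.2 : T1) + (y : T1)) = Real.sin (2 * Real.pi * (p.2 + y)) := rfl
  rw [cosJac, h1, h2, tsin_coe, tsin_coe]
  unfold cosPairDeriv
  rw [LinearMap.det_toContinuousLinearMap, LinearMap.det_toLin, Matrix.det_fin_two_of]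
  ring

/-- The region where the Jacobian is bounded below is controlled by the area formula. -/
theorem lintegral_cosJac_mul_le {ε : ℝ} (hε : 0 < ε) (hε3 : ε ≤ 1 / 3) (x y : T1)
    (hx : tsin x ≠ 0) (c d : ℝ) :
    ∫⁻ b : T1, ∫⁻ a : T1, ENNReal.ofReal |cosJac x y a b| *
      (regInv ε (tcos a + tcos b + c) * regInv ε (tcos (a + x) + tcos (b + y) + d))
      ≤ 256 * (ell ε * ell ε) := by
  induction x using QuotientAddGroup.induction_on
  induction y using QuotientAddGroup.induction_on
  rename_i x y
  change Real.sin (2 * Real.pi * x) ≠ 0 at hx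
  set A : Set (ℝ × ℝ) := Ioc 0 (0 + 1) ×ˢ Ioc 0 (0 + 1) with hA
  have hAm : MeasurableSet A := measurableSet_Ioc.prod measurableSet_Ioc
  set B : Set (ℝ × ℝ) := {p | (cosPairDeriv x y p).det ≠ 0} with hB
  have hdetm : Measurable fun p : ℝ × ℝ => (cosPairDeriv x y p).det := by
    simp_rw [det_cosPairDeriv, cosJac]
    have : Measurable ((↑) : ℝ → T1) := AddCircle.measurable_mk'
    fun_prop
  have hBm : MeasurableSet B := hdetm (measurableSet_singleton 0).compl
  -- The values of `cosPair` lie in this square, and the cut-off keeps the integral over all of `ℝ ×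
  -- ℝ` logarithmic.
  set g : ℝ × ℝ → ℝ≥0∞ := (Icc (-2 : ℝ) 2 ×ˢ Icc (-2 : ℝ) 2).indicator
    (fun w => regInv ε (w.1 + c) * regInv ε (w.2 + d)) with hg
  have hgm : Measurable g := Measurable.indicator (by fun_prop)
    (measurableSet_Icc.prod measurableSet_Icc)
  have hgf : ∀ p : ℝ × ℝ, g (cosPair x y p)
      = regInv ε (tcos (p.1 : T1) + tcos (p.2 : T1) + c)
        * regInv ε (tcos ((p.1 : T1) + (x : T1)) + tcos ((p.2 : T1) + (y : T1)) + d) := by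
    intro p
    have h : ∀ a b : ℝ, Real.cos a + Real.cos b ∈ Icc (-2 : ℝ) 2 := fun a b =>
      ⟨by linarith [Real.neg_one_le_cos a, Real.neg_one_le_cos b],
        by linarith [Real.cos_le_one a, Real.cos_le_one b]⟩
    rw [hg, indicator_of_mem (show cosPair x y p ∈ Icc (-2 : ℝ) 2 ×ˢ Icc (-2 : ℝ) 2 from
      ⟨h _ _, h _ _⟩)]
    rfl
  have hfm : Measurable fun p : ℝ × ℝ => ENNReal.ofReal |(cosPairDeriv x y p).det|
      * g (cosPair x y p) := by
    have : Measurable (cosPair x y) := by unfold cosPair; fun_prop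
    exact (by fun_prop : Measurable fun p => ENNReal.ofReal |(cosPairDeriv x y p).det|).mul
      (hgm.comp this)
  have hle : ∀ p : ℝ × ℝ, ENNReal.ofReal |cosJac x y p.1 p.2| *
      (regInv ε (tcos (p.1 : T1) + tcos (p.2 : T1) + c)
        * regInv ε (tcos ((p.1 : T1) + (x : T1)) + tcos ((p.2 : T1) + (y : T1)) + d))
      ≤ ENNReal.ofReal |(cosPairDeriv x y p).det| * g (cosPair x y p) := by
    intro p
    rw [hgf, det_cosPairDeriv, abs_mul]
    gcongr
    refine le_mul_of_one_le_left (abs_nonneg _) ?_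
    rw [abs_of_nonneg (by positivity)]
    nlinarith [Real.pi_gt_three]
  calc _ = ∫⁻ b in Ioc (0 : ℝ) (0 + 1), ∫⁻ a in Ioc (0 : ℝ) (0 + 1),
        ENNReal.ofReal |cosJac x y a b| * (regInv ε (tcos (a : T1) + tcos (b : T1) + c)
        * regInv ε (tcos ((a : T1) + (x : T1)) + tcos ((b : T1) + (y : T1)) + d)) := by
        rw [lintegral_T1 0]
        refine lintegral_congr fun b => ?_
        rw [lintegral_T1 0]
    _ ≤ ∫⁻ b in Ioc (0 : ℝ) (0 + 1), ∫⁻ a in Ioc (0 : ℝ) (0 + 1),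
        ENNReal.ofReal |(cosPairDeriv x y (a, b)).det| * g (cosPair x y (a, b)) :=
        lintegral_mono fun b => lintegral_mono fun a => hle (a, b)
    _ = ∫⁻ p in A, ENNReal.ofReal |(cosPairDeriv x y p).det| * g (cosPair x y p) := by
        rw [hA, Measure.volume_eq_prod, ← Measure.prod_restrict]
        exact (lintegral_prod_symm' _ hfm).symm
    _ = ∫⁻ p in A ∩ B, ENNReal.ofReal |(cosPairDeriv x y p).det| * g (cosPair x y p) := by
        rw [← lintegral_inter_add_sdiff _ A hBm]
        have : ∫⁻ p in A \ B, ENNReal.ofReal |(cosPairDeriv x y p).det| * g (cosPair x y p)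
            = ∫⁻ p in A \ B, 0 := by
          refine setLIntegral_congr_fun (hAm.diff hBm) fun p hp => ?_
          have : (cosPairDeriv x y p).det = 0 := by simpa [hB] using hp.2
          simp [this]
        rw [this]
        simp
    -- The possibly infinite fibre over the origin is the exceptional null set. The final constant
    -- is `256 = 4 * 8 * 8`.
    _ ≤ (4 : ℕ) * ∫⁻ w : ℝ × ℝ, g w := by
        refine lintegral_abs_det_mul_le_of_encard_le volume (hAm.inter hBm)
          (fun p _ => hasStrictFDerivAt_cosPair x y p) (fun p hp => hp.2) (Z := {0})
          (by simp) (fun w hw => ?_) hgm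
        exact (encard_le_encard (by gcongr; exact inter_subset_left)).trans
          (encard_cosPair_fiber_le hx hw)
    _ = (4 : ℕ) * ((∫⁻ s in Icc (-2 : ℝ) 2, regInv ε (s + c))
          * ∫⁻ s in Icc (-2 : ℝ) 2, regInv ε (s + d)) := by
        rw [hg, lintegral_indicator (measurableSet_Icc.prod measurableSet_Icc),
          Measure.volume_eq_prod, ← Measure.prod_restrict]
        rw [lintegral_prod_mul (f := fun s => regInv ε (s + c)) (g := fun s => regInv ε (s + d))
          (by fun_prop) (by fun_prop)]
    _ ≤ (4 : ℕ) * (((4 + (4 : ℕ)) * ell ε) * ((4 + (4 : ℕ)) * ell ε)) := by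
        gcongr <;> exact lintegral_regInv_Icc_le hε hε3 _ (by norm_num)
    _ = _ := by push_cast; ring

theorem cosJac_eq (x y a b : T1) : cosJac x y a b
    = (tsin (b + y) - tsin b * tcos x) * tsin a - (tsin b * tsin x) * tcos a := by
  rw [cosJac, tsin_add a x]
  ring

theorem measurable_cosJac (x y : T1) : Measurable fun p : T1 × T1 => cosJac x y p.1 p.2 := by
  unfold cosJac
  fun_prop

/-- For fixed `b` the Jacobian is `A sin a - B cos a` with `B = sin b sin x`. The bound `|B| ^ (-κ)`
factorizes, and its part in `b` is integrable. -/
theorem lintegral_cosJac_rpow_le {κ : ℝ} (hκ0 : 0 ≤ κ) (x y : T1) (hx : tsin x ≠ 0) :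
    ∫⁻ b : T1, ∫⁻ a : T1, ENNReal.ofReal |cosJac x y a b| ^ (-κ)
      ≤ sinInt κ * sinInt κ * ENNReal.ofReal |tsin x| ^ (-κ) := by
  calc _ ≤ ∫⁻ b : T1, ENNReal.ofReal |tsin b| ^ (-κ)
        * (ENNReal.ofReal |tsin x| ^ (-κ) * sinInt κ) := by
        refine lintegral_mono_ae ?_
        filter_upwards [ae_tsin_ne_zero] with b hb
        simp_rw [cosJac_eq]
        refine (lintegral_lin_trig_rpow_le hκ0 _ _).trans (le_of_eq ?_)
        rw [abs_mul, ENNReal.ofReal_mul (abs_nonneg _), ENNReal.mul_rpow_of_ne_zero, mul_assoc]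
        · simpa using hb
        · simpa using hx
    _ = _ := by
        rw [lintegral_mul_const _ (by fun_prop), sinInt]
        ring

theorem lintegral_pi_fin_three' {f : T3 → ℝ≥0∞} (hf : Measurable f) :
    ∫⁻ k, f k = ∫⁻ x : T1, ∫⁻ y : T1, ∫⁻ z : T1, f ![x, y, z] := by
  rw [lintegral_pi_succAbove 2 hf]
  have h := (volume_preserving_finTwoArrow T1).symm
  have hm : Measurable fun v : Fin 2 → T1 => ∫⁻ x : T1, f ((2 : Fin 3).insertNth x v) := by
    refine Measurable.lintegral_prod_left' (f := fun p : T1 × (Fin 2 → T1) =>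
      f ((2 : Fin 3).insertNth p.1 p.2)) ?_
    exact hf.comp (measurable_insertNth 2)
  rw [← h.lintegral_comp hm]
  rw [Measure.volume_eq_prod]
  refine (lintegral_prod _ (hm.comp (MeasurableEquiv.measurable _)).aemeasurable).trans ?_
  refine lintegral_congr fun x => lintegral_congr fun y => lintegral_congr fun z => ?_
  congr 1
  ext j
  fin_cases j <;> rfl

theorem kineticEnergy_vec (x y z : T1) :
    kineticEnergy ![x, y, z] = 3 - (tcos x + tcos y + tcos z) := kineticEnergy_eq _

/-! ### The two-resolvent bound and the crossing estimate -/

/-- The exponent `κ` used in the crossing estimate. -/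
noncomputable def kap : ℝ := 99 / 100

theorem lintegral_lintegral_mul_const_swap {h : T1 × T1 → ℝ≥0∞} (hm : Measurable h) (c : ℝ≥0∞) :
    ∫⁻ x : T1, ∫⁻ y : T1, h (x, y) * c = c * ∫⁻ y : T1, ∫⁻ x : T1, h (x, y) := by
  rw [lintegral_lintegral_swap (f := fun x y => h (x, y) * c) (hm.mul_const c).aemeasurable,
    ← lintegral_const_mul c (Measurable.lintegral_prod_left' hm)]
  refine lintegral_congr fun y => ?_
  rw [mul_comm c]
  exact lintegral_mul_const c (hm.comp measurable_prodMk_right)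

/-- The pointwise bound of the two-resolvent integral. -/
noncomputable def crossBound (ε : ℝ) (q : T3) : ℝ≥0∞ :=
  ENNReal.ofReal ε ^ (-(3 / 4) : ℝ) * (256 * (ell ε * ell ε)) +
    ENNReal.ofReal ε ^ (5 / 4 * kap - 2) * ((12 * ell ε + sinInt kap)
      * (sinInt kap * sinInt kap + 1)) * ENNReal.ofReal |tsin (q 0)| ^ (-kap)

theorem kap_pos : 0 < kap := by norm_num [kap]

theorem kap_lt_one : kap < 1 := by norm_num [kap]

@[fun_prop] theorem measurable_crossBound (ε : ℝ) : Measurable (crossBound ε) := by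
  unfold crossBound
  fun_prop

theorem crossBound_neg (ε : ℝ) (q : T3) : crossBound ε (-q) = crossBound ε q := by
  simp [crossBound, tsin_neg]

/-- The two-resolvent bound, uniform in both energies. -/
theorem lintegral_two_resolvents_le {ε : ℝ} (hε : 0 < ε) (hε3 : ε ≤ 1 / 3) (a b : ℝ) (q : T3) :
    ∫⁻ k : T3, regInv ε (kineticEnergy k - a) * regInv ε (kineticEnergy (k + q) - b)
      ≤ crossBound ε q := by
  set e := ENNReal.ofReal ε with he
  have he0 : e ≠ 0 := by simp [he, hε]
  have het : e ≠ ⊤ := ENNReal.ofReal_ne_top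
  have heinv : ENNReal.ofReal ε⁻¹ = e⁻¹ := ENNReal.ofReal_inv_of_pos hε
  set S := sinInt kap
  have hS : S ≠ ⊤ := (sinInt_lt_top kap_pos.le kap_lt_one).ne
  have hell : 1 ≤ ell ε := one_le_ell hε hε3
  -- In this case the right-hand side is infinite; the summand `1` in `crossBound` keeps the
  -- coefficient of the infinite factor visibly nonzero.
  by_cases hx : tsin (q 0) = 0
  · have h1 : ENNReal.ofReal |tsin (q 0)| ^ (-kap) = ⊤ := by simp [hx, kap_pos]
    rw [crossBound, h1, ENNReal.mul_top]
    · simp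
    · refine mul_ne_zero ?_ (mul_ne_zero ?_ ?_)
      · simp [ENNReal.rpow_eq_zero_iff, he0, het, ← he]
      · have : (12 : ℝ≥0∞) * ell ε ≠ 0 := mul_ne_zero (by norm_num)
          (lt_of_lt_of_le zero_lt_one hell).ne'
        simp [this]
      · simp
  -- Where the Jacobian is at least `δ`, inserting it costs `ε ^ (-3/4)` and the area formula
  -- applies. Where it is smaller, the second resolvent is bounded by `1/ε` and the factor `δ ^ κ *
  -- J ^ (-κ) ≥ 1` is inserted.
  set δ := e ^ (3 / 4 : ℝ) with hδ
  have hδ0 : δ ≠ 0 := by simp [hδ, he0, het]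
  have hδt : δ ≠ ⊤ := ENNReal.rpow_ne_top_of_nonneg (by norm_num) het
  set J : T3 → ℝ≥0∞ := fun k => ENNReal.ofReal |cosJac (q 0) (q 1) (k 0) (k 1)| with hJ
  have hJm : Measurable J := by
    have : Measurable fun k : T3 => cosJac (q 0) (q 1) (k 0) (k 1) :=
      (measurable_cosJac (q 0) (q 1)).comp (by fun_prop : Measurable fun k : T3 => (k 0, k 1))
    fun_prop
  set F1 : T3 → ℝ≥0∞ := fun k => regInv ε (kineticEnergy k - a) with hF1
  set F2 : T3 → ℝ≥0∞ := fun k => regInv ε (kineticEnergy (k + q) - b) with hF2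
  have hF1m : Measurable F1 := by fun_prop
  have hF2m : Measurable F2 := by fun_prop
  have hpt : ∀ k, F1 k * F2 k ≤ δ⁻¹ * (J k * (F1 k * F2 k))
      + e⁻¹ * δ ^ kap * (J k ^ (-kap) * F1 k) := by
    intro k
    rcases le_total δ (J k) with h | h
    · refine le_trans ?_ le_self_add
      rw [← mul_assoc]
      refine le_mul_of_one_le_left zero_le ?_
      rw [mul_comm, ← div_eq_mul_inv]
      exact (ENNReal.le_div_iff_mul_le (Or.inl hδ0) (Or.inl hδt)).2 (by rwa [one_mul])
    · refine le_trans ?_ le_add_self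
      have h1 : F2 k ≤ e⁻¹ := by rw [← heinv]; exact regInv_le hε _
      have h2 : 1 ≤ δ ^ kap * J k ^ (-kap) := by
        calc (1 : ℝ≥0∞) = δ ^ kap * δ ^ (-kap) := by
              rw [← ENNReal.rpow_add _ _ hδ0 hδt]; simp
          _ ≤ _ := by
              exact mul_le_mul_right (ennreal_rpow_anti (neg_nonpos.2 kap_pos.le) h) _
      calc F1 k * F2 k ≤ F1 k * e⁻¹ := by gcongr
        _ = e⁻¹ * 1 * F1 k := by ring
        _ ≤ e⁻¹ * (δ ^ kap * J k ^ (-kap)) * F1 k := by gcongr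
        _ = _ := by ring
  have hT1 : ∫⁻ k, J k * (F1 k * F2 k) ≤ 256 * (ell ε * ell ε) := by
    rw [lintegral_pi_fin_three (by fun_prop)]
    calc _ ≤ ∫⁻ z : T1, 256 * (ell ε * ell ε) := by
          refine lintegral_mono fun z => ?_
          have := lintegral_cosJac_mul_le hε hε3 (q 0) (q 1) hx (tcos z + a - 3)
            (tcos (z + q 2) + b - 3)
          refine le_trans (le_of_eq ?_) this
          refine lintegral_congr fun y => lintegral_congr fun x => ?_
          simp only [hJ, hF1, hF2]
          rw [kineticEnergy_eq, kineticEnergy_eq, ← regInv_neg, ← regInv_neg ε (3 - _ - b)]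
          congr 3
          · simp only [Matrix.cons_val_zero, Matrix.cons_val_one, Matrix.cons_val]; ring
          · simp only [Pi.add_apply, Matrix.cons_val_zero, Matrix.cons_val_one, Matrix.cons_val]
            ring
      _ = _ := by simp
  -- The Jacobian does not involve the third coordinate, so the remaining resolvent is integrated
  -- there first, uniformly in the other two.
  have hT2 : ∫⁻ k, J k ^ (-kap) * F1 k ≤ e ^ (kap / 2 - 1) * (12 * ell ε + S)
      * (S * S * ENNReal.ofReal |tsin (q 0)| ^ (-kap)) := by
    have hswap : ∫⁻ k, J k ^ (-kap) * F1 k = ∫⁻ x : T1, ∫⁻ y : T1, ∫⁻ z : T1,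
        J ![x, y, z] ^ (-kap) * F1 ![x, y, z] := lintegral_pi_fin_three' (by fun_prop)
    rw [hswap]
    calc _ ≤ ∫⁻ x : T1, ∫⁻ y : T1, ENNReal.ofReal |cosJac (q 0) (q 1) x y| ^ (-kap) *
          (e ^ (kap / 2 - 1) * (12 * ell ε + S)) := by
          refine lintegral_mono fun x => lintegral_mono fun y => ?_
          have h1 : ∀ z, J ![x, y, z] ^ (-kap) * F1 ![x, y, z]
              = ENNReal.ofReal |cosJac (q 0) (q 1) x y| ^ (-kap) *
                regInv ε (tcos z + (tcos x + tcos y + a - 3)) := by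
            intro z
            simp only [hJ, hF1]
            rw [kineticEnergy_vec, ← regInv_neg]
            congr 2
            ring
          simp_rw [h1]
          rw [lintegral_const_mul _ (by fun_prop)]
          gcongr
          have := lintegral_tsin_rpow_mul_regInv_le hε hε3 (γ := 0) (κ := kap) le_rfl
            zero_le_one kap_pos.le kap_lt_one.le (tcos x + tcos y + a - 3)
          simpa using this
      _ = e ^ (kap / 2 - 1) * (12 * ell ε + S) *
          ∫⁻ y : T1, ∫⁻ x : T1, ENNReal.ofReal |cosJac (q 0) (q 1) x y| ^ (-kap) := by
          have hm : Measurable fun p : T1 × T1 =>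
              ENNReal.ofReal |cosJac (q 0) (q 1) p.1 p.2| ^ (-kap) := by
            have := measurable_cosJac (q 0) (q 1)
            fun_prop
          exact lintegral_lintegral_mul_const_swap hm _
      _ ≤ _ := by
          gcongr
          exact lintegral_cosJac_rpow_le kap_pos.le _ _ hx
  calc ∫⁻ k, F1 k * F2 k ≤ ∫⁻ k, (δ⁻¹ * (J k * (F1 k * F2 k))
      + e⁻¹ * δ ^ kap * (J k ^ (-kap) * F1 k)) := lintegral_mono hpt
    _ = δ⁻¹ * (∫⁻ k, J k * (F1 k * F2 k)) + e⁻¹ * δ ^ kap * ∫⁻ k, J k ^ (-kap) * F1 k := by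
        rw [lintegral_add_left (by fun_prop), lintegral_const_mul _ (by fun_prop),
          lintegral_const_mul _ (by fun_prop)]
    _ ≤ δ⁻¹ * (256 * (ell ε * ell ε)) + e⁻¹ * δ ^ kap * (e ^ (kap / 2 - 1) * (12 * ell ε + S)
      * (S * S * ENNReal.ofReal |tsin (q 0)| ^ (-kap))) := by gcongr
    _ ≤ crossBound ε q := by
        rw [crossBound]
        have h1 : δ⁻¹ = e ^ (-(3 / 4) : ℝ) := by rw [hδ, ENNReal.rpow_neg]
        have h2 : e⁻¹ * δ ^ kap * e ^ (kap / 2 - 1) = e ^ (5 / 4 * kap - 2) := by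
          rw [hδ, ← ENNReal.rpow_mul, ← ENNReal.rpow_neg_one, ← ENNReal.rpow_add _ _ he0 het,
            ← ENNReal.rpow_add _ _ he0 het]
          congr 1; ring
        rw [h1]
        refine add_le_add le_rfl ?_
        calc _ = (e⁻¹ * δ ^ kap * e ^ (kap / 2 - 1)) * ((12 * ell ε + S) * (S * S + 0))
              * ENNReal.ofReal |tsin (q 0)| ^ (-kap) := by rw [add_zero]; ring
          _ ≤ _ := by
              rw [h2]
              gcongr
              exact zero_le

/-- Two-dimensional resolvent bound with a small power loss. -/
theorem lintegral_two_dim_resolvent_le {ε : ℝ} (hε : 0 < ε) (hε3 : ε ≤ 1 / 3) (c : ℝ) :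
    ∫⁻ y : T1, ∫⁻ z : T1, regInv ε (tcos y + tcos z + c)
      ≤ 2 * (ENNReal.ofReal ε ^ (kap - 1) * (12 * ell ε + sinInt kap) * sinInt kap) := by
  set s : T1 → ℝ≥0∞ := fun x => ENNReal.ofReal |tsin x| with hs
  have hsm : Measurable s := by fun_prop
  set R : T1 → T1 → ℝ≥0∞ := fun y z => regInv ε (tcos y + tcos z + c) with hR
  have hRm : Measurable fun p : T1 × T1 => R p.1 p.2 := by fun_prop
  have hRs : ∀ y z, R y z = R z y := fun y z => by simp only [hR]; rw [add_comm (tcos y)]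
  set g : T1 → T1 → ℝ≥0∞ := fun y z => s y ^ (-kap) * (s z ^ kap * R y z) with hg
  have hgm : Measurable fun p : T1 × T1 => g p.1 p.2 := by fun_prop
  have hgi : ∫⁻ y : T1, ∫⁻ z : T1, g y z
      ≤ ENNReal.ofReal ε ^ (kap - 1) * (12 * ell ε + sinInt kap) * sinInt kap := by
    calc _ ≤ ∫⁻ y : T1, s y ^ (-kap) * (ENNReal.ofReal ε ^ (kap - 1) * (12 * ell ε + sinInt kap)) := by
          refine lintegral_mono fun y => ?_
          have h1 : Measurable fun z => s z ^ kap * R y z := by fun_prop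
          rw [lintegral_const_mul _ h1]
          gcongr
          have := lintegral_tsin_rpow_mul_regInv_le hε hε3 kap_pos.le kap_lt_one.le kap_pos.le
            kap_lt_one.le (tcos y + c)
          have h2 : (kap + kap) / 2 - 1 = kap - 1 := by ring
          rw [h2] at this
          refine le_trans (le_of_eq ?_) this
          refine lintegral_congr fun z => ?_
          simp only [hR]
          congr 2
          ring
      _ = _ := by
          rw [lintegral_mul_const _ (by fun_prop), sinInt, mul_comm]
  -- The larger of the two sines is used as Jacobian weight with exponent `κ`, the smaller one in
  -- the integrable power `-κ`. Since `κ` is close to one, only the small loss `ε ^ (κ - 1)`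
  -- remains.
  have hpt : ∀ y z, tsin y ≠ 0 → tsin z ≠ 0 → R y z ≤ g y z + g z y := by
    have key : ∀ y z, tsin y ≠ 0 → s y ≤ s z → R y z ≤ g y z := by
      intro y z hy h
      simp only [hg]
      rw [← mul_assoc]
      refine le_mul_of_one_le_left zero_le ?_
      calc (1 : ℝ≥0∞) = s y ^ (-kap) * s y ^ kap := by
            rw [← ENNReal.rpow_add _ _ (by simp [hy]) ENNReal.ofReal_ne_top]; simp
        _ ≤ _ := by
            have := kap_pos
            gcongr
    intro y z hy hz
    rcases le_total (s y) (s z) with h | h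
    · exact (key y z hy h).trans le_self_add
    · rw [hRs]; exact (key z y hz h).trans le_add_self
  calc _ ≤ ∫⁻ y : T1, ∫⁻ z : T1, (g y z + g z y) := by
        refine lintegral_mono_ae ?_
        filter_upwards [ae_tsin_ne_zero] with y hy
        refine lintegral_mono_ae ?_
        filter_upwards [ae_tsin_ne_zero] with z hz using hpt y z hy hz
    _ = (∫⁻ y : T1, ∫⁻ z : T1, g y z) + ∫⁻ y : T1, ∫⁻ z : T1, g z y := by
        rw [← lintegral_add_left (Measurable.lintegral_prod_right' hgm)]
        refine lintegral_congr fun y => ?_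
        exact lintegral_add_left (hgm.comp measurable_prodMk_left) _
    _ = 2 * ∫⁻ y : T1, ∫⁻ z : T1, g y z := by
        rw [lintegral_lintegral_swap (f := fun y z => g z y) (hgm.comp measurable_swap).aemeasurable,
          two_mul]
    _ ≤ _ := by gcongr

/-- The crossing estimate has some slack in its exponent, into which its two or three logarithms are
absorbed at `1/200` each. -/
theorem ell_le_rpow {ε : ℝ} (hε : 0 < ε) :
    ell ε ≤ 200 * ENNReal.ofReal ε ^ (-(1 / 200) : ℝ) := by
  have h := Real.log_le_rpow_div (x := ε⁻¹) (by positivity) (ε := 1 / 200) (by norm_num)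
  rw [Real.log_inv] at h
  rw [ell, ENNReal.ofReal_rpow_of_pos hε, ← ENNReal.ofReal_ofNat,
    ← ENNReal.ofReal_mul (by norm_num)]
  refine ENNReal.ofReal_le_ofReal (h.trans (le_of_eq ?_))
  rw [Real.rpow_neg hε.le, Real.inv_rpow hε.le]
  ring

/-- The constant in the crossing estimate. -/
noncomputable def crossConst : ℝ≥0∞ :=
  256 * 200 ^ 3 * resConst + 2 * 200 ^ 2 * ((12 + sinInt kap) * (sinInt kap * sinInt kap + 1)
    * ((12 + sinInt kap) * sinInt kap) * sinInt kap)

theorem crossConst_ne_top : crossConst ≠ ⊤ := by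
  have h1 : sinInt kap ≠ ⊤ := (sinInt_lt_top kap_pos.le kap_lt_one).ne
  have h2 := resConst_ne_top
  unfold crossConst
  finiteness

theorem lintegral_lintegral_mul_const {h : T1 × T1 → ℝ≥0∞} (hm : Measurable h) (c : ℝ≥0∞) :
    ∫⁻ y : T1, ∫⁻ z : T1, h (y, z) * c = (∫⁻ y : T1, ∫⁻ z : T1, h (y, z)) * c := by
  rw [← lintegral_mul_const c (Measurable.lintegral_prod_right' hm)]
  refine lintegral_congr fun y => ?_
  exact lintegral_mul_const c (hm.comp measurable_prodMk_left)

/-- The crossing estimate. -/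
theorem lintegral_resolvent_mul_crossBound_le {ε : ℝ} (hε : 0 < ε) (hε3 : ε ≤ 1 / 3) (a : ℝ)
    (q : T3) :
    ∫⁻ k : T3, regInv ε (kineticEnergy k - a) * crossBound ε (k + q)
      ≤ crossConst * ENNReal.ofReal ε ^ (-(4 / 5) : ℝ) := by
  set e := ENNReal.ofReal ε with he
  have he0 : e ≠ 0 := by simp [he, hε]
  have het : e ≠ ⊤ := ENNReal.ofReal_ne_top
  have he1 : e ≤ 1 := by rw [he, ENNReal.ofReal_le_one]; linarith
  have hell : 1 ≤ ell ε := one_le_ell hε hε3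
  set S := sinInt kap with hS
  have hSell : 12 * ell ε + S ≤ (12 + S) * ell ε := by
    rw [add_mul]
    gcongr
    exact le_mul_of_one_le_right zero_le hell
  have hlog : ell ε ≤ 200 * e ^ (-(1 / 200) : ℝ) := ell_le_rpow hε
  set F : T3 → ℝ≥0∞ := fun k => regInv ε (kineticEnergy k - a) with hF
  have hFm : Measurable F := by fun_prop
  set C1 := e ^ (-(3 / 4) : ℝ) * (256 * (ell ε * ell ε))
  set C2 := e ^ (5 / 4 * kap - 2) * ((12 * ell ε + S) * (S * S + 1))
  -- The singular factor involves only the first coordinate. The resolvent is integrated over the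
  -- other two, uniformly in the first, after which the singularity is integrable.
  have h2 : ∫⁻ k : T3, F k * ENNReal.ofReal |tsin ((k + q) 0)| ^ (-kap)
      ≤ 2 * (e ^ (kap - 1) * (12 * ell ε + S) * S) * S := by
    rw [lintegral_pi_fin_three' (by fun_prop)]
    calc _ ≤ ∫⁻ x : T1, 2 * (e ^ (kap - 1) * (12 * ell ε + S) * S)
          * ENNReal.ofReal |tsin (x + q 0)| ^ (-kap) := by
          refine lintegral_mono fun x => ?_
          have h3 : ∀ y z : T1, F ![x, y, z]
              * ENNReal.ofReal |tsin ((![x, y, z] + q) 0)| ^ (-kap)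
              = regInv ε (tcos y + tcos z + (tcos x + a - 3))
                * ENNReal.ofReal |tsin (x + q 0)| ^ (-kap) := by
            intro y z
            simp only [hF]
            rw [kineticEnergy_vec, ← regInv_neg]
            congr 2
            ring
          simp_rw [h3]
          have hm : Measurable fun p : T1 × T1 => regInv ε (tcos p.1 + tcos p.2 + (tcos x + a - 3)) := by
            fun_prop
          rw [lintegral_lintegral_mul_const hm]
          gcongr
          exact lintegral_two_dim_resolvent_le hε hε3 _
      _ = _ := by
          rw [lintegral_const_mul _ (by fun_prop),
            lintegral_add_right_eq_self (fun x : T1 => ENNReal.ofReal |tsin x| ^ (-kap))]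
          rfl
  calc _ = C1 * (∫⁻ k, F k) + C2 * ∫⁻ k : T3, F k * ENNReal.ofReal |tsin ((k + q) 0)| ^ (-kap) := by
        rw [← lintegral_const_mul _ hFm, ← lintegral_const_mul _ (by fun_prop),
          ← lintegral_add_left (by fun_prop)]
        refine lintegral_congr fun k => ?_
        simp only [crossBound, ← he]
        ring
    _ ≤ C1 * (resConst * ell ε) + C2 * (2 * (e ^ (kap - 1) * (12 * ell ε + S) * S) * S) := by
        gcongr
        exact lintegral_resolvent_le hε hε3 a
    _ ≤ 256 * 200 ^ 3 * resConst * e ^ (-(4 / 5) : ℝ) + 2 * 200 ^ 2 * ((12 + S) * (S * S + 1)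
          * ((12 + S) * S) * S) * e ^ (-(4 / 5) : ℝ) := by
        -- With `κ = 99/100` the exponents are `-3/4 - 3/200 = -0.765` and `(5κ/4 - 2) + (κ - 1) -
        -- 2/200 = -0.7825`, both above `-4/5`.
        refine add_le_add ?_ ?_
        · calc C1 * (resConst * ell ε)
              ≤ e ^ (-(3 / 4) : ℝ) * (256 * ((200 * e ^ (-(1 / 200) : ℝ))
                * (200 * e ^ (-(1 / 200) : ℝ)))) * (resConst * (200 * e ^ (-(1 / 200) : ℝ))) := by
                simp only [C1]
                gcongr
            _ = 256 * 200 ^ 3 * resConst * (e ^ (-(3 / 4) : ℝ) * e ^ (-(1 / 200) : ℝ)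
                * e ^ (-(1 / 200) : ℝ) * e ^ (-(1 / 200) : ℝ)) := by ring
            _ ≤ _ := by
                gcongr
                rw [← ENNReal.rpow_add _ _ he0 het, ← ENNReal.rpow_add _ _ he0 het,
                  ← ENNReal.rpow_add _ _ he0 het]
                exact ENNReal.rpow_le_rpow_of_exponent_ge he1 (by norm_num)
        · calc C2 * (2 * (e ^ (kap - 1) * (12 * ell ε + S) * S) * S)
              ≤ e ^ (5 / 4 * kap - 2) * (((12 + S) * (200 * e ^ (-(1 / 200) : ℝ))) * (S * S + 1))
                * (2 * (e ^ (kap - 1) * ((12 + S) * (200 * e ^ (-(1 / 200) : ℝ))) * S) * S) := by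
                simp only [C2]
                gcongr
                · exact hSell.trans (by gcongr)
                · exact hSell.trans (by gcongr)
            _ = 2 * 200 ^ 2 * ((12 + S) * (S * S + 1) * ((12 + S) * S) * S)
                * (e ^ (5 / 4 * kap - 2) * e ^ (-(1 / 200) : ℝ) * e ^ (kap - 1)
                  * e ^ (-(1 / 200) : ℝ)) := by ring
            _ ≤ _ := by
                gcongr
                rw [← ENNReal.rpow_add _ _ he0 het, ← ENNReal.rpow_add _ _ he0 het,
                  ← ENNReal.rpow_add _ _ he0 het]
                exact ENNReal.rpow_le_rpow_of_exponent_ge he1 (by norm_num [kap])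
    _ = crossConst * e ^ (-(4 / 5) : ℝ) := by rw [crossConst, add_mul (256 * 200 ^ 3 * resConst)]

/-! ### Resolvents at signed combinations of momenta -/

/-- The regularized resolvent `1 / (|e(k) - a| + ε)`. -/
noncomputable def res (ε a : ℝ) (k : T3) : ℝ≥0∞ := regInv ε (kineticEnergy k - a)

@[fun_prop] theorem measurable_res {α : Type*} [MeasurableSpace α] {ε : ℝ} {a : α → ℝ} {k : α → T3}
    (ha : Measurable a) (hk : Measurable k) : Measurable fun x => res ε (a x) (k x) := by
  unfold LatticeSchrodinger.res
  fun_prop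

theorem res_neg (ε a : ℝ) (k : T3) : res ε a (-k) = res ε a k := by
  rw [res, res, kineticEnergy_neg]

theorem res_le {ε : ℝ} (hε : 0 < ε) (a : ℝ) (k : T3) : res ε a k ≤ ENNReal.ofReal ε⁻¹ :=
  regInv_le hε _

/-- Both `e` and `crossBound` are even, so the sign `-1` reduces to `+1` with `d` replaced by `-d`.
-/
theorem lintegral_res_mul_res_le {ε : ℝ} (hε : 0 < ε) (hε3 : ε ≤ 1 / 3) (a b : ℝ) {σ : ℤ}
    (hσ : σ = 1 ∨ σ = -1) (d : T3) :
    ∫⁻ k : T3, res ε a k * res ε b (σ • k + d) ≤ crossBound ε d := by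
  rcases hσ with rfl | rfl
  · simp_rw [one_smul]
    exact lintegral_two_resolvents_le hε hε3 a b d
  · have h : ∀ k : T3, res ε b ((-1 : ℤ) • k + d) = res ε b (k + -d) := by
      intro k
      rw [← res_neg]
      congr 1
      simp [add_comm]
    simp_rw [h]
    rw [← crossBound_neg]
    exact lintegral_two_resolvents_le hε hε3 a b (-d)

theorem lintegral_res_mul_crossBound_le {ε : ℝ} (hε : 0 < ε) (hε3 : ε ≤ 1 / 3) (a : ℝ) {σ : ℤ}
    (hσ : σ = 1 ∨ σ = -1) (d : T3) :
    ∫⁻ k : T3, res ε a k * crossBound ε (σ • k + d)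
      ≤ crossConst * ENNReal.ofReal ε ^ (-(4 / 5) : ℝ) := by
  rcases hσ with rfl | rfl
  · simp_rw [one_smul]
    exact lintegral_resolvent_mul_crossBound_le hε hε3 a d
  · have h : ∀ k : T3, crossBound ε ((-1 : ℤ) • k + d) = crossBound ε (k + -d) := by
      intro k
      rw [← crossBound_neg]
      congr 1
      simp [add_comm]
    simp_rw [h]
    exact lintegral_resolvent_mul_crossBound_le hε hε3 a (-d)

/-! ### Successive integration of loop momenta -/

section Loops

variable {P : Type*} [DecidableEq P]

/-- The integral over the loop momenta in `S`. -/
noncomputable abbrev loopInt (S : Finset P) (f : (P → T3) → ℝ≥0∞) : (P → T3) → ℝ≥0∞ :=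
  lmarginal (fun _ : P => (volume : Measure T3)) S f

theorem loopInt_mul_of_dependsOn (S : Finset P) {f g : (P → T3) → ℝ≥0∞} (hf : Measurable f)
    (hg : DependsOn g (Sᶜ : Set P)) (w : P → T3) :
    loopInt S (fun w => f w * g w) w = loopInt S f w * g w := by
  have h : ∀ y : S → T3, g (Function.updateFinset w S y) = g w := fun y =>
    hg fun i hi => by simp only [mem_compl_iff, Finset.mem_coe] at hi; simp [Function.updateFinset, hi]
  unfold loopInt lmarginal
  simp_rw [h]
  exact lintegral_mul_const _ (hf.comp measurable_updateFinset)

/-- The product of the resolvents of the loop momenta in `S`. -/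
noncomputable def resProd (ε : ℝ) (S : Finset P) (a : P → ℝ) (w : P → T3) : ℝ≥0∞ :=
  ∏ m ∈ S, res ε (a m) (w m)

omit [DecidableEq P] in
@[fun_prop] theorem measurable_resProd {α : Type*} [MeasurableSpace α] {ε : ℝ} {S : Finset P}
    {a : α → P → ℝ} {w : α → P → T3} (ha : Measurable a) (hw : Measurable w) :
    Measurable fun x => resProd ε S (a x) (w x) := by
  unfold LatticeSchrodinger.resProd
  fun_prop

omit [DecidableEq P] in
theorem dependsOn_resProd (ε : ℝ) (S : Finset P) (a : P → ℝ) :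
    DependsOn (resProd ε S a) (S : Set P) := fun w w' h =>
  Finset.prod_congr rfl fun m hm => by rw [h m hm]

theorem resProd_erase_mul (ε : ℝ) {S : Finset P} {x : P} (hx : x ∈ S) (a : P → ℝ) (w : P → T3) :
    resProd ε S a w = resProd ε (S.erase x) a w * res ε (a x) (w x) :=
  (Finset.prod_erase_mul S _ hx).symm

theorem resProd_erase_update (ε : ℝ) (S : Finset P) (x : P) (a : P → ℝ) (w : P → T3) (y : T3) :
    resProd ε (S.erase x) a (Function.update w x y) = resProd ε (S.erase x) a w :=
  dependsOn_resProd ε _ a fun i hi => by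
    rw [Function.update_of_ne (Finset.ne_of_mem_erase hi)]

theorem dependsOn_update {α : Type*} {g : (P → T3) → α} {s : Set P} (hg : DependsOn g s) {x : P}
    (hx : x ∉ s) (w : P → T3) (y : T3) : g (Function.update w x y) = g w :=
  hg fun i hi => by
    rw [Function.update_of_ne]
    rintro rfl
    exact hx hi

/-- A loop integral of one resolvent costs a logarithm. -/
noncomputable def loopCost (ε : ℝ) : ℝ≥0∞ := (resConst + 1) * ell ε

/-- Owing to the summand `1` in `loopCost`, the number of loop integrations in a bound may be
overestimated freely. -/
theorem one_le_loopCost {ε : ℝ} (hε : 0 < ε) (hε3 : ε ≤ 1 / 3) : 1 ≤ loopCost ε :=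
  le_mul_of_one_le_of_le le_add_self (one_le_ell hε hε3)

theorem lintegral_res_le {ε : ℝ} (hε : 0 < ε) (hε3 : ε ≤ 1 / 3) (a : ℝ) :
    ∫⁻ k : T3, res ε a k ≤ loopCost ε :=
  (lintegral_resolvent_le hε hε3 a).trans (by unfold loopCost; gcongr; exact le_self_add)

theorem loopInt_resProd_le {ε : ℝ} (hε : 0 < ε) (hε3 : ε ≤ 1 / 3) (S : Finset P) (a : P → ℝ)
    (w : P → T3) : loopInt S (resProd ε S a) w ≤ loopCost ε ^ S.card := by
  induction S using Finset.induction_on generalizing w with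
  | empty => simp [loopInt, resProd]
  | insert i S hi ih =>
    have h1 : resProd ε (insert i S) a = fun w => resProd ε S a w * res ε (a i) (w i) := by
      funext w
      rw [resProd, Finset.prod_insert hi, mul_comm]; rfl
    have hd : DependsOn (fun w : P → T3 => res ε (a i) (w i)) (Sᶜ : Set P) := fun w w' h => by
      simp only
      rw [h i (by simpa using hi)]
    rw [loopInt, lmarginal_insert _ (by fun_prop) hi, h1]
    calc _ = ∫⁻ y : T3, loopInt S (resProd ε S a) (Function.update w i y) * res ε (a i) y := by
          refine lintegral_congr fun y => ?_
          refine (loopInt_mul_of_dependsOn S (by fun_prop) hd _).trans ?_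
          rw [Function.update_self]
      _ ≤ ∫⁻ y : T3, loopCost ε ^ S.card * res ε (a i) y := by
          gcongr with y
          exact ih _
      _ = loopCost ε ^ S.card * ∫⁻ y : T3, res ε (a i) y := lintegral_const_mul _ (by fun_prop)
      _ ≤ loopCost ε ^ S.card * loopCost ε := by gcongr; exact lintegral_res_le hε hε3 _
      _ = _ := by rw [Finset.card_insert_of_notMem hi, pow_succ]

theorem loopInt_resProd_mul_le {ε : ℝ} (hε : 0 < ε) (hε3 : ε ≤ 1 / 3) {S : Finset P} {n : ℕ}
    (hn : S.card ≤ n) (a : P → ℝ) {g : (P → T3) → ℝ≥0∞} (hg : DependsOn g (Sᶜ : Set P))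
    (w : P → T3) : loopInt S (fun w => resProd ε S a w * g w) w ≤ loopCost ε ^ n * g w := by
  rw [loopInt_mul_of_dependsOn S (by fun_prop) hg]
  gcongr
  exact (loopInt_resProd_le hε hε3 S a w).trans (pow_le_pow_right₀ (one_le_loopCost hε hε3) hn)

/-- Integrating out one of the two loop momenta of a crossing. -/
theorem loopInt_cross_first_le {ε : ℝ} (hε : 0 < ε) (hε3 : ε ≤ 1 / 3) {S : Finset P} {x : P}
    (hx : x ∈ S) (a : P → ℝ) (a' : ℝ) {σ : ℤ} (hσ : σ = 1 ∨ σ = -1) {d : (P → T3) → T3}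
    (hd : DependsOn d ({x}ᶜ : Set P)) (hdm : Measurable d) {g : (P → T3) → ℝ≥0∞}
    (hg : DependsOn g ({x}ᶜ : Set P)) (hgm : Measurable g) (w : P → T3) :
    loopInt S (fun w => resProd ε S a w * res ε a' (σ • w x + d w) * g w) w
      ≤ loopInt (S.erase x) (fun w => resProd ε (S.erase x) a w * crossBound ε (d w) * g w) w := by
  have hm : Measurable fun w : P → T3 => σ • w x + d w :=
    ((measurable_pi_apply x).const_smul σ).add hdm
  rw [loopInt, lmarginal_erase' _ (by fun_prop) hx]
  refine lmarginal_mono (fun w => ?_) w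
  have h1 : ∀ y : T3, resProd ε S a (Function.update w x y)
      * res ε a' (σ • (Function.update w x y) x + d (Function.update w x y))
      * g (Function.update w x y)
      = resProd ε (S.erase x) a w * g w * (res ε (a x) y * res ε a' (σ • y + d w)) := by
    intro y
    rw [resProd_erase_mul ε hx, resProd_erase_update, Function.update_self,
      dependsOn_update hd (by simp), dependsOn_update hg (by simp)]
    ring
  simp_rw [h1]
  have hm2 : Measurable fun y : T3 => σ • y + d w := (measurable_id.const_smul σ).add_const _
  rw [lintegral_const_mul _ (by fun_prop), mul_right_comm]
  gcongr
  exact lintegral_res_mul_res_le hε hε3 _ _ hσ _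

/-- The gain from a crossing. -/
noncomputable def crossCost (ε : ℝ) : ℝ≥0∞ := crossConst * ENNReal.ofReal ε ^ (-(4 / 5) : ℝ)

/-- Integrating out the second of the two loop momenta of a crossing. -/
theorem loopInt_cross_second_le {ε : ℝ} (hε : 0 < ε) (hε3 : ε ≤ 1 / 3) {S : Finset P} {x : P}
    (hx : x ∈ S) (a : P → ℝ) {σ : ℤ} (hσ : σ = 1 ∨ σ = -1) {d : (P → T3) → T3}
    (hd : DependsOn d ({x}ᶜ : Set P)) (hdm : Measurable d) {g : (P → T3) → ℝ≥0∞}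
    (hg : DependsOn g (Sᶜ : Set P)) (hgm : Measurable g) {n : ℕ} (hn : S.card ≤ n) (w : P → T3) :
    loopInt S (fun w => resProd ε S a w * crossBound ε (σ • w x + d w) * g w) w
      ≤ loopCost ε ^ n * (crossCost ε * g w) := by
  have hm : Measurable fun w : P → T3 => σ • w x + d w :=
    ((measurable_pi_apply x).const_smul σ).add hdm
  rw [loopInt, lmarginal_erase' _ (by fun_prop) hx]
  have hg' : DependsOn (fun w => crossCost ε * g w) ((S.erase x : Finset P)ᶜ : Set P) := by
    intro w w' h
    simp only
    rw [hg fun i hi => h i fun hi' => hi (Finset.mem_of_mem_erase hi')]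
  refine le_trans (lmarginal_mono (fun w => ?_) w) (loopInt_resProd_mul_le hε hε3
    ((Finset.card_erase_le).trans hn) a hg' w)
  have h1 : ∀ y : T3, resProd ε S a (Function.update w x y)
      * crossBound ε (σ • (Function.update w x y) x + d (Function.update w x y))
      * g (Function.update w x y)
      = resProd ε (S.erase x) a w * g w * (res ε (a x) y * crossBound ε (σ • y + d w)) := by
    intro y
    rw [resProd_erase_mul ε hx, resProd_erase_update, Function.update_self,
      dependsOn_update hd (by simp), dependsOn_update hg (by simpa using hx)]
    ring
  simp_rw [h1]
  have hm2 : Measurable fun y : T3 => σ • y + d w := (measurable_id.const_smul σ).add_const _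
  rw [lintegral_const_mul _ (by fun_prop), mul_assoc, mul_comm (g w)]
  gcongr
  exact lintegral_res_mul_crossBound_le hε hε3 _ hσ _

/-- Integrating out both loop momenta of a crossing. -/
theorem loopInt_cross_both_le {ε : ℝ} (hε : 0 < ε) (hε3 : ε ≤ 1 / 3) {S : Finset P} {x y : P}
    (hx : x ∈ S) (hy : y ∈ S) (hxy : x ≠ y) (a : P → ℝ) (a' : ℝ) {σ τ : ℤ}
    (hσ : σ = 1 ∨ σ = -1) (hτ : τ = 1 ∨ τ = -1) {c : (P → T3) → T3}
    (hc : DependsOn c ({x, y}ᶜ : Set P)) (hcm : Measurable c) {g : (P → T3) → ℝ≥0∞}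
    (hg : DependsOn g (Sᶜ : Set P)) (hgm : Measurable g) {n : ℕ} (hn : S.card ≤ n) (w : P → T3) :
    loopInt S (fun w => resProd ε S a w * res ε a' (σ • w x + (τ • w y + c w)) * g w) w
      ≤ loopCost ε ^ n * (crossCost ε * g w) := by
  have hm : Measurable fun w : P → T3 => τ • w y + c w :=
    ((measurable_pi_apply y).const_smul τ).add hcm
  -- The integral over `w x` leaves `crossBound` at `τ • w y + c w`, which the resolvent of `w y`
  -- then integrates. As `c` involves neither momentum, the second integral is of the same form.
  refine (loopInt_cross_first_le hε hε3 hx a a' hσ (d := fun w => τ • w y + c w) ?_ hm ?_ hgm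
    w).trans (loopInt_cross_second_le hε hε3 (Finset.mem_erase.2 ⟨hxy.symm, hy⟩) a hτ ?_ hcm
      ?_ hgm (Finset.card_erase_le.trans hn) w)
  · intro w w' h
    simp only
    rw [h y (by simpa using hxy.symm), hc fun i hi => h i fun hi' => hi (Or.inl hi')]
  · intro w w' h
    exact hg fun i hi => h i fun hi' => hi (by rw [mem_singleton_iff] at hi'; rw [hi']; exact hx)
  · intro w w' h
    exact hc fun i hi => h i fun hi' => hi (Or.inr hi')
  · intro w w' h
    exact hg fun i hi => h i fun hi' => hi (Finset.mem_of_mem_erase hi')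

end Loops

/-! ### Energy integrals and the possible positions of a crossing -/

section Energies

variable {P : Type*} [DecidableEq P]

theorem lintegral_loopInt_swap (μ : Measure ℝ) [SFinite μ] (S : Finset P)
    {F : ℝ → (P → T3) → ℝ≥0∞} (hF : Measurable fun p : ℝ × (P → T3) => F p.1 p.2) (w : P → T3) :
    ∫⁻ β, loopInt S (F β) w ∂μ = loopInt S (fun w => ∫⁻ β, F β w ∂μ) w := by
  unfold loopInt lmarginal
  refine lintegral_lintegral_swap (Measurable.aemeasurable ?_)
  exact hF.comp (measurable_fst.prodMk (measurable_updateFinset.comp measurable_snd))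

theorem loopInt_const_mul (S : Finset P) (c : ℝ≥0∞) {f : (P → T3) → ℝ≥0∞} (hf : Measurable f)
    (w : P → T3) : loopInt S (fun w => c * f w) w = c * loopInt S f w :=
  lintegral_const_mul _ (hf.comp measurable_updateFinset)

theorem lintegral_lintegral_const_mul (μ : Measure ℝ) [SFinite μ] (c : ℝ≥0∞) {h : ℝ → ℝ → ℝ≥0∞}
    (hh : Measurable fun p : ℝ × ℝ => h p.1 p.2) :
    ∫⁻ β, ∫⁻ β', c * h β β' ∂μ ∂μ = c * ∫⁻ β, ∫⁻ β', h β β' ∂μ ∂μ := by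
  have h1 : ∀ β, ∫⁻ β', c * h β β' ∂μ = c * ∫⁻ β', h β β' ∂μ := fun β =>
    lintegral_const_mul c (hh.comp measurable_prodMk_left)
  simp_rw [h1]
  exact lintegral_const_mul c (Measurable.lintegral_prod_right' hh)

/-- Integrating out both energies once only the two energy resolvents depend on them. -/
theorem lintegral_energies_loopInt_le {ε : ℝ} {μ : Measure ℝ} [SFinite μ] {E : ℝ≥0∞}
    (hE : ∀ k : T3, ∫⁻ β, res ε β k ∂μ ≤ E) (S : Finset P) {H : (P → T3) → ℝ≥0∞}
    (hH : Measurable H) {ρ ρ' : (P → T3) → T3} (hρ : Measurable ρ) (hρ' : Measurable ρ')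
    (w : P → T3) :
    ∫⁻ β, ∫⁻ β', loopInt S (fun w => H w * (res ε β (ρ w) * res ε β' (ρ' w))) w ∂μ ∂μ
      ≤ E * E * loopInt S H w := by
  calc _ ≤ ∫⁻ β, loopInt S (fun w => E * (H w * res ε β (ρ w))) w ∂μ := by
        refine lintegral_mono fun β => ?_
        simp only
        rw [lintegral_loopInt_swap μ S (F := fun β' w => H w * (res ε β (ρ w) * res ε β' (ρ' w)))
          (by fun_prop)]
        refine lmarginal_mono (fun w => ?_) w
        simp_rw [← mul_assoc]
        rw [lintegral_const_mul _ (by fun_prop), mul_assoc E, mul_comm E]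
        exact mul_le_mul_right (hE _) _
    _ ≤ loopInt S (fun w => E * E * H w) w := by
        rw [lintegral_loopInt_swap μ S (F := fun β w => E * (H w * res ε β (ρ w))) (by fun_prop)]
        refine lmarginal_mono (fun w => ?_) w
        simp_rw [← mul_assoc]
        rw [lintegral_const_mul _ (by fun_prop), mul_right_comm]
        gcongr
        exact hE _
    _ = _ := loopInt_const_mul _ _ hH _

variable [Fintype P]

theorem lintegral_eq_loopInt_compl (S : Finset P) {f : (P → T3) → ℝ≥0∞} (hf : Measurable f)
    (w : P → T3) : ∫⁻ w, f w = loopInt S (loopInt Sᶜ f) w := by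
  rw [loopInt, loopInt, ← lmarginal_union _ _ hf disjoint_compl_right, Finset.union_compl,
    ← lintegral_eq_lmarginal_univ]
  rfl

theorem resProd_univ (ε : ℝ) (S : Finset P) (a : P → ℝ) (w : P → T3) :
    resProd ε Finset.univ a w = resProd ε Sᶜ a w * resProd ε S a w := by
  rw [resProd, resProd, resProd, mul_comm, Finset.prod_mul_prod_compl]

/-- The loop and energy integrals of the resolvents of a graph with a crossing. The loop momenta in
`S` carry energies that are held fixed, the two energies `β` and `β'` are integrated using the
resolvents at `ρ` and `ρ'`, which only depend on the loop momenta in `S`. -/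
theorem lintegral_crossing_le {ε : ℝ} (hε : 0 < ε) (hε3 : ε ≤ 1 / 3) {μ : Measure ℝ} [SFinite μ]
    {E : ℝ≥0∞} (hE : ∀ k : T3, ∫⁻ β, res ε β k ∂μ ≤ E) (S : Finset P)
    {a : ℝ → ℝ → P → ℝ} {aS : P → ℝ}
    (haS : ∀ β β', ∀ m ∈ S, a β β' m = aS m) {aE : ℝ → ℝ → ℝ}
    {ρ ρ' c : (P → T3) → T3}
    (hρm : Measurable ρ) (hρm' : Measurable ρ') (hcm : Measurable c)
    (hρ : DependsOn ρ (S : Set P)) (hρ' : DependsOn ρ' (S : Set P))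
    {b f : P} (hbf : b ≠ f) (hc : DependsOn c ({b, f}ᶜ : Set P)) {σ τ : ℤ}
    (hσ : σ = 1 ∨ σ = -1) (hτ : τ = 1 ∨ τ = -1)
    (hcases : (b ∈ S ∧ f ∈ S ∧ DependsOn c (S : Set P) ∧ ∃ a₀, ∀ β β', aE β β' = a₀) ∨
      (b ∈ S ∧ f ∈ S ∧ DependsOn c (S : Set P) ∧ (∀ β β', aE β β' = β) ∧
        ∃ k₀, ∀ w, ρ w = w b + k₀) ∨
      (b ∉ S ∧ f ∈ S ∧ DependsOn c (S : Set P)) ∨ (b ∉ S ∧ f ∉ S)) :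
    ∫⁻ β, ∫⁻ β', (∫⁻ w : P → T3, resProd ε Finset.univ (a β β') w *
        res ε (aE β β') (σ • w b + (τ • w f + c w)) * (res ε β (ρ w) * res ε β' (ρ' w))) ∂μ ∂μ
      ≤ E * E * (loopCost ε ^ Fintype.card P * crossCost ε) := by
  have hcard : loopCost ε ^ Fintype.card P = loopCost ε ^ Sᶜ.card * loopCost ε ^ S.card := by
    rw [← pow_add, add_comm, Finset.card_add_card_compl]
  have hEm : Measurable fun w : P → T3 => σ • w b + (τ • w f + c w) :=
    ((measurable_pi_apply b).const_smul σ).add (((measurable_pi_apply f).const_smul τ).add hcm)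
  have hEm2 : Measurable fun w : P → T3 => τ • w f + c w :=
    ((measurable_pi_apply f).const_smul τ).add hcm
  have hdρ : ∀ (β β' : ℝ), DependsOn (fun w => res ε β (ρ w) * res ε β' (ρ' w)) (S : Set P) := by
    intro β β' w w' h
    simp only
    rw [hρ h, hρ' h]
  have hprod : ∀ β β' w, resProd ε Finset.univ (a β β') w
      = resProd ε Sᶜ (a β β') w * resProd ε S aS w := by
    intro β β' w
    rw [resProd_univ ε S, resProd, resProd, resProd]
    congr 1
    exact Finset.prod_congr rfl fun m hm => by rw [haS β β' m hm]
  have hScc : (((Sᶜ : Finset P) : Set P))ᶜ = (S : Set P) := by simp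
  have hdS : DependsOn (resProd ε S aS) (S : Set P) := dependsOn_resProd ε S aS
  have w₀ : P → T3 := 0
  -- Reduction to the case in which the energies only enter through `ρ` and `ρ'`.
  have main : ∀ H : (P → T3) → ℝ≥0∞, Measurable H →
      (∀ β β' w, loopInt Sᶜ (fun w => resProd ε Finset.univ (a β β') w *
        res ε (aE β β') (σ • w b + (τ • w f + c w)) * (res ε β (ρ w) * res ε β' (ρ' w))) w
        ≤ loopCost ε ^ Sᶜ.card * (H w * (res ε β (ρ w) * res ε β' (ρ' w)))) →
      loopInt S H w₀ ≤ loopCost ε ^ S.card * crossCost ε →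
      ∫⁻ β, ∫⁻ β', (∫⁻ w : P → T3, resProd ε Finset.univ (a β β') w *
        res ε (aE β β') (σ • w b + (τ • w f + c w)) * (res ε β (ρ w) * res ε β' (ρ' w))) ∂μ ∂μ
      ≤ E * E * (loopCost ε ^ Fintype.card P * crossCost ε) := by
    intro H hH h1 h2
    calc _ ≤ ∫⁻ β, ∫⁻ β', loopCost ε ^ Sᶜ.card *
          loopInt S (fun w => H w * (res ε β (ρ w) * res ε β' (ρ' w))) w₀ ∂μ ∂μ := by
          refine lintegral_mono fun β => lintegral_mono fun β' => ?_
          simp only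
          rw [lintegral_eq_loopInt_compl S (by fun_prop) w₀, ← loopInt_const_mul S _ (by fun_prop)]
          exact lmarginal_mono (h1 β β') w₀
      _ = loopCost ε ^ Sᶜ.card * ∫⁻ β, ∫⁻ β',
          loopInt S (fun w => H w * (res ε β (ρ w) * res ε β' (ρ' w))) w₀ ∂μ ∂μ := by
          have hm : Measurable fun p : ℝ × ℝ =>
              loopInt S (fun w => H w * (res ε p.1 (ρ w) * res ε p.2 (ρ' w))) w₀ := by
            unfold loopInt lmarginal
            refine Measurable.lintegral_prod_right' (f := fun p : (ℝ × ℝ) × (S → T3) =>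
              H (Function.updateFinset w₀ S p.2) * (res ε p.1.1 (ρ (Function.updateFinset w₀ S p.2))
                * res ε p.1.2 (ρ' (Function.updateFinset w₀ S p.2)))) ?_
            have hu : Measurable fun p : (ℝ × ℝ) × (S → T3) => Function.updateFinset w₀ S p.2 :=
              measurable_updateFinset.comp measurable_snd
            fun_prop
          exact lintegral_lintegral_const_mul μ _ hm
      _ ≤ loopCost ε ^ Sᶜ.card * (E * E * (loopCost ε ^ S.card * crossCost ε)) := by
          gcongr
          exact (lintegral_energies_loopInt_le hE S hH hρm hρm' w₀).trans (by gcongr)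
      _ = _ := by rw [hcard]; ring
  rcases hcases with ⟨hb, hf, hcS, a₀, ha₀⟩ | ⟨hb, hf, hcS, haβ, k₀, hk₀⟩ | ⟨hb, hf, hcS⟩ |
    ⟨hb, hf⟩
  -- All three resolvents of the crossing have fixed energies. The loop momenta outside `S` go
  -- first, then both energies, then the crossing within `S`.
  · refine main (fun w => resProd ε S aS w * res ε a₀ (σ • w b + (τ • w f + c w))) (by fun_prop)
      (fun β β' w => ?_) ?_
    · simp_rw [ha₀, hprod, mul_assoc]
      refine loopInt_resProd_mul_le hε hε3 le_rfl (a β β')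
        (g := fun w => resProd ε S aS w * (res ε a₀ (σ • w b + (τ • w f + c w)) *
          (res ε β (ρ w) * res ε β' (ρ' w)))) ?_ w
      rw [hScc]
      intro w w' h
      simp only
      rw [hρ h, hρ' h, hdS h, hcS h, h b hb, h f hf]
    · have := loopInt_cross_both_le hε hε3 hb hf hbf aS a₀ hσ hτ hc hcm (g := fun _ => 1)
        (fun _ _ _ => rfl) measurable_const le_rfl w₀
      simpa using this
  -- Here `β` occurs in the extra resolvent as well as in that of `ρ`. After `β'`, the momentum `w
  -- f` is integrated at fixed `β`, which is possible because `ρ` does not contain it and the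
  -- two-resolvent bound is uniform. Then `β` remains only at `ρ` and can be integrated, and `w b`
  -- comes last.
  · have hm0 : Measurable fun w : P → T3 => w b + k₀ :=
      (measurable_pi_apply b).add measurable_const
    calc _ ≤ ∫⁻ β, ∫⁻ β', loopInt S (fun w => loopCost ε ^ Sᶜ.card * (resProd ε S aS w *
          res ε β (σ • w b + (τ • w f + c w)) * res ε β (w b + k₀) * res ε β' (ρ' w))) w₀ ∂μ ∂μ := by
          refine lintegral_mono fun β => lintegral_mono fun β' => ?_
          simp only
          rw [lintegral_eq_loopInt_compl S (by fun_prop) w₀]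
          refine lmarginal_mono (fun w => ?_) w₀
          simp_rw [haβ, hprod, hk₀, mul_assoc]
          refine loopInt_resProd_mul_le hε hε3 le_rfl (a β β')
            (g := fun w => resProd ε S aS w * (res ε β (σ • w b + (τ • w f + c w)) *
              (res ε β (w b + k₀) * res ε β' (ρ' w)))) ?_ w
          rw [hScc]
          intro w w' h
          simp only
          rw [hρ' h, hdS h, hcS h, h b hb, h f hf]
      _ ≤ ∫⁻ β, loopInt S (fun w => loopCost ε ^ Sᶜ.card * E * (resProd ε S aS w *
          res ε β (σ • w b + (τ • w f + c w)) * res ε β (w b + k₀))) w₀ ∂μ := by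
          refine lintegral_mono fun β => ?_
          simp only
          rw [lintegral_loopInt_swap μ S (F := fun β' w => loopCost ε ^ Sᶜ.card *
            (resProd ε S aS w * res ε β (σ • w b + (τ • w f + c w)) * res ε β (w b + k₀)
              * res ε β' (ρ' w))) (by fun_prop)]
          refine lmarginal_mono (fun w => ?_) w₀
          simp_rw [← mul_assoc]
          rw [lintegral_const_mul _ (by fun_prop), mul_comm]
          calc _ ≤ E * (loopCost ε ^ Sᶜ.card * resProd ε S aS w *
                res ε β (σ • w b + (τ • w f + c w)) * res ε β (w b + k₀)) := by
                gcongr; exact hE _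
            _ = _ := by ring
      _ ≤ ∫⁻ β, loopInt (S.erase f) (fun w => loopCost ε ^ Sᶜ.card * E *
          (resProd ε (S.erase f) aS w * crossBound ε (σ • w b + c w) * res ε β (w b + k₀))) w₀ ∂μ := by
          refine lintegral_mono fun β => ?_
          simp only
          have hm3 : Measurable fun w : P → T3 => σ • w b + c w :=
            ((measurable_pi_apply b).const_smul σ).add hcm
          rw [loopInt_const_mul S _ (by fun_prop), loopInt_const_mul (S.erase f) _ (by fun_prop)]
          gcongr
          have h1 := loopInt_cross_first_le hε hε3 hf aS β hτ (d := fun w => σ • w b + c w) ?_ hm3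
            (g := fun w => res ε β (w b + k₀)) ?_ (by fun_prop) w₀
          · refine le_trans (le_of_eq ?_) h1
            congr 1
            funext w
            congr 3
            abel
          · intro w w' h
            simp only
            rw [h b (by simpa using hbf), hc fun i hi => h i fun hi' => hi (Or.inr hi')]
          · intro w w' h
            simp only
            rw [h b (by simpa using hbf)]
      _ ≤ loopInt (S.erase f) (fun w => loopCost ε ^ Sᶜ.card * E * E *
          (resProd ε (S.erase f) aS w * crossBound ε (σ • w b + c w) * 1)) w₀ := by
          have hm3 : Measurable fun w : P → T3 => σ • w b + c w :=
            ((measurable_pi_apply b).const_smul σ).add hcm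
          rw [lintegral_loopInt_swap μ (S.erase f) (F := fun β w => loopCost ε ^ Sᶜ.card * E *
            (resProd ε (S.erase f) aS w * crossBound ε (σ • w b + c w) * res ε β (w b + k₀)))
            (by fun_prop)]
          refine lmarginal_mono (fun w => ?_) w₀
          simp_rw [← mul_assoc]
          rw [lintegral_const_mul _ (by fun_prop), mul_comm]
          calc _ ≤ E * (loopCost ε ^ Sᶜ.card * E * resProd ε (S.erase f) aS w *
                crossBound ε (σ • w b + c w)) := by
                gcongr; exact hE _
            _ = _ := by ring
      _ ≤ loopCost ε ^ Sᶜ.card * E * E * (loopCost ε ^ S.card * (crossCost ε * 1)) := by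
          have hm3 : Measurable fun w : P → T3 => σ • w b + c w :=
            ((measurable_pi_apply b).const_smul σ).add hcm
          rw [loopInt_const_mul (S.erase f) _ (by fun_prop)]
          gcongr
          refine loopInt_cross_second_le hε hε3 (Finset.mem_erase.2 ⟨hbf, hb⟩) aS hσ ?_ hcm
            (g := fun _ => 1) (fun _ _ _ => rfl) measurable_const Finset.card_erase_le w₀
          intro w w' h
          exact hc fun i hi => h i fun hi' => hi (Or.inl hi')
      _ = _ := by rw [hcard]; ring
  -- The momentum `w b` is integrated with the others outside `S` at fixed energies. The remaining
  -- `crossBound` is free of `β` and `β'`, so both energies can be integrated before `w f`.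
  · refine main (fun w => resProd ε S aS w * crossBound ε (τ • w f + c w)) (by fun_prop)
      (fun β β' w => ?_) ?_
    · have hb' : b ∈ Sᶜ := Finset.mem_compl.2 hb
      have h1 := loopInt_cross_first_le hε hε3 hb' (a β β') (aE β β') hσ
        (d := fun w => τ • w f + c w) ?_ hEm2
        (g := fun w => resProd ε S aS w * (res ε β (ρ w) * res ε β' (ρ' w))) ?_ (by fun_prop) w
      · have h2 := loopInt_resProd_mul_le hε hε3 (S := Sᶜ.erase b) (n := Sᶜ.card)
          Finset.card_erase_le (a β β') (g := fun w => crossBound ε (τ • w f + c w) *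
            (resProd ε S aS w * (res ε β (ρ w) * res ε β' (ρ' w)))) ?_ w
        · refine le_trans (le_of_eq ?_) (h1.trans (le_trans (le_of_eq ?_) (h2.trans (le_of_eq ?_))))
          · congr 1
            funext w
            rw [hprod]
            ring
          · congr 1
            funext w
            ring
          · ring
        · intro w w' h
          have h' : ∀ i ∈ (S : Set P), w i = w' i := fun i hi => h i fun hi' =>
            (Finset.mem_compl.1 (Finset.mem_of_mem_erase hi')) hi
          simp only
          rw [hρ h', hρ' h', hdS h', hcS h', h' f hf]
      · intro w w' h
        simp only
        rw [h f (by simpa using hbf.symm), hc fun i hi => h i fun hi' => hi (Or.inl hi')]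
      · intro w w' h
        have h' : ∀ i ∈ (S : Set P), w i = w' i := fun i hi => h i fun hi' =>
          hb (by rw [mem_singleton_iff] at hi'; rwa [hi'] at hi)
        simp only
        rw [hρ h', hρ' h', hdS h']
    · have := loopInt_cross_second_le hε hε3 hf aS hτ (d := c) ?_ hcm (g := fun _ => 1)
        (fun _ _ _ => rfl) measurable_const le_rfl w₀
      · simpa using this
      · intro w w' h
        exact hc fun i hi => h i fun hi' => hi (Or.inr hi')
  -- The whole crossing lies outside `S` and is integrated before the energies, with a bound uniform
  -- in them.
  · refine main (fun w => resProd ε S aS w * crossCost ε) (by fun_prop) (fun β β' w => ?_) ?_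
    · have h1 := loopInt_cross_both_le hε hε3 (Finset.mem_compl.2 hb) (Finset.mem_compl.2 hf) hbf
        (a β β') (aE β β') hσ hτ hc hcm
        (g := fun w => resProd ε S aS w * (res ε β (ρ w) * res ε β' (ρ' w))) ?_ (by fun_prop)
        le_rfl w
      · refine le_trans (le_of_eq ?_) (h1.trans (le_of_eq ?_))
        · congr 1
          funext w
          rw [hprod]
          ring
        · ring
      · rw [hScc]
        intro w w' h
        simp only
        rw [hρ h, hρ' h, hdS h]
    · exact loopInt_resProd_mul_le hε hε3 le_rfl aS (g := fun _ => crossCost ε)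
        (fun _ _ _ => rfl) w₀

end Energies

/-! ### Triangular affine changes of variables on a power of the torus -/

section Triangular

variable {P : Type*}

/-- One step of solving `s m • q m + A q m = w m` for `q`. -/
def solveStep (s : P → ℤ) (A : (P → T3) → P → T3) (w q : P → T3) : P → T3 :=
  fun m => s m • (w m - A q m)

/-- The solution `q` of the triangular system `s m • q m + A q m = w m`. -/
def triSolve (s : P → ℤ) (A : (P → T3) → P → T3) (R : ℕ) (w : P → T3) : P → T3 :=
  (solveStep s A w)^[R] 0

variable {s : P → ℤ} {A : (P → T3) → P → T3} {r : P → ℕ}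

theorem sign_smul_sign_smul {σ : ℤ} (hσ : σ = 1 ∨ σ = -1) (x : T3) : σ • σ • x = x := by
  rcases hσ with rfl | rfl <;> simp

/-- Each iteration settles one more rank. Hence finitely many iterations solve the system exactly,
whatever the starting point, which gives existence as well as uniqueness. -/
theorem solveStep_iterate_congr (hA : ∀ m, DependsOn (fun q => A q m) {m' | r m' < r m})
    (w : P → T3) (n : ℕ) (q q' : P → T3) (m : P) (hm : r m < n) :
    (solveStep s A w)^[n] q m = (solveStep s A w)^[n] q' m := by
  induction n generalizing m with
  | zero => omega
  | succ n ih =>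
    rw [Function.iterate_succ_apply', Function.iterate_succ_apply', solveStep, solveStep]
    congr 2
    exact hA m fun m' (hm' : r m' < r m) => ih m' (by omega)

theorem triSolve_spec (hs : ∀ m, s m = 1 ∨ s m = -1)
    (hA : ∀ m, DependsOn (fun q => A q m) {m' | r m' < r m}) {R : ℕ} (hR : ∀ m, r m < R)
    (w : P → T3) (m : P) :
    s m • triSolve s A R w m + A (triSolve s A R w) m = w m := by
  have h : solveStep s A w (triSolve s A R w) = triSolve s A R w := by
    rw [triSolve, ← Function.iterate_succ_apply' (solveStep s A w), Function.iterate_succ_apply]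
    exact funext fun m => solveStep_iterate_congr hA w R _ _ m (hR m)
  conv_lhs => enter [1, 2]; rw [← h]
  rw [solveStep, sign_smul_sign_smul (hs m)]
  abel

theorem triSolve_eq (hs : ∀ m, s m = 1 ∨ s m = -1)
    (hA : ∀ m, DependsOn (fun q => A q m) {m' | r m' < r m}) {R : ℕ} (hR : ∀ m, r m < R)
    (q : P → T3) : triSolve s A R (fun m => s m • q m + A q m) = q := by
  have h : Function.IsFixedPt (solveStep s A fun m => s m • q m + A q m) q := by
    funext m
    rw [solveStep, add_sub_cancel_right, sign_smul_sign_smul (hs m)]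
  rw [triSolve]
  conv_rhs => rw [← (h.iterate R).eq]
  exact funext fun m => solveStep_iterate_congr hA _ R _ _ m (hR m)

theorem triSolve_dependsOn (hA : ∀ m, DependsOn (fun q => A q m) {m' | r m' < r m}) (R : ℕ)
    (m : P) : DependsOn (fun w => triSolve s A R w m) {m' | r m' ≤ r m} := by
  intro w w' h
  suffices H : ∀ n, ∀ m₁, r m₁ ≤ r m → (solveStep s A w)^[n] 0 m₁ = (solveStep s A w')^[n] 0 m₁ from
    H R m le_rfl
  intro n
  induction n with
  | zero => simp
  | succ n ih =>
    intro m₁ hm₁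
    rw [Function.iterate_succ_apply', Function.iterate_succ_apply', solveStep, solveStep, h m₁ hm₁]
    congr 2
    exact hA m₁ fun m' (hm' : r m' < r m₁) => ih m' (by omega)

theorem continuous_triSolve (hA : Continuous A) (R : ℕ) : Continuous (triSolve s A R) := by
  unfold triSolve
  induction R with
  | zero => exact continuous_const
  | succ n ih =>
    simp_rw [Function.iterate_succ_apply']
    refine continuous_pi fun m => ?_
    unfold solveStep
    exact ((continuous_apply m).sub ((continuous_apply m).comp (hA.comp ih))).zsmul (s m)

/-- Triangular affine changes of loop momenta preserve the measure. -/
theorem measurePreserving_triangular [Fintype P] (hs : ∀ m, s m = 1 ∨ s m = -1)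
    (hA : ∀ m, DependsOn (fun q => A q m) {m' | r m' < r m})
    (hadd : ∀ q q', A (q + q') + A 0 = A q + A q') (hc : Continuous A) :
    MeasurePreserving (fun (q : P → T3) m => s m • q m + A q m) := by
  obtain ⟨R, hR⟩ : ∃ R, ∀ m, r m < R :=
    ⟨Finset.univ.sup r + 1, fun m => Nat.lt_succ_of_le (Finset.le_sup (Finset.mem_univ m))⟩
  -- The homogeneous part is a continuous surjective endomorphism of a compact group and therefore
  -- preserves Haar measure. The constant part is a translation.
  let L : (P → T3) →+ (P → T3) :=
    { toFun := fun q m => s m • q m + (A q m - A 0 m)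
      map_zero' := by ext; simp
      map_add' := fun q q' => by
        have h := hadd q q'
        funext m
        have h' : A (q + q') m = A q m + A q' m - A 0 m := by
          rw [eq_sub_iff_add_eq]; exact congrFun h m
        simp only [Pi.add_apply, h', smul_add]
        abel }
  have hcont : Continuous L := by
    refine continuous_pi fun m => ?_
    exact ((continuous_apply m).zsmul _).add (((continuous_apply m).comp hc).sub continuous_const)
  have hsurj : Function.Surjective L := by
    intro w
    refine ⟨triSolve s A R (w + A 0), ?_⟩
    funext m
    have := triSolve_spec hs hA hR (w + A 0) m
    show s m • triSolve s A R (w + A 0) m + (A (triSolve s A R (w + A 0)) m - A 0 m) = w m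
    rw [← add_sub_assoc, this]
    simp
  have : BorelSpace (P → T3) := Pi.borelSpace
  have : (volume : Measure (P → T3)).IsAddHaarMeasure :=
    @Measure.pi.isAddHaarMeasure P (fun _ => T3) _ _ _ _ _ _ _ _
  have h1 : MeasurePreserving L volume volume := L.measurePreserving hcont hsurj rfl
  have h2 := (measurePreserving_add_right (volume : Measure (P → T3)) (A 0)).comp h1
  have h3 : (fun (q : P → T3) m => s m • q m + A q m) = (fun x => x + A 0) ∘ L := by
    funext q m
    show _ = s m • q m + (A q m - A 0 m) + A 0 m
    abel
  rw [h3]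
  exact h2

end Triangular

/-! ### Paired lines and the order of integration -/

/-- The positions of the interactions on a line with `N` steps, without the `n`-th one. -/
abbrev LinePos (N n : ℕ) : Type := {l : Fin N // (l : ℕ) ≠ n}

/-- Two lines with `N` steps each, whose interactions are paired. The step at an interaction is,
up to a sign, the momentum difference of its pair. -/
structure PairedLines (N n : ℕ) (P : Type*) where
  partner : Fin 2 × LinePos N n → Fin 2 × LinePos N n
  partner_partner : ∀ b, partner (partner b) = b
  partner_ne : ∀ b, partner b ≠ b
  pair : Fin 2 × LinePos N n → P
  pair_surjective : Function.Surjective pair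
  pair_eq : ∀ {b b'}, pair b = pair b' → b' = b ∨ b' = partner b
  pair_partner : ∀ b, pair (partner b) = pair b
  sign : Fin 2 × LinePos N n → ℤ
  sign_eq : ∀ b, sign b = 1 ∨ sign b = -1
  sign_partner : ∀ b, (partner b).1 = b.1 → sign (partner b) = -sign b

namespace PairedLines

variable {N n : ℕ} {P : Type*} (G : PairedLines N n P)

/-- The momentum step at `l`. -/
def step (ζ : Fin 2 → T3) (q : P → T3) (j : Fin 2) (l : Fin N) : T3 :=
  if h : (l : ℕ) = n then ζ j else G.sign (j, ⟨l, h⟩) • q (G.pair (j, ⟨l, h⟩))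

/-- The momentum `k_l` on the line `j`. -/
def mom (p ζ : Fin 2 → T3) (q : P → T3) (j : Fin 2) (l : Fin (N + 1)) : T3 :=
  p j + ∑ i : Fin N with i.castSucc < l, G.step ζ q j i

variable (p ζ : Fin 2 → T3)

theorem filter_castSucc_lt_succ (l : Fin N) :
    (Finset.univ.filter fun i : Fin N => i.castSucc < l.succ)
      = insert l (Finset.univ.filter fun i : Fin N => i.castSucc < l.castSucc) := by
  ext i
  simp [Fin.castSucc_lt_succ_iff, le_iff_eq_or_lt]

theorem mom_succ (q : P → T3) (j : Fin 2) (l : Fin N) :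
    G.mom p ζ q j l.succ = G.mom p ζ q j l.castSucc + G.step ζ q j l := by
  unfold mom
  rw [filter_castSucc_lt_succ, Finset.sum_insert (by simp)]
  abel

theorem mom_succ_pos (q : P → T3) (b : Fin 2 × LinePos N n) :
    G.mom p ζ q b.1 b.2.1.succ = G.sign b • q (G.pair b) + G.mom p ζ q b.1 b.2.1.castSucc := by
  rw [mom_succ, step, dif_neg b.2.2, add_comm]

theorem mom_zero (q : P → T3) (j : Fin 2) : G.mom p ζ q j 0 = p j := by
  simp [mom]

theorem mom_eq_add (q : P → T3) (j : Fin 2) (l : Fin (N + 1)) :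
    G.mom p ζ q j l = G.mom 0 0 q j l
      + (p j + ∑ i : Fin N with i.castSucc < l, if (i : ℕ) = n then ζ j else 0) := by
  unfold mom
  have h : ∀ i : Fin N, G.step ζ q j i = G.step 0 q j i + if (i : ℕ) = n then ζ j else 0 := by
    intro i
    unfold step
    split_ifs <;> simp
  simp_rw [h]
  rw [Finset.sum_add_distrib]
  simp only [Pi.zero_apply]
  abel

theorem mom_add (q q' : P → T3) (j : Fin 2) (l : Fin (N + 1)) :
    G.mom p ζ (q + q') j l + G.mom p ζ 0 j l = G.mom p ζ q j l + G.mom p ζ q' j l := by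
  unfold mom
  have h : ∀ i : Fin N, G.step ζ (q + q') j i + G.step ζ 0 j i
      = G.step ζ q j i + G.step ζ q' j i := by
    intro i
    unfold step
    split_ifs <;> simp
  rw [add_add_add_comm, ← Finset.sum_add_distrib, Finset.sum_congr rfl fun i _ => h i,
    Finset.sum_add_distrib]
  abel

theorem dependsOn_mom (j : Fin 2) (l : Fin (N + 1)) : DependsOn (fun q => G.mom p ζ q j l)
    {m | ∃ x : LinePos N n, x.1.castSucc < l ∧ G.pair (j, x) = m} := by
  intro q q' h
  simp only [mom]
  congr 1
  refine Finset.sum_congr rfl fun i hi => ?_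
  unfold step
  split_ifs with h1
  · rfl
  · rw [h _ ⟨⟨i, h1⟩, (Finset.mem_filter.1 hi).2, rfl⟩]

theorem continuous_mom : Continuous fun x : (Fin 2 → T3) × (Fin 2 → T3) × (P → T3) =>
    G.mom x.1 x.2.1 x.2.2 := by
  refine continuous_pi fun j => continuous_pi fun l => ?_
  unfold mom
  refine ((continuous_apply j).comp continuous_fst).add (continuous_finsetSum _ fun i _ => ?_)
  unfold step
  split_ifs with h
  · exact (continuous_apply j).comp (continuous_fst.comp continuous_snd)
  · exact ((continuous_apply _).comp (continuous_snd.comp continuous_snd)).zsmul _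

/-- An order of integration adapted to a crossing on the line `j`. -/
def rank (N n : ℕ) (j : Fin 2) (b : Fin 2 × LinePos N n) : ℕ :=
  if b.1 = j then N + b.2.1 else if (b.2.1 : ℕ) < n then b.2.1 else 2 * N + b.2.1

variable {j : Fin 2}

theorem rank_self (x : LinePos N n) : rank N n j (j, x) = N + x.1 := by simp [rank]

theorem rank_lt_of_lt (i : Fin 2) {x y : LinePos N n} (h : x < y) :
    rank N n j (i, x) < rank N n j (i, y) := by
  have h' : (x.1 : ℕ) < y.1 := h
  unfold rank
  simp only
  split_ifs <;> omega

theorem rank_injective (hn : n < N) : Function.Injective (rank N n j) := by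
  rintro ⟨i, x, hx⟩ ⟨i', y, hy⟩ h
  unfold rank at h
  simp only at h
  have hx' := x.2
  have hy' := y.2
  have key : i = i' ∧ (x : ℕ) = y := by
    refine ⟨?_, ?_⟩
    · by_contra hne
      split_ifs at h <;> omega
    · split_ifs at h <;> omega
  obtain ⟨rfl, h2⟩ := key
  obtain rfl := Fin.ext h2
  rfl

/-- The order runs through the other line before `n`, then all of the line `j`, then the other line
after `n`. Its cut at `N + n` separates the interactions followed by a momentum of energy `α` from
those followed by one of energy `β`, while the line `j` stays contiguous for the crossing argument.
-/
theorem rank_lt_iff (b : Fin 2 × LinePos N n) :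
    rank N n j b < N + n ↔ (b.2.1 : ℕ) < n := by
  have := b.2.2
  unfold rank
  split_ifs <;> omega

theorem rank_lt (b : Fin 2 × LinePos N n) : rank N n j b < 3 * N := by
  have := b.2.1.2
  unfold rank
  split_ifs <;> omega

theorem eq_of_rank_between {y : Fin 2 × LinePos N n} (h : N ≤ rank N n j y)
    (h' : rank N n j y < 2 * N) : y.1 = j := by
  by_contra hne
  unfold rank at h h'
  rw [if_neg hne] at h h'
  split_ifs at h h' <;> omega

/-- The interaction of a pair that comes first in the order of integration. -/
noncomputable def opening (j : Fin 2) (m : P) : Fin 2 × LinePos N n :=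
  let b := (G.pair_surjective m).choose
  if rank N n j b < rank N n j (G.partner b) then b else G.partner b

theorem rank_ne (hn : n < N) (b : Fin 2 × LinePos N n) :
    rank N n j b ≠ rank N n j (G.partner b) := fun h =>
  G.partner_ne b (rank_injective hn h).symm

theorem pair_opening (m : P) : G.pair (G.opening j m) = m := by
  have h := (G.pair_surjective m).choose_spec
  unfold opening
  simp only
  split_ifs
  · exact h
  · rw [pair_partner, h]

theorem rank_opening_lt (hn : n < N) (m : P) :
    rank N n j (G.opening j m) < rank N n j (G.partner (G.opening j m)) := by
  unfold opening
  simp only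
  split_ifs with h1
  · exact h1
  · rw [partner_partner]
    exact lt_of_le_of_ne (not_lt.1 h1) (G.rank_ne hn _).symm

theorem opening_pair (hn : n < N) {b : Fin 2 × LinePos N n}
    (h : rank N n j b < rank N n j (G.partner b)) : G.opening j (G.pair b) = b := by
  rcases G.pair_eq (G.pair_opening (j := j) (G.pair b)).symm with h1 | h1
  · exact h1
  · have h2 := G.rank_opening_lt hn (j := j) (G.pair b)
    rw [h1, partner_partner] at h2
    omega

theorem rank_opening_pair_le (hn : n < N) (b : Fin 2 × LinePos N n) :
    rank N n j (G.opening j (G.pair b)) ≤ rank N n j b := by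
  rcases lt_or_gt_of_ne (G.rank_ne hn (j := j) b) with h | h
  · rw [G.opening_pair hn h]
  · have : G.opening j (G.pair b) = G.partner b := by
      rw [← G.pair_partner, G.opening_pair hn]
      rwa [partner_partner]
    rw [this]
    exact h.le

theorem opening_injective : Function.Injective (G.opening j) := fun m m' h => by
  rw [← G.pair_opening (j := j) m, h, pair_opening]

theorem opening_ne_of_lt (hn : n < N) {b : Fin 2 × LinePos N n}
    (h : rank N n j (G.partner b) < rank N n j b) (m : P) : G.opening j m ≠ b := by
  rintro rfl
  have := G.rank_opening_lt hn (j := j) m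
  omega

/-- The openings and their partners enumerate the `2 * (N - 1)` interactions without repetition. -/
theorem card_pairs {N n : ℕ} {P : Type*} (G : PairedLines N n P) (hn : n < N) [Fintype P] :
     Fintype.card P + 1 = N := by
  have h1 : Function.Bijective (Sum.elim (G.opening 0) (G.partner ∘ G.opening 0)) := by
    have hp : Function.Injective G.partner := fun x y h => by
      rw [← G.partner_partner x, h, partner_partner]
    refine ⟨(G.opening_injective).sumElim (hp.comp (G.opening_injective)) ?_, ?_⟩
    · intro m m' h
      have h1 := G.rank_opening_lt hn (j := 0) m
      have h2 := G.rank_opening_lt hn (j := 0) m'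
      rw [h, Function.comp_apply, partner_partner] at h1
      omega
    · intro b
      rcases G.pair_eq (G.pair_opening (j := 0) (G.pair b)) with h | h
      · exact ⟨Sum.inl _, h.symm⟩
      · exact ⟨Sum.inr _, h.symm⟩
  have h2 := Fintype.card_of_bijective h1
  have h3 : Fintype.card (LinePos N n) + 1 = N := by
    have h4 : Fintype.card {l : Fin N // (l : ℕ) = n} = 1 :=
      Fintype.card_eq_one_iff.2 ⟨⟨⟨n, hn⟩, rfl⟩, fun y => Subtype.ext (Fin.ext y.2)⟩
    have h5 := Fintype.card_subtype_compl (fun l : Fin N => (l : ℕ) = n)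
    rw [h4, Fintype.card_fin] at h5
    have h6 : Fintype.card (LinePos N n) = N - 1 := h5
    omega
  simp only [Fintype.card_sum, Fintype.card_prod, Fintype.card_fin] at h2
  omega

end PairedLines

namespace PairedLines

variable {N n : ℕ} {P : Type*} (G : PairedLines N n P) (p ζ : Fin 2 → T3)

/-! ### Loop momenta as integration variables -/

section LoopMomenta

/-- The momentum before the opening interaction of each pair. -/
noncomputable def before (j : Fin 2) (q : P → T3) (m : P) : T3 :=
  G.mom p ζ q (G.opening j m).1 (G.opening j m).2.1.castSucc

/-- The loop momentum of a pair, which is the momentum after its opening interaction. -/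
noncomputable def loopMom (j : Fin 2) (q : P → T3) (m : P) : T3 :=
  G.sign (G.opening j m) • q m + G.before p ζ j q m

/-- The momentum differences of the pairs in terms of the loop momenta. -/
noncomputable def ofLoop (j : Fin 2) (w : P → T3) : P → T3 :=
  triSolve (fun m => G.sign (G.opening j m)) (G.before p ζ j) (3 * N) w

variable {j : Fin 2}

theorem mom_opening (q : P → T3) (m : P) :
    G.mom p ζ q (G.opening j m).1 (G.opening j m).2.1.succ = G.loopMom p ζ j q m := by
  rw [mom_succ_pos, loopMom, pair_opening]
  rfl

/-- Interactions to the left on the same line have smaller rank, and their pairs were opened no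
later than there. This is the triangularity of the passage to loop momenta. -/
theorem dependsOn_before (hn : n < N) (m : P) : DependsOn (fun q => G.before p ζ j q m)
    {m' | rank N n j (G.opening j m') < rank N n j (G.opening j m)} := by
  refine (G.dependsOn_mom p ζ _ _).mono ?_
  rintro _ ⟨x, hx, rfl⟩
  exact (G.rank_opening_pair_le hn _).trans_lt (rank_lt_of_lt _ (Fin.castSucc_lt_castSucc_iff.1 hx))

theorem continuous_before : Continuous (G.before p ζ j) := by
  refine continuous_pi fun m => ?_
  exact (continuous_apply _).comp ((continuous_apply _).comp (G.continuous_mom.comp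
    (continuous_const.prodMk (continuous_const.prodMk continuous_id))))

theorem measurePreserving_loopMom (hn : n < N) [Fintype P] :
    MeasurePreserving (G.loopMom p ζ j) :=
  measurePreserving_triangular (fun _ => G.sign_eq _) (G.dependsOn_before p ζ hn)
    (fun q q' => funext fun _ => G.mom_add p ζ q q' _ _) (G.continuous_before p ζ)

theorem ofLoop_loopMom (hn : n < N) (q : P → T3) :
    G.ofLoop p ζ j (G.loopMom p ζ j q) = q :=
  triSolve_eq (fun _ => G.sign_eq _) (G.dependsOn_before p ζ hn) (fun _ => rank_lt _) q

theorem loopMom_ofLoop (hn : n < N) (w : P → T3) :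
    G.loopMom p ζ j (G.ofLoop p ζ j w) = w :=
  funext fun m => triSolve_spec (fun _ => G.sign_eq _) (G.dependsOn_before p ζ hn)
    (fun _ => rank_lt _) w m

theorem mom_ofLoop_opening (hn : n < N) (w : P → T3) (m : P) :
    G.mom p ζ (G.ofLoop p ζ j w) (G.opening j m).1 (G.opening j m).2.1.succ = w m := by
  rw [mom_opening, loopMom_ofLoop _ _ _ hn]

/-- A momentum involves the pairs met to its left, and expressing these in loop momenta only brings
in pairs opened earlier. A bound on the ranks to the left thus controls the whole dependence. -/
theorem dependsOn_mom_ofLoop (hn : n < N) (i : Fin 2) (l : Fin (N + 1)) {R : ℕ}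
    (hR : ∀ x : LinePos N n, x.1.castSucc < l → rank N n j (i, x) < R) :
    DependsOn (fun w => G.mom p ζ (G.ofLoop p ζ j w) i l)
      {m | rank N n j (G.opening j m) < R} := by
  intro w w' h
  refine G.dependsOn_mom p ζ i l ?_
  rintro _ ⟨x, hx, rfl⟩
  refine triSolve_dependsOn (G.dependsOn_before p ζ hn) (3 * N) _ fun m' hm' => h m' ?_
  exact lt_of_le_of_lt (le_trans hm' (G.rank_opening_pair_le hn _)) (hR x hx)

theorem continuous_mom_ofLoop (i : Fin 2) (l : Fin (N + 1)) :
    Continuous fun w => G.mom p ζ (G.ofLoop p ζ j w) i l :=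
  (continuous_apply _).comp ((continuous_apply _).comp (G.continuous_mom.comp
    (continuous_const.prodMk (continuous_const.prodMk
      (continuous_triSolve (G.continuous_before p ζ) _)))))

theorem measurable_mom_ofLoop [Fintype P] (i : Fin 2) (l : Fin (N + 1)) :
    Measurable fun w => G.mom p ζ (G.ofLoop p ζ j w) i l := by
  have : BorelSpace (P → T3) := Pi.borelSpace
  exact (G.continuous_mom_ofLoop p ζ i l).measurable

theorem lintegral_eq_lintegral_ofLoop (hn : n < N) [Fintype P] {F : (P → T3) → ℝ≥0∞}
    (hF : Measurable F) : ∫⁻ q, F q = ∫⁻ w, F (G.ofLoop p ζ j w) := by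
  have : BorelSpace (P → T3) := Pi.borelSpace
  have hm : Measurable (G.ofLoop p ζ j) :=
    (continuous_triSolve (G.continuous_before p ζ) _).measurable
  refine Eq.trans ?_ ((G.measurePreserving_loopMom p ζ (j := j) hn).lintegral_comp (hF.comp hm))
  exact lintegral_congr fun q => by rw [ofLoop_loopMom _ _ _ hn]

end LoopMomenta

/-! ### Minimal crossings and the cancellation inside them -/

section Crossing

/-- An internal contraction `l₁ — l₂` of the line `j`, and an interaction between `l₁` and `l₂` whose
partner is not between them. -/
def HasCrossing (j : Fin 2) : Prop :=
  ∃ l₁ i l₂ : LinePos N n, G.partner (j, l₁) = (j, l₂) ∧ l₁ < i ∧ i < l₂ ∧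
    ∀ x, G.partner (j, i) = (j, x) → x < l₁ ∨ l₂ < x

variable {j : Fin 2}

/-- In the order of integration, a pair opened before `b` is closed at `s` while the pair of `b` is
still open. If the partner of `i` precedes `l₁`, the choice is `(l₁, i)`; otherwise it follows `l₂`
and the choice is `(i, l₂)`. A partner on the other line has rank below or above all ranks of the
line `j`. -/
theorem exists_crossing (h : G.HasCrossing j) : ∃ b s : LinePos N n, b < s ∧
    rank N n j (G.partner (j, s)) < rank N n j (j, b) ∧
    rank N n j (j, s) < rank N n j (G.partner (j, b)) := by
  obtain ⟨l₁, i, l₂, h12, h1, h2, h3⟩ := h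
  have h21 : G.partner (j, l₂) = (j, l₁) := by rw [← h12, partner_partner]
  rcases lt_or_ge (rank N n j (G.partner (j, i))) (rank N n j (j, l₁)) with h4 | h4
  · exact ⟨l₁, i, h1, h4, by rw [h12]; exact rank_lt_of_lt _ h2⟩
  · refine ⟨i, l₂, h2, by rw [h21]; exact rank_lt_of_lt _ h1, ?_⟩
    by_contra h5
    rw [not_lt] at h5
    rw [rank_self] at h4 h5
    have hy : (G.partner (j, i)).1 = j :=
      eq_of_rank_between ((Nat.le_add_right _ _).trans h4) (by have := l₂.1.2; omega)
    have h6 := h3 (G.partner (j, i)).2 (Prod.ext hy rfl)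
    have h7 : G.partner (j, i) = (j, (G.partner (j, i)).2) := Prod.ext hy rfl
    rw [h7, rank_self] at h4 h5
    rcases h6 with h6 | h6
    · have : ((G.partner (j, i)).2.1 : ℕ) < l₁.1 := h6
      omega
    · have : (l₂.1 : ℕ) < (G.partner (j, i)).2.1 := h6
      omega

/-- A crossing that encloses only full contractions. -/
theorem exists_minimal_crossing (h : G.HasCrossing j) : ∃ b s : LinePos N n, b < s ∧
    rank N n j (G.partner (j, s)) < rank N n j (j, b) ∧
    rank N n j (j, s) < rank N n j (G.partner (j, b)) ∧
    ∀ x, b < x → x < s → ∃ y, b < y ∧ y < s ∧ G.partner (j, x) = (j, y) := by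
  obtain ⟨b₀, s₀, h₀⟩ := G.exists_crossing h
  suffices H : ∀ d : ℕ, ∀ b s : LinePos N n, (s.1 : ℕ) - b.1 ≤ d → b < s →
      rank N n j (G.partner (j, s)) < rank N n j (j, b) →
      rank N n j (j, s) < rank N n j (G.partner (j, b)) → ∃ b s : LinePos N n, b < s ∧
      rank N n j (G.partner (j, s)) < rank N n j (j, b) ∧
      rank N n j (j, s) < rank N n j (G.partner (j, b)) ∧
      ∀ x, b < x → x < s → ∃ y, b < y ∧ y < s ∧ G.partner (j, x) = (j, y) from
    H _ b₀ s₀ le_rfl h₀.1 h₀.2.1 h₀.2.2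
  -- Induction on the distance. If the partner of an enclosed `x` is not enclosed, it precedes `b`
  -- or follows `s` in the order of integration, and `(b, x)` or `(x, s)` is a shorter crossing.
  intro d
  induction d with
  | zero =>
    intro b s hd hbs
    have : (b.1 : ℕ) < s.1 := hbs
    omega
  | succ d ih =>
    intro b s hd hbs h1 h2
    by_cases hcl : ∀ x, b < x → x < s → ∃ y, b < y ∧ y < s ∧ G.partner (j, x) = (j, y)
    · exact ⟨b, s, hbs, h1, h2, hcl⟩
    push Not at hcl
    obtain ⟨x, hbx, hxs, hx⟩ := hcl
    have hbx' : (b.1 : ℕ) < x.1 := hbx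
    have hxs' : (x.1 : ℕ) < s.1 := hxs
    have hrb := rank_lt_of_lt (N := N) (n := n) (j := j) j hbx
    have hrs := rank_lt_of_lt (N := N) (n := n) (j := j) j hxs
    rcases lt_or_ge (rank N n j (G.partner (j, x))) (rank N n j (j, b)) with h4 | h4
    · exact ih b x (by omega) hbx h4 (hrs.trans h2)
    rcases lt_or_ge (rank N n j (j, s)) (rank N n j (G.partner (j, x))) with h5 | h5
    · exact ih x s (by omega) hxs (h1.trans hrb) h5
    exfalso
    rw [rank_self] at h4 h5
    have hy : (G.partner (j, x)).1 = j :=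
      eq_of_rank_between ((Nat.le_add_right _ _).trans h4) (by have := s.1.2; omega)
    have h7 : G.partner (j, x) = (j, (G.partner (j, x)).2) := Prod.ext hy rfl
    set y := (G.partner (j, x)).2
    have hpy : G.partner (j, y) = (j, x) := by rw [← h7, partner_partner]
    rw [h7, rank_self] at h4 h5
    have hyb : y ≠ b := by
      rintro hyb
      rw [← hyb, hpy] at h2
      omega
    have hys : y ≠ s := by
      rintro hys
      rw [← hys, hpy] at h1
      omega
    refine hx y (lt_of_le_of_ne ?_ hyb.symm) (lt_of_le_of_ne ?_ hys) h7
    · exact Subtype.coe_le_coe.1 (Fin.le_def.2 (by omega))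
    · exact Subtype.coe_le_coe.1 (Fin.le_def.2 (by omega))

/-- The enclosed interactions form complete internal pairs, whose two steps cancel. What may remain
is the step at `n`, which does not depend on the pair momenta. -/
theorem mom_castSucc_eq_of_closed {b s : LinePos N n} (hbs : b < s)
    (hcl : ∀ x, b < x → x < s → ∃ y, b < y ∧ y < s ∧ G.partner (j, x) = (j, y)) :
    ∃ κ, ∀ q, G.mom p ζ q j s.1.castSucc = G.mom p ζ q j b.1.succ + κ := by
  have hbs' : b.1 < s.1 := hbs
  suffices H : ∀ q, G.mom 0 0 q j s.1.castSucc = G.mom 0 0 q j b.1.succ by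
    refine ⟨(p j + ∑ i : Fin N with i.castSucc < s.1.castSucc, if (i : ℕ) = n then ζ j else 0) -
      (p j + ∑ i : Fin N with i.castSucc < b.1.succ, if (i : ℕ) = n then ζ j else 0), fun q => ?_⟩
    rw [G.mom_eq_add p ζ q j s.1.castSucc, G.mom_eq_add p ζ q j b.1.succ, H q]
    abel
  intro q
  have hsub : (Finset.univ.filter fun i : Fin N => i.castSucc < s.1.castSucc)
      = (Finset.univ.filter fun i : Fin N => i.castSucc < b.1.succ) ∪
        (Finset.univ.filter fun i : Fin N => b.1 < i ∧ i < s.1) := by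
    ext i
    simp only [Finset.mem_filter, Finset.mem_univ, true_and, Finset.mem_union,
      Fin.castSucc_lt_castSucc_iff, Fin.castSucc_lt_succ_iff]
    constructor
    · intro h
      rcases le_or_gt i b.1 with h1 | h1
      · exact Or.inl h1
      · exact Or.inr ⟨h1, h⟩
    · rintro (h | h)
      · exact h.trans_lt hbs'
      · exact h.2
  have hdisj : Disjoint (Finset.univ.filter fun i : Fin N => i.castSucc < b.1.succ)
      (Finset.univ.filter fun i : Fin N => b.1 < i ∧ i < s.1) := by
    rw [Finset.disjoint_left]
    intro i h1 h2
    simp only [Finset.mem_filter, Finset.mem_univ, true_and, Fin.castSucc_lt_succ_iff] at h1 h2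
    exact absurd h2.1 (not_lt.2 h1)
  unfold mom
  rw [hsub, Finset.sum_union hdisj, ← add_assoc]
  refine add_eq_left.2 ?_
  -- The fixed point at `n` is harmless for the cancellation, since its step has been made zero by
  -- passing to `ζ = 0`.
  let g : Fin N → Fin N := fun i => if h : (i : ℕ) = n then i else (G.partner (j, ⟨i, h⟩)).2.1
  have hg : ∀ x : LinePos N n, g x.1 = (G.partner (j, x)).2.1 := fun x => dif_neg x.2
  refine Finset.sum_involution (fun i _ => g i) ?_ ?_ ?_ ?_
  · intro i hi
    have hi' := (Finset.mem_filter.1 hi).2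
    by_cases h : (i : ℕ) = n
    · simp [g, h, step]
    · obtain ⟨y, hy1, hy2, hy3⟩ := hcl ⟨i, h⟩ hi'.1 hi'.2
      have hgi : g i = y.1 := by rw [show i = (⟨i, h⟩ : LinePos N n).1 from rfl, hg, hy3]
      have h2 := G.pair_partner (j, ⟨i, h⟩)
      have h3 := G.sign_partner (j, ⟨i, h⟩) (by rw [hy3])
      rw [hy3] at h2 h3
      rw [hgi, step, step, dif_neg h, dif_neg y.2]
      change _ + G.sign (j, y) • q (G.pair (j, y)) = 0
      rw [h2, h3, neg_smul, add_neg_cancel]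
  · intro i hi hne
    by_cases h : (i : ℕ) = n
    · simp [step, h] at hne
    · intro hgi
      have hi' := (Finset.mem_filter.1 hi).2
      obtain ⟨y, hy1, hy2, hy3⟩ := hcl ⟨i, h⟩ hi'.1 hi'.2
      refine G.partner_ne (j, ⟨i, h⟩) ?_
      rw [hy3]
      have : g i = y.1 := by rw [show i = (⟨i, h⟩ : LinePos N n).1 from rfl, hg, hy3]
      exact Prod.ext rfl (Subtype.ext (this.symm.trans hgi))
  · intro i hi
    have hi' := (Finset.mem_filter.1 hi).2
    by_cases h : (i : ℕ) = n
    · simpa [g, h] using hi'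
    · obtain ⟨y, hy1, hy2, hy3⟩ := hcl ⟨i, h⟩ hi'.1 hi'.2
      have : g i = y.1 := by rw [show i = (⟨i, h⟩ : LinePos N n).1 from rfl, hg, hy3]
      rw [this]
      exact Finset.mem_filter.2 ⟨Finset.mem_univ _, hy1, hy2⟩
  · intro i hi
    have hi' := (Finset.mem_filter.1 hi).2
    by_cases h : (i : ℕ) = n
    · simp [g, h]
    · obtain ⟨y, hy1, hy2, hy3⟩ := hcl ⟨i, h⟩ hi'.1 hi'.2
      have : g i = y.1 := by rw [show i = (⟨i, h⟩ : LinePos N n).1 from rfl, hg, hy3]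
      rw [this, hg, ← hy3, partner_partner]

end Crossing

end PairedLines

/-! ### The basic estimate for two lines with a crossing -/

theorem prod_le_prod_comp_mul_pow {ι κ : Type*} [Fintype ι] [Fintype κ] (x : ι → ℝ≥0∞)
    {M : ℝ≥0∞} (hM : ∀ i, x i ≤ M) {g : κ → ι} (hg : Function.Injective g) :
    ∏ i, x i ≤ (∏ k, x (g k)) * M ^ (Fintype.card ι - Fintype.card κ) := by
  classical
  rw [← Finset.prod_mul_prod_compl (Finset.univ.image g), Finset.prod_image fun a _ b _ h => hg h]
  gcongr
  refine (Finset.prod_le_pow_card _ _ M fun i _ => hM i).trans_eq ?_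
  rw [Finset.card_compl, Finset.card_image_of_injective _ hg, Finset.card_univ]

theorem injective_vec_five {X : Type*} {a b c d e : X} (hab : a ≠ b) (hac : a ≠ c) (had : a ≠ d)
    (hae : a ≠ e) (hbc : b ≠ c) (hbd : b ≠ d) (hbe : b ≠ e) (hcd : c ≠ d) (hce : c ≠ e)
    (hde : d ≠ e) : Function.Injective ![a, b, c, d, e] := by
  intro x y h
  fin_cases x <;> fin_cases y <;> simp_all

/-- The product of the regularized resolvents of two lines, with energies `α` up to `n` and `β`
afterwards. -/
noncomputable def lineProd {N : ℕ} (ε : ℝ) (n : ℕ) (α β : Fin 2 → ℝ)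
    (k : Fin 2 → Fin (N + 1) → T3) : ℝ≥0∞ :=
  ∏ x : Fin 2 × Fin (N + 1), res ε (if (x.2 : ℕ) ≤ n then α x.1 else β x.1) (k x.1 x.2)

theorem measurable_lineProd {X : Type*} [MeasurableSpace X] {N : ℕ} {ε : ℝ} {n : ℕ}
    {α β : X → Fin 2 → ℝ} {k : X → Fin 2 → Fin (N + 1) → T3} (hα : Measurable α)
    (hβ : Measurable β) (hk : Measurable k) :
    Measurable fun x => lineProd ε n (α x) (β x) (k x) := by
  unfold lineProd
  refine Finset.measurable_prod _ fun x _ => measurable_res ?_ (by fun_prop)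
  split_ifs <;> fun_prop

namespace PairedLines

variable {N n : ℕ} {P : Type*} [Fintype P] (G : PairedLines N n P)

theorem measurable_mom : Measurable fun x : (Fin 2 → T3) × (Fin 2 → T3) × (P → T3) =>
    G.mom x.1 x.2.1 x.2.2 := by
  have h1 : BorelSpace (P → T3) := Pi.borelSpace
  have h2 : BorelSpace (Fin 2 → T3) := Pi.borelSpace
  refine measurable_pi_lambda _ fun j => measurable_pi_lambda _ fun l => ?_
  exact ((continuous_apply l).comp ((continuous_apply j).comp G.continuous_mom)).measurable

set_option maxHeartbeats 1000000 in
/-- The basic estimate for two lines with a crossing. -/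
theorem lintegral_lineProd_le (hn : n < N) {j j' : Fin 2} (hj : j' ≠ j) (hG : G.HasCrossing j)
    {ε : ℝ} (hε : 0 < ε) (hε3 : ε ≤ 1 / 3) {μ : Measure ℝ} [SFinite μ] {E : ℝ≥0∞}
    (hE : ∀ k : T3, ∫⁻ β, res ε β k ∂μ ≤ E) (p ζ : Fin 2 → T3) (α : Fin 2 → ℝ) :
    ∫⁻ β, ∫⁻ β', (∫⁻ q : P → T3,
        lineProd ε n α (fun i => if i = j then β else β') (G.mom p ζ q)) ∂μ ∂μ
      ≤ ENNReal.ofReal ε⁻¹ ^ (N - 2) * (res ε (α j) (p j) * res ε (α j') (p j')) *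
        (E * E * (loopCost ε ^ (N - 1) * crossCost ε)) := by
  classical
  have hcard : Fintype.card P = N - 1 := by have := G.card_pairs hn; omega
  obtain ⟨b, s, hbs, h1, h2, hcl⟩ := G.exists_minimal_crossing hG
  obtain ⟨κ, hκ⟩ := G.mom_castSucc_eq_of_closed p ζ hbs hcl
  have hbs' : (b.1 : ℕ) < s.1 := hbs
  have hrbs := rank_lt_of_lt (N := N) (n := n) (j := j) j hbs
  -- The pair closed at `s` was opened at `f`, possibly on the other line but before `b` in the
  -- order of integration.
  set f := G.partner (j, s) with hf
  set o := G.opening j with ho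
  set Ψ := G.ofLoop p ζ j with hΨ
  have hob : o (G.pair (j, b)) = (j, b) := G.opening_pair hn (hrbs.trans h2)
  have hof : o (G.pair (j, s)) = f := by
    rw [← G.pair_partner, ho, G.opening_pair hn]
    rw [partner_partner]
    exact h1.trans hrbs
  set mb := G.pair (j, b)
  set mf := G.pair (j, s)
  have hbf : mb ≠ mf := by
    intro h
    rw [h, hof] at hob
    rw [hob] at h1
    exact lt_irrefl _ h1
  -- These are the loop momenta with index at most `n`, whose energies `α` are fixed at this stage.
  set S : Finset P := Finset.univ.filter fun m => rank N n j (o m) < N + n with hS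
  have hmemS : ∀ m, m ∈ S ↔ ((o m).2.1 : ℕ) < n := fun m => by
    rw [hS, Finset.mem_filter, rank_lt_iff]
    simp
  have hScoe : (S : Set P) = {m | rank N n j (o m) < N + n} := by ext; simp [hS]
  have hdep : ∀ i : Fin 2, DependsOn (fun w => G.mom p ζ (Ψ w) i ⟨n + 1, by omega⟩) (S : Set P) := by
    intro i
    rw [hScoe]
    refine G.dependsOn_mom_ofLoop p ζ hn i _ fun x hx => ?_
    rw [rank_lt_iff]
    have hx1 : (x.1 : ℕ) < n + 1 := hx
    have := x.2
    simp only
    omega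
  have hwb : ∀ w, G.mom p ζ (Ψ w) j b.1.succ = w mb := by
    intro w
    have := G.mom_ofLoop_opening p ζ (j := j) hn w mb
    rwa [← ho, hob] at this
  -- The propagator on the line `j` that carries the energy integral.
  obtain ⟨r, hrn, hr0, hro, hrs, hrS, hrb⟩ : ∃ r : Fin (N + 1), n < (r : ℕ) ∧ (r ≠ 0) ∧
      (∀ m, ((o m).1, (o m).2.1.succ) ≠ (j, r)) ∧ r ≠ s.1.succ ∧
      DependsOn (fun w => G.mom p ζ (Ψ w) j r) (S : Set P) ∧
      ((b.1 : ℕ) < n → n < (s.1 : ℕ) → ∀ w, G.mom p ζ (Ψ w) j r = w mb + κ) := by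
    by_cases hc : (b.1 : ℕ) < n ∧ n < (s.1 : ℕ)
    -- If the crossing encloses the test function, the extra resolvent has energy `β` too. The
    -- momentum before `s` is then chosen for the energy integral, because it contains `w mb` but
    -- not `w mf`.
    · have hw : ∀ w, G.mom p ζ (Ψ w) j s.1.castSucc = w mb + κ := fun w => by rw [hκ, hwb]
      refine ⟨s.1.castSucc, hc.2, ?_, ?_, ?_, ?_, fun _ _ => hw⟩
      · intro h
        have := congrArg Fin.val h
        simp at this
        omega
      -- An interaction just before `s` is enclosed, so its partner lies to its left and it opens no
      -- pair. Hence the chosen momentum is not a loop momentum.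
      · intro m h
        have h3 : (o m).1 = j := congrArg Prod.fst h
        have h4 : ((o m).2.1 : ℕ) + 1 = s.1 := congrArg (fun x : Fin 2 × Fin (N + 1) => (x.2 : ℕ)) h
        have h5 := (o m).2.2
        obtain ⟨y, hy1, hy2, hy3⟩ := hcl (o m).2 (Fin.lt_def.2 (by omega))
          (Fin.lt_def.2 (by omega))
        have h6 := G.rank_opening_lt hn (j := j) m
        rw [← ho, show o m = (j, (o m).2) from Prod.ext h3 rfl, hy3, rank_self, rank_self] at h6
        have h7 : (y.1 : ℕ) < s.1 := hy2
        omega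
      · intro h
        have := congrArg Fin.val h
        simp at this
      · intro w w' h
        simp only
        rw [hw, hw, h mb]
        rw [Finset.mem_coe, hmemS, hob]
        exact hc.1
    · refine ⟨⟨n + 1, by omega⟩, Nat.lt_succ_self n, ?_, ?_, ?_, hdep j, fun h3 h4 => absurd ⟨h3, h4⟩ hc⟩
      · intro h
        have := congrArg Fin.val h
        simp at this
      · intro m h
        have h4 : ((o m).2.1 : ℕ) + 1 = n + 1 := congrArg (fun x : Fin 2 × Fin (N + 1) => (x.2 : ℕ)) h
        exact (o m).2.2 (by omega)
      · intro h
        have h4 : n + 1 = (s.1 : ℕ) + 1 := congrArg Fin.val h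
        exact s.2 (by omega)
  set τ : ℤ := G.sign (j, s) * G.sign f with hτdef
  have hτ : τ = 1 ∨ τ = -1 := by
    rcases G.sign_eq (j, s) with h | h <;> rcases G.sign_eq f with h' | h' <;> simp [hτdef, h, h']
  set c : (P → T3) → T3 := fun w => κ - τ • G.mom p ζ (Ψ w) f.1 f.2.1.castSucc with hcdef
  have hcdep : DependsOn c {m | rank N n j (o m) < rank N n j f} := by
    intro w w' h
    have h3 := G.dependsOn_mom_ofLoop p ζ hn f.1 f.2.1.castSucc (R := rank N n j f) (fun x hx =>
      rank_lt_of_lt _ (Fin.castSucc_lt_castSucc_iff.1 hx)) h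
    exact congrArg (κ - τ • ·) h3
  have hcm : Measurable c :=
    measurable_const.sub ((G.measurable_mom_ofLoop p ζ _ _).const_smul τ)
  -- The step at `s` is, up to sign, the difference between the loop momentum `w mf` and the
  -- momentum before `f`, added to `w mb + κ`.
  have hEq : ∀ w, G.mom p ζ (Ψ w) j s.1.succ = (1 : ℤ) • w mb + (τ • w mf + c w) := by
    intro w
    have h3 : w mf = G.sign f • (Ψ w) mf + G.mom p ζ (Ψ w) f.1 f.2.1.castSucc := by
      have := G.mom_ofLoop_opening p ζ (j := j) hn w mf
      rw [← ho, hof, mom_succ_pos, show G.pair f = mf from G.pair_partner _] at this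
      exact this.symm
    have h4 : G.mom p ζ (Ψ w) j s.1.succ
        = G.sign (j, s) • (Ψ w) mf + G.mom p ζ (Ψ w) j s.1.castSucc := G.mom_succ_pos p ζ (Ψ w) (j, s)
    rw [h4, hκ, hwb, hcdef]
    simp only
    rw [h3]
    rw [smul_add, hτdef, mul_smul, sign_smul_sign_smul (G.sign_eq f)]
    simp only [one_smul]
    abel
  set a : ℝ → ℝ → P → ℝ := fun β β' m =>
    if ((o m).2.1.succ : ℕ) ≤ n then α (o m).1 else if (o m).1 = j then β else β' with ha
  set aE : ℝ → ℝ → ℝ := fun β _ => if (s.1.succ : ℕ) ≤ n then α j else β with haE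
  have hsub : ∀ {R : ℕ}, rank N n j f ≤ R → {m | rank N n j (o m) < rank N n j f}
      ⊆ {m | rank N n j (o m) < R} := fun hR m hm => lt_of_lt_of_le hm hR
  have hb : mb ∈ S ↔ (b.1 : ℕ) < n := by rw [hmemS, hob]
  have hfS : mf ∈ S ↔ rank N n j f < N + n := by rw [hS, Finset.mem_filter, hof]; simp
  have hcS : mf ∈ S → DependsOn c (S : Set P) := fun h => by
    rw [hScoe]
    exact hcdep.mono (hsub (hfS.1 h).le)
  -- As `f` comes before `b`, the combination `mb ∈ S`, `mf ∉ S` does not occur.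
  have hfb : mb ∈ S → mf ∈ S := fun h => by
    rw [hS, Finset.mem_filter, hob] at h
    exact hfS.2 (h1.trans h.2)
  have hcases : (mb ∈ S ∧ mf ∈ S ∧ DependsOn c (S : Set P) ∧ ∃ a₀, ∀ β β', aE β β' = a₀) ∨
      (mb ∈ S ∧ mf ∈ S ∧ DependsOn c (S : Set P) ∧ (∀ β β', aE β β' = β) ∧
        ∃ k₀, ∀ w, G.mom p ζ (Ψ w) j r = w mb + k₀) ∨
      (mb ∉ S ∧ mf ∈ S ∧ DependsOn c (S : Set P)) ∨ (mb ∉ S ∧ mf ∉ S) := by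
    by_cases hbn : (b.1 : ℕ) < n
    · have hbS := hb.2 hbn
      rcases lt_or_gt_of_ne s.2 with hs | hs
      · refine Or.inl ⟨hbS, hfb hbS, hcS (hfb hbS), α j, fun β β' => ?_⟩
        simp only [haE, Fin.val_succ]
        rw [if_pos (by omega)]
      · refine Or.inr (Or.inl ⟨hbS, hfb hbS, hcS (hfb hbS), fun β β' => ?_, κ, hrb hbn hs⟩)
        simp only [haE, Fin.val_succ]
        rw [if_neg (by omega)]
    · have hbS : mb ∉ S := fun h => hbn (hb.1 h)
      by_cases hfm : mf ∈ S
      · exact Or.inr (Or.inr (Or.inl ⟨hbS, hfm, hcS hfm⟩))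
      · exact Or.inr (Or.inr (Or.inr ⟨hbS, hfm⟩))
  have haS : ∀ β β', ∀ m ∈ S, a β β' m = α (o m).1 := fun β β' m hm => by
    have h3 := (hmemS m).1 hm
    simp only [ha, Fin.val_succ]
    rw [if_pos (by omega)]
  have hc : DependsOn c ({mb, mf}ᶜ : Set P) := hcdep.mono fun m hm => by
    rintro (h | h)
    · rw [h, mem_ofPred_eq, hob] at hm
      omega
    · rw [mem_singleton_iff] at h
      rw [h, mem_ofPred_eq, hof] at hm
      omega
  have hρ1 : Measurable fun w => G.mom p ζ (Ψ w) j r := G.measurable_mom_ofLoop p ζ _ _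
  have hρ2 : Measurable fun w => G.mom p ζ (Ψ w) j' ⟨n + 1, by omega⟩ :=
    G.measurable_mom_ofLoop p ζ _ _
  have hkey := lintegral_crossing_le (σ := 1) hε hε3 hE S haS hρ1 hρ2 hcm hrS (hdep j') hbf hc
    (Or.inl rfl) hτ hcases
  set M := ENNReal.ofReal ε⁻¹
  -- The resolvents that are kept: one per loop momentum, the extra one after `s`, two for the
  -- energies after the test function and the two initial ones. The other `2(N + 1) - (N - 1) - 5 =
  -- N - 2` are bounded by `1/ε`.
  let g : P ⊕ Fin 5 → Fin 2 × Fin (N + 1) := Sum.elim (fun m => ((o m).1, (o m).2.1.succ))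
    ![(j, s.1.succ), (j, r), (j', ⟨n + 1, by omega⟩), (j, 0), (j', 0)]
  have hg : Function.Injective g := by
    refine Function.Injective.sumElim ?_ ?_ ?_
    · intro m m' h
      refine G.opening_injective (j := j) ?_
      have h3 : (o m).1 = (o m').1 := congrArg (fun x : Fin 2 × Fin (N + 1) => x.1) h
      have h4 : (o m).2.1.succ = (o m').2.1.succ := congrArg (fun x : Fin 2 × Fin (N + 1) => x.2) h
      exact Prod.ext h3 (Subtype.ext (Fin.succ_injective _ h4))
    · have e2 : (⟨n + 1, by omega⟩ : Fin (N + 1)) ≠ 0 := fun h => by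
        have := congrArg Fin.val h
        simp at this
      have hne : ∀ x y : Fin (N + 1), (j, x) ≠ (j', y) := fun x y h => hj (congrArg Prod.fst h).symm
      have hne' : ∀ (i : Fin 2) {x y : Fin (N + 1)}, x ≠ y → (i, x) ≠ (i, y) := fun i x y h h' =>
        h (congrArg Prod.snd h')
      exact injective_vec_five (hne' _ hrs.symm) (hne _ _) (hne' _ (Fin.succ_ne_zero _)) (hne _ _)
        (hne _ _) (hne' _ hr0) (hne _ _) (hne _ _).symm (hne' _ e2) (hne _ _)
    · intro m x
      fin_cases x
      · intro h
        have h3 : (o m).1 = j := congrArg Prod.fst h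
        have h4 : (o m).2.1.succ = s.1.succ := congrArg Prod.snd h
        exact G.opening_ne_of_lt hn (h1.trans hrbs) m
          (Prod.ext h3 (Subtype.ext (Fin.succ_injective _ h4)))
      · exact hro m
      · intro h
        have h4 : ((o m).2.1 : ℕ) + 1 = n + 1 := congrArg (fun x : Fin 2 × Fin (N + 1) => (x.2 : ℕ)) h
        exact (o m).2.2 (by omega)
      · intro h
        exact Fin.succ_ne_zero _ (congrArg Prod.snd h)
      · intro h
        exact Fin.succ_ne_zero _ (congrArg Prod.snd h)
  have hpt : ∀ β β' w, lineProd ε n α (fun i => if i = j then β else β') (G.mom p ζ (Ψ w))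
      ≤ M ^ (N - 2) * (res ε (α j) (p j) * res ε (α j') (p j')) *
        (resProd ε Finset.univ (a β β') w * res ε (aE β β') ((1 : ℤ) • w mb + (τ • w mf + c w)) *
          (res ε β (G.mom p ζ (Ψ w) j r) * res ε β' (G.mom p ζ (Ψ w) j' ⟨n + 1, by omega⟩))) := by
    intro β β' w
    refine (prod_le_prod_comp_mul_pow _ (fun _ => res_le hε _ _) hg).trans (le_of_eq ?_)
    have hexp : Fintype.card (Fin 2 × Fin (N + 1)) - Fintype.card (P ⊕ Fin 5) = N - 2 := by
      simp only [Fintype.card_prod, Fintype.card_sum, Fintype.card_fin, hcard]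
      omega
    rw [hexp, Fintype.prod_sum_type, Fin.prod_univ_five]
    have h3 : ∏ m : P, res ε (if ((g (Sum.inl m)).2 : ℕ) ≤ n then α (g (Sum.inl m)).1 else
        if (g (Sum.inl m)).1 = j then β else β')
          (G.mom p ζ (Ψ w) (g (Sum.inl m)).1 (g (Sum.inl m)).2)
        = resProd ε Finset.univ (a β β') w := by
      refine Finset.prod_congr rfl fun m _ => ?_
      simp only [g, Sum.elim_inl, ha]
      rw [G.mom_ofLoop_opening p ζ hn]
      rfl
    have hnn : ¬ n + 1 ≤ n := by omega
    rw [h3, ← hEq]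
    simp only [g, Sum.elim_inr, Matrix.cons_val, hj, if_true, if_neg (not_le.2 hrn), haE,
      hnn, if_false, Fin.val_zero, Nat.zero_le, mom_zero]
    ring
  have hMtop : M ^ (N - 2) * (res ε (α j) (p j) * res ε (α j') (p j')) ≠ ⊤ :=
    ENNReal.mul_ne_top (ENNReal.pow_ne_top ENNReal.ofReal_ne_top)
      (ENNReal.mul_ne_top (ne_top_of_le_ne_top ENNReal.ofReal_ne_top (res_le hε _ _))
        (ne_top_of_le_ne_top ENNReal.ofReal_ne_top (res_le hε _ _)))
  rw [← hcard]
  refine le_trans ?_ (mul_le_mul_right hkey _)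
  have hpull : ∀ {ν : Measure ℝ} (h : ℝ → ℝ≥0∞) (C : ℝ≥0∞), C ≠ ⊤ → 
      ∫⁻ β, C * h β ∂ν = C * ∫⁻ β, h β ∂ν := fun h C hC => lintegral_const_mul' C h hC
  rw [← hpull _ _ hMtop]
  refine lintegral_mono fun β => ?_
  simp only
  rw [← hpull _ _ hMtop]
  refine lintegral_mono fun β' => ?_
  simp only
  rw [← lintegral_const_mul' _ _ hMtop, G.lintegral_eq_lintegral_ofLoop p ζ (j := j) hn]
  · exact lintegral_mono fun w => hpt β β' w
  · exact measurable_lineProd measurable_const measurable_const (G.measurable_mom.comp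
      (measurable_const.prodMk (measurable_const.prodMk measurable_id)))

end PairedLines

/-! ### Reversal of both lines -/

namespace PairedLines

variable {N n n' : ℕ} {P : Type*}

/-- An interaction seen from the other end of its line. -/
def revPos (h : n + n' + 1 = N) (b : Fin 2 × LinePos N n) : Fin 2 × LinePos N n' :=
  (b.1, ⟨b.2.1.rev, by have := b.2.2; have := b.2.1.2; rw [Fin.val_rev]; omega⟩)

theorem revPos_revPos (h : n + n' + 1 = N) (h' : n' + n + 1 = N) (b : Fin 2 × LinePos N n) :
    revPos h' (revPos h b) = b := by
  simp [revPos]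

theorem revPos_lt_revPos (h : n + n' + 1 = N) {i : Fin 2} {x y : LinePos N n} (hxy : x < y) :
    (revPos h (i, y)).2 < (revPos h (i, x)).2 :=
  Fin.rev_lt_rev.2 (show x.1 < y.1 from hxy)

variable (G : PairedLines N n P)

/-- The same pairing, with both lines traversed backwards. -/
def reverse (h : n + n' + 1 = N) (h' : n' + n + 1 = N) : PairedLines N n' P where
  partner b := revPos h (G.partner (revPos h' b))
  partner_partner b := by rw [revPos_revPos, G.partner_partner, revPos_revPos]
  partner_ne b hb := G.partner_ne (revPos h' b) (by
    rw [← revPos_revPos h h' (G.partner (revPos h' b)), hb])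
  pair b := G.pair (revPos h' b)
  pair_surjective m := by
    obtain ⟨b, rfl⟩ := G.pair_surjective m
    exact ⟨revPos h b, by simp only [revPos_revPos]⟩
  pair_eq {b b'} hb := by
    rcases G.pair_eq hb with h1 | h1
    · exact Or.inl (by rw [← revPos_revPos h' h b', h1, revPos_revPos])
    · exact Or.inr (by rw [← revPos_revPos h' h b', h1])
  pair_partner b := by rw [revPos_revPos, G.pair_partner]
  sign b := G.sign (revPos h' b)
  sign_eq b := G.sign_eq _
  sign_partner b hb := by
    rw [revPos_revPos]
    exact G.sign_partner _ hb

variable (h : n + n' + 1 = N) (h' : n' + n + 1 = N)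

theorem reverse_step (ζ : Fin 2 → T3) (q : P → T3) (j : Fin 2) (l : Fin N) :
    (G.reverse h h').step ζ q j l = G.step ζ q j l.rev := by
  unfold step
  have hl : (l : ℕ) = n' ↔ (l.rev : ℕ) = n := by
    have := l.2
    rw [Fin.val_rev]
    omega
  by_cases h1 : (l : ℕ) = n'
  · rw [dif_pos h1, dif_pos (hl.1 h1)]
  · rw [dif_neg h1, dif_neg (fun h2 => h1 (hl.2 h2))]
    rfl

/-- With the steps kept and only their order reversed, starting at minus the final momentum gives
minus the original momenta. The sign is invisible to the even dispersion relation. -/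
theorem reverse_mom {p p' ζ : Fin 2 → T3} {q : P → T3} {j : Fin 2}
    (hp : p' j = -G.mom p ζ q j (Fin.last N)) (l : Fin (N + 1)) :
    (G.reverse h h').mom p' ζ q j l = -G.mom p ζ q j l.rev := by
  induction l using Fin.induction with
  | zero => rw [mom_zero, hp, Fin.rev_zero]
  | succ l ih =>
    rw [mom_succ, ih, reverse_step, Fin.rev_succ, Fin.rev_castSucc, mom_succ]
    abel

theorem HasCrossing.reverse {G : PairedLines N n P} {j : Fin 2} (hG : G.HasCrossing j) :
    (G.reverse h h').HasCrossing j := by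
  obtain ⟨l₁, i, l₂, h1, h2, h3, h4⟩ := hG
  have h1' : G.partner (j, l₂) = (j, l₁) := by rw [← h1, partner_partner]
  refine ⟨(revPos h (j, l₂)).2, (revPos h (j, i)).2, (revPos h (j, l₁)).2, ?_,
    revPos_lt_revPos h h3, revPos_lt_revPos h h2, fun x hx => ?_⟩
  · change revPos h (G.partner (revPos h' (revPos h (j, l₂)))) = revPos h (j, l₁)
    rw [revPos_revPos, h1']
  · change revPos h (G.partner (revPos h' (revPos h (j, i)))) = (j, x) at hx
    rw [revPos_revPos] at hx
    have h5 : G.partner (j, i) = (j, (revPos h' (j, x)).2) := by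
      rw [← revPos_revPos h h' (G.partner (j, i)), hx]
      rfl
    have hx2 : x = (revPos h (j, (revPos h' (j, x)).2)).2 :=
      congrArg Prod.snd (revPos_revPos h' h (j, x)).symm
    rw [hx2]
    rcases h4 _ h5 with h6 | h6
    · exact Or.inr (revPos_lt_revPos h h6)
    · exact Or.inl (revPos_lt_revPos h h6)

end PairedLines

/-- Reversal carries the indices up to `n'` to those beyond `n`, so the two families of energies
change places. -/
theorem lineProd_reverse {N n n' : ℕ} (h : n + n' + 1 = N) (ε : ℝ) (α β : Fin 2 → ℝ)
    (k : Fin 2 → Fin (N + 1) → T3) :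
    lineProd ε n' β α (fun j l => -k j l.rev) = lineProd ε n α β k := by
  unfold lineProd
  refine Fintype.prod_equiv ((Equiv.refl _).prodCongr Fin.revPerm) _ _ fun x => ?_
  have h1 : (x.2 : ℕ) ≤ n' ↔ ¬ (x.2.rev : ℕ) ≤ n := by
    have := x.2.2
    rw [Fin.val_rev]
    omega
  rw [res_neg]
  simp only [Equiv.prodCongr_apply, Prod.map, Equiv.refl_apply, Fin.revPerm_apply]
  by_cases h2 : (x.2.rev : ℕ) ≤ n
  · rw [if_neg (fun h3 => h1.1 h3 h2), if_pos h2]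
  · rw [if_pos (h1.2 h2), if_neg h2]

/-! ### From pairings to paired lines -/

namespace Pairing

variable {n₁ n₂ : ℕ} (π : Pairing n₁ n₂)

open Classical in
/-- The abstract pair of lines of a pairing. -/
noncomputable def lines : PairedLines (n₁ + n₂ + 1) n₁ π.Pair where
  partner := π.partner
  partner_partner := π.partner_partner
  partner_ne := π.partner_ne
  pair b := if h : π.IsFirst b then ⟨b, h⟩ else ⟨π.partner b, (π.isFirst_partner_iff b).2 h⟩
  pair_surjective m := ⟨m.1, dif_pos m.2⟩
  pair_eq {b b'} hb := by
    have hpp := π.partner_partner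
    split_ifs at hb with h1 h2 h2 <;> have h3 := congrArg Subtype.val hb <;> simp only at h3
    · exact Or.inl h3.symm
    · exact Or.inr (by rw [h3, hpp])
    · exact Or.inr h3.symm
    · exact Or.inl (by rw [← hpp b', ← h3, hpp])
  pair_partner b := by
    have h1 := π.isFirst_partner_iff b
    by_cases h : π.IsFirst b
    · rw [dif_neg (fun h2 => h1.1 h2 h), dif_pos h]
      exact Subtype.ext (π.partner_partner b)
    · rw [dif_pos (h1.2 h), dif_neg h]
  sign b := if π.IsFirst b then 1 else if (π.partner b).1 = b.1 then -1 else 1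
  sign_eq b := by split_ifs <;> simp
  sign_partner b hb := by
    have h1 := π.isFirst_partner_iff b
    rw [π.partner_partner]
    by_cases h : π.IsFirst b
    · rw [if_neg (fun h2 => h1.1 h2 h), if_pos h, if_pos hb.symm]
    · rw [if_pos (h1.2 h), if_neg h, if_pos hb]
      rfl

theorem momentumStep_eq (x : π.Config) (j : Fin 2) (l : Fin (n₁ + n₂ + 1)) :
    π.momentumStep x j l = π.lines.step (fun i => toTorus (x.2.2 i)) x.2.1 j l := by
  unfold momentumStep PairedLines.step
  split_ifs with h
  · rfl
  · unfold bulletMomentum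
    simp only [lines]
    split_ifs <;> simp

theorem momentum_eq (x : π.Config) :
    π.momentum x = π.lines.mom x.1 (fun i => toTorus (x.2.2 i)) x.2.1 := by
  funext j l
  simp only [momentum, PairedLines.mom, momentumStep_eq]

theorem HasGeneralizedCrossing.lines {π : Pairing n₁ n₂} {j : Fin 2}
    (h : π.HasGeneralizedCrossing j) : π.lines.HasCrossing j := by
  rcases h with ⟨l₁, i₁, l₂, i₂, h1, h2, h3, h4, h5⟩ | ⟨l₁, i₁, l₂, h1, h2, h3, h4⟩
  · refine ⟨l₁, i₁, l₂, h1, h3, h4, fun x hx => Or.inr ?_⟩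
    have : (j, i₂) = (j, x) := h2.symm.trans hx
    exact lt_of_lt_of_eq h5 (congrArg Prod.snd this)
  · exact ⟨l₁, i₁, l₂, h1, h3, h4, fun x hx => absurd (congrArg Prod.fst hx) h2⟩

end Pairing

/-! ### Integration over all energies and over weights in the remaining variables -/

theorem lintegral_pi_two {X : Type*} [MeasurableSpace X] (μ : Measure X) [SigmaFinite μ]
    {F : (Fin 2 → X) → ℝ≥0∞} (hF : Measurable F) :
    ∫⁻ x, F x ∂(Measure.pi fun _ => μ) = ∫⁻ a, ∫⁻ b, F ![a, b] ∂μ ∂μ := by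
  have h := (measurePreserving_finTwoArrow μ).symm
  exact (h.lintegral_comp hF).symm.trans (lintegral_prod _ (hF.comp h.measurable).aemeasurable)

theorem measurable_vec_two {X Y : Type*} [MeasurableSpace X] [MeasurableSpace Y] {a b : Y → X}
    (ha : Measurable a) (hb : Measurable b) : Measurable fun y => ![a y, b y] := by
  refine measurable_pi_lambda _ fun i => ?_
  fin_cases i
  · exact ha
  · exact hb

theorem lintegral_pi_two_of_ne {X : Type*} [MeasurableSpace X] (μ : Measure X) [SigmaFinite μ]
    {F : (Fin 2 → X) → ℝ≥0∞} (hF : Measurable F) (j : Fin 2) :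
    ∫⁻ x, F x ∂(Measure.pi fun _ => μ)
      = ∫⁻ a, ∫⁻ b, F (fun i => if i = j then a else b) ∂μ ∂μ := by
  rw [lintegral_pi_two μ hF]
  fin_cases j
  · refine lintegral_congr fun a => lintegral_congr fun b => congrArg F ?_
    funext i
    fin_cases i <;> rfl
  · rw [lintegral_lintegral_swap (f := fun a b => F ![a, b]) (hF.comp
      (measurable_vec_two measurable_fst measurable_snd)).aemeasurable]
    refine lintegral_congr fun a => lintegral_congr fun b => congrArg F ?_
    funext i
    fin_cases i <;> rfl

/-- Integration of an estimate that is uniform in `y` against a weight. -/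
theorem lintegral_weight_le {A B Y Q : Type*} [MeasurableSpace A] [MeasurableSpace B]
    [MeasurableSpace Y] [MeasurableSpace Q] {μ : Measure A} {ν : Measure B} {m : Measure Y}
    {ρ : Measure Q} [SFinite μ] [SFinite ν] [SFinite m] [SFinite ρ] {L : A → B → Y → Q → ℝ≥0∞}
    (hL : Measurable fun x : ((A × B) × Y) × Q => L x.1.1.1 x.1.1.2 x.1.2 x.2) {W : Y → ℝ≥0∞}
    (hW : Measurable W) {C : ℝ≥0∞} (hC : ∀ y, ∫⁻ a, ∫⁻ b, (∫⁻ q, L a b y q ∂ρ) ∂ν ∂μ ≤ C) :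
    ∫⁻ a, ∫⁻ b, (∫⁻ y, (∫⁻ q, W y * L a b y q ∂ρ) ∂m) ∂ν ∂μ ≤ C * ∫⁻ y, W y ∂m := by
  have hI : Measurable fun x : (A × B) × Y => ∫⁻ q, L x.1.1 x.1.2 x.2 q ∂ρ :=
    hL.lintegral_prod_right'
  have hI1 : Measurable fun x : (A × B) × Y => W x.2 * ∫⁻ q, L x.1.1 x.1.2 x.2 q ∂ρ :=
    (hW.comp measurable_snd).mul hI
  have hI2 : Measurable fun x : A × Y => ∫⁻ b, W x.2 * (∫⁻ q, L x.1 b x.2 q ∂ρ) ∂ν := by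
    refine Measurable.lintegral_prod_right' (f := fun z : (A × Y) × B =>
      W z.1.2 * (∫⁻ q, L z.1.1 z.2 z.1.2 q ∂ρ)) ?_
    exact hI1.comp ((measurable_fst.fst.prodMk measurable_snd).prodMk measurable_fst.snd)
  calc _ = ∫⁻ a, ∫⁻ b, (∫⁻ y, W y * (∫⁻ q, L a b y q ∂ρ) ∂m) ∂ν ∂μ := by
        refine lintegral_congr fun a => lintegral_congr fun b => lintegral_congr fun y => ?_
        have h0 : Measurable (L a b y) := hL.comp (measurable_prodMk_left (x := ((a, b), y)))
        exact lintegral_const_mul _ h0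
    _ = ∫⁻ a, ∫⁻ y, (∫⁻ b, W y * (∫⁻ q, L a b y q ∂ρ) ∂ν) ∂m ∂μ := by
        refine lintegral_congr fun a => ?_
        refine lintegral_lintegral_swap (f := fun b y => W y * (∫⁻ q, L a b y q ∂ρ))
          (Measurable.aemeasurable ?_)
        exact hI1.comp ((measurable_const.prodMk measurable_fst).prodMk measurable_snd)
    _ = ∫⁻ y, ∫⁻ a, (∫⁻ b, W y * (∫⁻ q, L a b y q ∂ρ) ∂ν) ∂μ ∂m :=
        lintegral_lintegral_swap hI2.aemeasurable
    _ = ∫⁻ y, W y * (∫⁻ a, (∫⁻ b, (∫⁻ q, L a b y q ∂ρ) ∂ν) ∂μ) ∂m := by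
        refine lintegral_congr fun y => ?_
        have h1 : ∀ a, Measurable fun b => ∫⁻ q, L a b y q ∂ρ := fun a =>
          hI.comp ((measurable_const.prodMk measurable_id).prodMk measurable_const)
        simp_rw [lintegral_const_mul _ (h1 _)]
        refine lintegral_const_mul _ ?_
        refine Measurable.lintegral_prod_right' (f := fun z : A × B => ∫⁻ q, L z.1 z.2 y q ∂ρ) ?_
        exact hI.comp (measurable_id.prodMk measurable_const)
    _ ≤ ∫⁻ y, W y * C ∂m := by
        gcongr with y
        exact hC y
    _ = _ := by rw [lintegral_mul_const _ hW, mul_comm]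

/-- The bound for the energy and loop integrals of two lines with `N` steps and a crossing. -/
noncomputable def gainBound (ε : ℝ) (E : ℝ≥0∞) (N : ℕ) : ℝ≥0∞ :=
  ENNReal.ofReal ε⁻¹ ^ (N - 2) * (E ^ 4 * (loopCost ε ^ (N - 1) * crossCost ε))

namespace PairedLines

variable {N n : ℕ} {P : Type*} [Fintype P] (G : PairedLines N n P)

/-- In the basic estimate `α` survives only in the two resolvents at the initial momenta, which
integrate the two remaining energies. -/
theorem lintegral_energies_le (hn : n < N) {j : Fin 2} (hG : G.HasCrossing j)
    {ε : ℝ} (hε : 0 < ε) (hε3 : ε ≤ 1 / 3) {μ : Measure ℝ} [IsFiniteMeasure μ] {E : ℝ≥0∞}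
    (hE : ∀ k : T3, ∫⁻ β, res ε β k ∂μ ≤ E) (p ζ : Fin 2 → T3) :
    ∫⁻ α, ∫⁻ β, (∫⁻ q, lineProd ε n α β (G.mom p ζ q)) ∂(Measure.pi fun _ => μ)
      ∂(Measure.pi fun _ => μ) ≤ gainBound ε E N := by
  obtain ⟨j', hj'⟩ := exists_ne j
  have hm : ∀ α, Measurable fun β : Fin 2 → ℝ => ∫⁻ q, lineProd ε n α β (G.mom p ζ q) := by
    intro α
    refine Measurable.lintegral_prod_right' (f := fun x : (Fin 2 → ℝ) × (P → T3) =>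
      lineProd ε n α x.1 (G.mom p ζ x.2)) ?_
    exact measurable_lineProd measurable_const measurable_fst (G.measurable_mom.comp
      (measurable_const.prodMk (measurable_const.prodMk measurable_snd)))
  have hr : Measurable fun α : Fin 2 → ℝ => res ε (α j) (p j) * res ε (α j') (p j') := by fun_prop
  have hres : ∫⁻ α, res ε (α j) (p j) * res ε (α j') (p j') ∂(Measure.pi fun _ => μ) ≤ E * E := by
    rw [lintegral_pi_two_of_ne μ hr j]
    simp only [if_true, if_neg hj']
    calc _ = ∫⁻ a, res ε a (p j) * ∫⁻ b, res ε b (p j') ∂μ ∂μ :=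
          lintegral_congr fun a => lintegral_const_mul _ (by fun_prop)
      _ ≤ ∫⁻ a, res ε a (p j) * E ∂μ := by gcongr; exact hE _
      _ = (∫⁻ a, res ε a (p j) ∂μ) * E := lintegral_mul_const _ (by fun_prop)
      _ ≤ E * E := by gcongr; exact hE _
  calc _ ≤ ∫⁻ α, ENNReal.ofReal ε⁻¹ ^ (N - 2) * (res ε (α j) (p j) * res ε (α j') (p j')) *
        (E * E * (loopCost ε ^ (N - 1) * crossCost ε)) ∂(Measure.pi fun _ => μ) := by
        refine lintegral_mono fun α => ?_
        simp only
        rw [lintegral_pi_two_of_ne μ (hm α) j]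
        exact G.lintegral_lineProd_le hn hj' hG hε hε3 hE p ζ α
    _ = ENNReal.ofReal ε⁻¹ ^ (N - 2) *
        (∫⁻ α, res ε (α j) (p j) * res ε (α j') (p j') ∂(Measure.pi fun _ => μ)) *
        (E * E * (loopCost ε ^ (N - 1) * crossCost ε)) := by
        rw [lintegral_mul_const _ (by fun_prop), lintegral_const_mul _ hr]
    _ ≤ ENNReal.ofReal ε⁻¹ ^ (N - 2) * (E * E) *
        (E * E * (loopCost ε ^ (N - 1) * crossCost ε)) := by gcongr
    _ = _ := by rw [gainBound]; ring

/-- Integration of the estimate against a weight in the remaining variables. -/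
theorem lintegral_weight_lineProd_le (hn : n < N) {j : Fin 2} (hG : G.HasCrossing j)
    {ε : ℝ} (hε : 0 < ε) (hε3 : ε ≤ 1 / 3) {μ : Measure ℝ} [IsFiniteMeasure μ] {E : ℝ≥0∞}
    (hE : ∀ k : T3, ∫⁻ β, res ε β k ∂μ ≤ E) {Y : Type*} [MeasurableSpace Y] {m : Measure Y}
    [SFinite m] {W : Y → ℝ≥0∞} (hW : Measurable W) {p ζ : Y → Fin 2 → T3} (hp : Measurable p)
    (hζ : Measurable ζ) :
    ∫⁻ α, ∫⁻ β, (∫⁻ y, (∫⁻ q, W y * lineProd ε n α β (G.mom (p y) (ζ y) q)) ∂m)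
      ∂(Measure.pi fun _ => μ) ∂(Measure.pi fun _ => μ) ≤ gainBound ε E N * ∫⁻ y, W y ∂m := by
  have h1 : Measurable fun x : (((Fin 2 → ℝ) × (Fin 2 → ℝ)) × Y) × (P → T3) =>
      G.mom (p x.1.2) (ζ x.1.2) x.2 :=
    G.measurable_mom.comp ((hp.comp measurable_fst.snd).prodMk
      ((hζ.comp measurable_fst.snd).prodMk measurable_snd))
  exact lintegral_weight_le (L := fun α β y q => lineProd ε n α β (G.mom (p y) (ζ y) q))
    (measurable_lineProd measurable_fst.fst.fst measurable_fst.fst.snd h1) hW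
    fun y => G.lintegral_energies_le hn hG hε hε3 hE (p y) (ζ y)

omit [Fintype P] in
theorem mom_eq_add_start (p ζ : Fin 2 → T3) (q : P → T3) (j : Fin 2) (l : Fin (N + 1)) :
    G.mom p ζ q j l = p j + G.mom 0 ζ q j l := by
  simp [mom]

end PairedLines

theorem continuous_toTorus : Continuous toTorus := by
  refine continuous_pi fun i => ?_
  exact (AddCircle.continuous_mk' 1).comp (EuclideanSpace.proj i).continuous

instance (ι : Type*) [Fintype ι] : SFinite (volume : Measure ((ι → T3) × (Fin 2 → E3))) :=
  @Measure.prod.instSFinite _ _ _ _ _ _ _ _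

instance : (volume : Measure T3).IsNegInvariant :=
  @Measure.pi.isNegInvariant (Fin 3) (fun _ => T1) _ _ _ _ _ _ _

instance (ι : Type*) [Fintype ι] : (volume : Measure (ι → T3)).IsNegInvariant :=
  @Measure.pi.isNegInvariant ι (fun _ => T3) _ _ _ _ _ _ _

namespace PairedLines

variable {N n : ℕ} {P : Type*} [Fintype P] (G : PairedLines N n P)

/-- This form is needed for the reversed lines, where `α` and `β` are exchanged. -/
theorem lintegral_energies_swap_le (hn : n < N) {j : Fin 2} (hG : G.HasCrossing j)
    {ε : ℝ} (hε : 0 < ε) (hε3 : ε ≤ 1 / 3) {μ : Measure ℝ} [IsFiniteMeasure μ] {E : ℝ≥0∞}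
    (hE : ∀ k : T3, ∫⁻ β, res ε β k ∂μ ≤ E) (p ζ : Fin 2 → T3) :
    ∫⁻ α, ∫⁻ β, (∫⁻ q, lineProd ε n β α (G.mom p ζ q)) ∂(Measure.pi fun _ => μ)
      ∂(Measure.pi fun _ => μ) ≤ gainBound ε E N := by
  refine le_trans (le_of_eq ?_) (G.lintegral_energies_le hn hG hε hε3 hE p ζ)
  refine lintegral_lintegral_swap (f := fun α β => ∫⁻ q, lineProd ε n β α (G.mom p ζ q))
    (Measurable.aemeasurable ?_)
  refine Measurable.lintegral_prod_right' (f := fun x : ((Fin 2 → ℝ) × (Fin 2 → ℝ)) × (P → T3) =>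
    lineProd ε n x.1.2 x.1.1 (G.mom p ζ x.2)) ?_
  exact measurable_lineProd measurable_fst.snd measurable_fst.fst (G.measurable_mom.comp
    (measurable_const.prodMk (measurable_const.prodMk measurable_snd)))

theorem lintegral_weight_lineProd_swap_le (hn : n < N) {j : Fin 2} (hG : G.HasCrossing j)
    {ε : ℝ} (hε : 0 < ε) (hε3 : ε ≤ 1 / 3) {μ : Measure ℝ} [IsFiniteMeasure μ] {E : ℝ≥0∞}
    (hE : ∀ k : T3, ∫⁻ β, res ε β k ∂μ ≤ E) {Y : Type*} [MeasurableSpace Y] {m : Measure Y}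
    [SFinite m] {W : Y → ℝ≥0∞} (hW : Measurable W) {p ζ : Y → Fin 2 → T3} (hp : Measurable p)
    (hζ : Measurable ζ) :
    ∫⁻ α, ∫⁻ β, (∫⁻ y, (∫⁻ q, W y * lineProd ε n β α (G.mom (p y) (ζ y) q)) ∂m)
      ∂(Measure.pi fun _ => μ) ∂(Measure.pi fun _ => μ) ≤ gainBound ε E N * ∫⁻ y, W y ∂m := by
  have h1 : Measurable fun x : (((Fin 2 → ℝ) × (Fin 2 → ℝ)) × Y) × (P → T3) =>
      G.mom (p x.1.2) (ζ x.1.2) x.2 :=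
    G.measurable_mom.comp ((hp.comp measurable_fst.snd).prodMk
      ((hζ.comp measurable_fst.snd).prodMk measurable_snd))
  exact lintegral_weight_le (L := fun α β y q => lineProd ε n β α (G.mom (p y) (ζ y) q))
    (measurable_lineProd measurable_fst.fst.snd measurable_fst.fst.fst h1) hW
    fun y => G.lintegral_energies_swap_le hn hG hε hε3 hE (p y) (ζ y)

end PairedLines

section Weights

variable {f : T3 → ℝ≥0∞} {H : E3 → ℝ≥0∞}

theorem lintegral_two_mul {X : Type*} [MeasureSpace X] [SigmaFinite (volume : Measure X)]
    {g : X → ℝ≥0∞} (hg : Measurable g) :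
    ∫⁻ p : Fin 2 → X, g (p 0) * g (p 1) = (∫⁻ x, g x) ^ 2 := by
  have hm : Measurable fun p : Fin 2 → X => g (p 0) * g (p 1) :=
    (hg.comp (measurable_pi_apply 0)).mul (hg.comp (measurable_pi_apply 1))
  refine (lintegral_pi_two volume hm).trans ?_
  have h1 : ∀ a : X, ∫⁻ b : X, g (![a, b] 0) * g (![a, b] 1) = g a * ∫⁻ b, g b := fun a =>
    lintegral_const_mul (g a) hg
  simp_rw [h1]
  rw [lintegral_mul_const _ hg, sq]

theorem lintegral_weight_eq (hf : Measurable f) (hH : Measurable H) :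
    ∫⁻ y : (Fin 2 → T3) × (Fin 2 → E3), f (y.1 0) * f (y.1 1) * (H (y.2 0) * H (y.2 1))
      = (∫⁻ k, f k) ^ 2 * (∫⁻ ξ, H ξ) ^ 2 := by
  have h1 : Measurable fun p : Fin 2 → T3 => f (p 0) * f (p 1) :=
    (hf.comp (measurable_pi_apply 0)).mul (hf.comp (measurable_pi_apply 1))
  have h2 : Measurable fun p : Fin 2 → E3 => H (p 0) * H (p 1) :=
    (hH.comp (measurable_pi_apply 0)).mul (hH.comp (measurable_pi_apply 1))
  rw [← lintegral_two_mul hf, ← lintegral_two_mul hH]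
  exact lintegral_prod_mul h1.aemeasurable h2.aemeasurable

end Weights

/-! ### Integration over configurations with weights at either end -/

namespace Pairing

variable {n₁ n₂ : ℕ} (π : Pairing n₁ n₂)

theorem measurable_momentum : Measurable π.momentum := by
  have h1 : Measurable fun x : π.Config => fun i => toTorus (x.2.2 i) :=
    measurable_pi_lambda _ fun i => continuous_toTorus.measurable.comp
      ((measurable_pi_apply i).comp measurable_snd.snd)
  have h2 : π.momentum = fun x => π.lines.mom x.1 (fun i => toTorus (x.2.2 i)) x.2.1 :=
    funext π.momentum_eq
  rw [h2]
  exact π.lines.measurable_mom.comp (measurable_fst.prodMk (h1.prodMk measurable_snd.fst))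

theorem measurable_momentum_apply (j : Fin 2) (l : Fin (n₁ + n₂ + 2)) :
    Measurable fun x => π.momentum x j l :=
  (measurable_pi_apply l).comp ((measurable_pi_apply j).comp π.measurable_momentum)

theorem lintegral_config {F : π.Config → ℝ≥0∞} (hF : Measurable F) :
    ∫⁻ x, F x = ∫⁻ y : (Fin 2 → T3) × (Fin 2 → E3), ∫⁻ q, F (y.1, q, y.2) := by
  have h1 : Measurable fun z : ((Fin 2 → T3) × (Fin 2 → E3)) × (π.Pair → T3) =>
      F (z.1.1, z.2, z.1.2) :=
    hF.comp (measurable_fst.fst.prodMk (measurable_snd.prodMk measurable_fst.snd))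
  refine (lintegral_prod _ hF.aemeasurable).trans ?_
  refine Eq.trans ?_ (lintegral_prod (fun y : (Fin 2 → T3) × (Fin 2 → E3) =>
    ∫⁻ q, F (y.1, q, y.2)) (Measurable.lintegral_prod_right' h1).aemeasurable).symm
  refine lintegral_congr fun p => ?_
  exact lintegral_prod_symm' _ (hF.comp measurable_prodMk_left)

/-- Replacing the initial momenta by the negatives of the final ones. -/
theorem lintegral_config_end {F : π.Config → ℝ≥0∞} (hF : Measurable F) :
    ∫⁻ x, F x = ∫⁻ x : π.Config, F (fun j => -x.1 j -
      π.lines.mom 0 (fun i => toTorus (x.2.2 i)) x.2.1 j (Fin.last _), x.2) := by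
  have h0 : Measurable fun z : (π.Pair → T3) × (Fin 2 → E3) => fun j =>
      π.lines.mom 0 (fun i => toTorus (z.2 i)) z.1 j (Fin.last _) := by
    have h1 : Measurable fun z : (π.Pair → T3) × (Fin 2 → E3) => fun i => toTorus (z.2 i) :=
      measurable_pi_lambda _ fun i => continuous_toTorus.measurable.comp
        ((measurable_pi_apply i).comp measurable_snd)
    have h2 := π.lines.measurable_mom.comp
      ((measurable_const (a := (0 : Fin 2 → T3))).prodMk (h1.prodMk measurable_fst))
    exact measurable_pi_lambda _ fun j => (measurable_pi_apply _).comp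
      ((measurable_pi_apply j).comp h2)
  have h3 : Measurable fun x : π.Config => F (fun j => -x.1 j -
      π.lines.mom 0 (fun i => toTorus (x.2.2 i)) x.2.1 j (Fin.last _), x.2) :=
    hF.comp ((measurable_fst.neg.sub (h0.comp measurable_snd)).prodMk measurable_snd)
  refine (lintegral_prod_symm' F hF).trans (Eq.trans ?_ (lintegral_prod_symm' _ h3).symm)
  refine lintegral_congr fun z => ?_
  have : (volume : Measure (Fin 2 → T3)).IsAddHaarMeasure :=
    @Measure.pi.isAddHaarMeasure (Fin 2) (fun _ => T3) _ _ _ _ _ _ _ _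
  have : BorelSpace (Fin 2 → T3) := Pi.borelSpace
  -- For fixed pair momenta and `ξ`, the final momenta are translates of the initial ones, and Haar
  -- measure is invariant under translation and reflection.
  have h4 := lintegral_sub_left_eq_self (μ := (volume : Measure (Fin 2 → T3)))
    (fun p => F (p, z)) (-fun j => π.lines.mom 0 (fun i => toTorus (z.2 i)) z.1 j (Fin.last _))
  rw [← h4]
  refine lintegral_congr fun p => ?_
  congr 2
  funext j
  simp only [Pi.sub_apply, Pi.neg_apply]
  abel

variable {π} {j : Fin 2} {ε : ℝ} {μ : Measure ℝ} [IsFiniteMeasure μ] {E : ℝ≥0∞}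
  {f : T3 → ℝ≥0∞} {H : E3 → ℝ≥0∞}

theorem lintegral_config_start_le (hπ : π.HasGeneralizedCrossing j) (hε : 0 < ε) (hε3 : ε ≤ 1 / 3)
    (hE : ∀ k : T3, ∫⁻ β, res ε β k ∂μ ≤ E) (hf : Measurable f) (hH : Measurable H) :
    ∫⁻ α, ∫⁻ β, (∫⁻ x : π.Config, f (π.momentum x 0 0) * f (π.momentum x 1 0) *
      (H (x.2.2 0) * H (x.2.2 1)) * lineProd ε n₁ α β (π.momentum x)) ∂(Measure.pi fun _ => μ)
      ∂(Measure.pi fun _ => μ)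
      ≤ gainBound ε E (n₁ + n₂ + 1) * ((∫⁻ k, f k) ^ 2 * (∫⁻ ξ, H ξ) ^ 2) := by
  have hW : Measurable fun y : (Fin 2 → T3) × (Fin 2 → E3) =>
      f (y.1 0) * f (y.1 1) * (H (y.2 0) * H (y.2 1)) := by fun_prop
  have hζ : Measurable fun y : (Fin 2 → T3) × (Fin 2 → E3) => fun i => toTorus (y.2 i) :=
    measurable_pi_lambda _ fun i => continuous_toTorus.measurable.comp
      ((measurable_pi_apply i).comp measurable_snd)
  rw [← lintegral_weight_eq hf hH]
  refine le_trans (le_of_eq ?_) (π.lines.lintegral_weight_lineProd_le (by omega) hπ.lines hε hε3 hE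
    hW measurable_fst hζ)
  refine lintegral_congr fun α => lintegral_congr fun β => ?_
  rw [lintegral_config]
  · refine lintegral_congr fun y => lintegral_congr fun q => ?_
    simp only [momentum_eq, PairedLines.mom_zero]
  · have h1 := π.measurable_momentum
    have h2 := measurable_lineProd (ε := ε) (n := n₁) (measurable_const (a := α))
      (measurable_const (a := β)) h1
    have h3 := fun j l => hf.comp (π.measurable_momentum_apply j l)
    have h4 : ∀ i, Measurable fun x : π.Config => H (x.2.2 i) := fun i =>
      hH.comp ((measurable_pi_apply i).comp measurable_snd.snd)
    exact (((h3 0 0).mul (h3 1 0)).mul ((h4 0).mul (h4 1))).mul h2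

/-- The negatives of the final momenta are the initial momenta of the reversed lines, so the weight
sits at the start there and the swapped estimate applies. -/
theorem lintegral_config_last_le (hπ : π.HasGeneralizedCrossing j) (hε : 0 < ε) (hε3 : ε ≤ 1 / 3)
    (hE : ∀ k : T3, ∫⁻ β, res ε β k ∂μ ≤ E) (hf : Measurable f) (hH : Measurable H) :
    ∫⁻ α, ∫⁻ β, (∫⁻ x : π.Config, f (π.momentum x 0 (Fin.last _)) *
      f (π.momentum x 1 (Fin.last _)) *
      (H (x.2.2 0) * H (x.2.2 1)) * lineProd ε n₁ α β (π.momentum x)) ∂(Measure.pi fun _ => μ)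
      ∂(Measure.pi fun _ => μ)
      ≤ gainBound ε E (n₁ + n₂ + 1) * ((∫⁻ k, f k) ^ 2 * (∫⁻ ξ, H ξ) ^ 2) := by
  have hfn : Measurable fun k : T3 => f (-k) := hf.comp measurable_neg
  have hW : Measurable fun y : (Fin 2 → T3) × (Fin 2 → E3) =>
      f (-y.1 0) * f (-y.1 1) * (H (y.2 0) * H (y.2 1)) := by fun_prop
  have hζ : Measurable fun y : (Fin 2 → T3) × (Fin 2 → E3) => fun i => toTorus (y.2 i) :=
    measurable_pi_lambda _ fun i => continuous_toTorus.measurable.comp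
      ((measurable_pi_apply i).comp measurable_snd)
  have hneg : ∫⁻ k : T3, f k = ∫⁻ k : T3, f (-k) := (lintegral_neg_eq_self f).symm
  have hr : n₁ + n₂ + 1 = n₁ + n₂ + 1 := rfl
  have hr' : n₂ + n₁ + 1 = n₁ + n₂ + 1 := by omega
  rw [hneg, ← lintegral_weight_eq hfn hH]
  refine le_trans (le_of_eq ?_) ((π.lines.reverse hr hr').lintegral_weight_lineProd_swap_le
    (by omega) (hπ.lines.reverse hr hr') hε hε3 hE hW measurable_fst hζ)
  refine lintegral_congr fun α => lintegral_congr fun β => ?_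
  have h1 := π.measurable_momentum
  have h2 := measurable_lineProd (ε := ε) (n := n₁) (measurable_const (a := α))
    (measurable_const (a := β)) h1
  have h3 := fun j l => hf.comp (π.measurable_momentum_apply j l)
  have h4 : ∀ i, Measurable fun x : π.Config => H (x.2.2 i) := fun i =>
    hH.comp ((measurable_pi_apply i).comp measurable_snd.snd)
  have hm := (((h3 0 (Fin.last _)).mul (h3 1 (Fin.last _))).mul ((h4 0).mul (h4 1))).mul h2
  have hm' : Measurable fun x : π.Config => f (-x.1 0) * f (-x.1 1) *
      (H (x.2.2 0) * H (x.2.2 1)) * lineProd ε n₂ β α ((π.lines.reverse hr hr').mom x.1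
        (fun i => toTorus (x.2.2 i)) x.2.1) := by
    refine Measurable.mul ?_ (measurable_lineProd measurable_const measurable_const ?_)
    · exact hW.comp (measurable_fst.prodMk measurable_snd.snd)
    · exact (π.lines.reverse hr hr').measurable_mom.comp (measurable_fst.prodMk
        ((hζ.comp (measurable_fst.prodMk measurable_snd.snd)).prodMk measurable_snd.fst))
  refine (π.lintegral_config_end hm).trans (Eq.trans ?_ (π.lintegral_config hm'))
  refine lintegral_congr fun x => ?_
  set p : Fin 2 → T3 := fun j => -x.1 j -
      π.lines.mom 0 (fun i => toTorus (x.2.2 i)) x.2.1 j (Fin.last _) with hp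
  have hlast : ∀ i, π.lines.mom p (fun i => toTorus (x.2.2 i)) x.2.1 i (Fin.last _) = -x.1 i := by
    intro i
    rw [PairedLines.mom_eq_add_start, hp]
    exact sub_add_cancel _ _
  have hrev : (π.lines.reverse hr hr').mom x.1 (fun i => toTorus (x.2.2 i)) x.2.1
      = fun i l => -π.lines.mom p (fun i => toTorus (x.2.2 i)) x.2.1 i l.rev := by
    funext i l
    exact π.lines.reverse_mom hr hr' (by rw [hlast, neg_neg]) l
  rw [hrev, lineProd_reverse hr]
  simp only [Pi.mul_apply, Function.comp_apply, momentum_eq]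
  rw [← hlast 0, ← hlast 1]

end Pairing

/-! ### Decay of the Fourier transform of the test function -/

section FourierDecay

open scoped FourierTransform ContDiff

theorem one_add_pow_four_le {x : ℝ} (hx : 0 ≤ x) : (1 + x) ^ 4 ≤ 8 * (1 + x ^ 4) := by
  nlinarith [sq_nonneg (x - 1), sq_nonneg (x ^ 2 - 1), sq_nonneg (x * (x - 1)),
    mul_nonneg hx (sq_nonneg (x - 1))]

theorem le_rpow_neg_four {x y K : ℝ} (hx : 0 ≤ x) (h : (1 + x) ^ 4 * y ≤ K) :
    y ≤ K * (1 + x) ^ (-4 : ℝ) := by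
  have h1 : 0 < (1 + x) ^ 4 := by positivity
  have h2 : (1 + x) ^ (-4 : ℝ) = ((1 + x) ^ 4)⁻¹ := by
    rw [Real.rpow_neg (by positivity)]
    congr 1
    exact_mod_cast Real.rpow_natCast (1 + x) 4
  rw [h2, ← div_eq_mul_inv, le_div_iff₀ h1]
  linarith

variable {J : E3 → T3 → ℂ}

theorem toTorus_surjective : Function.Surjective toTorus := by
  intro v
  choose x hx using fun i => QuotientAddGroup.mk_surjective (v i)
  exact ⟨WithLp.toLp 2 x, funext hx⟩

theorem IsSchwartz.contDiff_left (hJ : IsSchwartz J) (v : E3) :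
    ContDiff ℝ ∞ fun X => J X (toTorus v) :=
  hJ.1.comp (contDiff_id.prodMk contDiff_const)

theorem IsSchwartz.norm_iteratedFDeriv_left_le (hJ : IsSchwartz J) (b : ℕ) (X v : E3) :
    ‖iteratedFDeriv ℝ b (fun X => J X (toTorus v)) X‖
      ≤ ‖iteratedFDeriv ℝ b (fun p : E3 × E3 => J p.1 (toTorus p.2)) (X, v)‖ := by
  set F : E3 × E3 → ℂ := fun p => J p.1 (toTorus p.2)
  have h1 : (fun X => J X (toTorus v))
      = (fun z => F (z + (0, v))) ∘ ContinuousLinearMap.inl ℝ E3 E3 := by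
    funext X
    simp [F]
  have h2 : ContDiff ℝ ∞ fun z => F (z + (0, v)) := hJ.1.comp (contDiff_id.add contDiff_const)
  rw [h1, ContinuousLinearMap.iteratedFDeriv_comp_right _ h2 _
    (by exact_mod_cast le_top), iteratedFDeriv_comp_add_right]
  refine (ContinuousMultilinearMap.norm_compContinuousLinearMap_le _ _).trans ?_
  have h3 : ∏ _i : Fin b, ‖ContinuousLinearMap.inl ℝ E3 E3‖ ≤ 1 :=
    Finset.prod_le_one (fun _ _ => norm_nonneg _)
      fun _ _ => ContinuousLinearMap.norm_inl_le_one ℝ E3 E3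
  have h4 : ContinuousLinearMap.inl ℝ E3 E3 X + (0, v) = (X, v) := by simp
  rw [h4]
  exact mul_le_of_le_one_right (norm_nonneg _) h3

/-- The power `4` exceeds the dimension `3`, which makes the bound integrable; uniformity in `v`
comes from the seminorms. -/
theorem IsSchwartz.exists_decay (hJ : IsSchwartz J) (b : ℕ) : ∃ K : ℝ, ∀ X v : E3,
    ‖iteratedFDeriv ℝ b (fun X => J X (toTorus v)) X‖ ≤ K * (1 + ‖X‖) ^ (-4 : ℝ) := by
  obtain ⟨C0, h0⟩ := hJ.2 0 b
  obtain ⟨C4, h4⟩ := hJ.2 4 b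
  refine ⟨8 * (C0 + C4), fun X v => le_rpow_neg_four (norm_nonneg X) ?_⟩
  have h1 := hJ.norm_iteratedFDeriv_left_le b X v
  have h2 := h0 X v
  have h3 := h4 X v
  set y := ‖iteratedFDeriv ℝ b (fun p : E3 × E3 => J p.1 (toTorus p.2)) (X, v)‖
  calc _ ≤ (1 + ‖X‖) ^ 4 * y := by gcongr
    _ ≤ 8 * (1 + ‖X‖ ^ 4) * y := by
        gcongr
        exact one_add_pow_four_le (norm_nonneg X)
    _ ≤ _ := by linarith

theorem finrank_E3 : Module.finrank ℝ E3 = 3 := by simp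

theorem integrable_one_add_norm_E3 : Integrable fun X : E3 => (1 + ‖X‖) ^ (-4 : ℝ) :=
  integrable_one_add_norm (by rw [finrank_E3]; norm_num)

/-- Four derivatives in `X` have `L¹` norms bounded uniformly in `v`, and each of them is worth one
power of `ξ`. -/
theorem IsSchwartz.exists_fourier_decay (hJ : IsSchwartz J) : ∃ C : ℝ, ∀ (v : T3) (ξ : E3),
    ‖𝓕 (fun X => J X v) ξ‖ ≤ C * (1 + ‖ξ‖) ^ (-4 : ℝ) := by
  choose K hK using hJ.exists_decay
  set I : ℝ := ∫ X : E3, (1 + ‖X‖) ^ (-4 : ℝ)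
  set S : ℝ := ∑ b ∈ Finset.range 5, |K b| * I
  refine ⟨8 * (S + 16 * S), fun v ξ => ?_⟩
  obtain ⟨v, rfl⟩ := toTorus_surjective v
  have hI : 0 ≤ I := integral_nonneg fun X => by positivity
  have hint : ∀ b, Integrable fun X => ‖iteratedFDeriv ℝ b (fun X => J X (toTorus v)) X‖ := by
    intro b
    refine (integrable_one_add_norm_E3.const_mul (K b)).mono' ?_ (Filter.Eventually.of_forall
      fun X => ?_)
    · exact ((hJ.contDiff_left v).continuous_iteratedFDeriv
        (by exact_mod_cast le_top)).norm.aestronglyMeasurable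
    · rw [norm_norm]
      exact hK b X v
  have hle : ∀ b, ∫ X, ‖iteratedFDeriv ℝ b (fun X => J X (toTorus v)) X‖ ≤ |K b| * I := by
    intro b
    rw [← integral_const_mul]
    refine integral_mono (hint b) (integrable_one_add_norm_E3.const_mul _) fun X => ?_
    refine (hK b X v).trans ?_
    gcongr
    exact le_abs_self _
  have key : ∀ n : ℕ, n ≤ 4 → ‖ξ‖ ^ n * ‖𝓕 (fun X => J X (toTorus v)) ξ‖ ≤ 2 ^ n * S := by
    intro n hn
    have h1 := Real.pow_mul_norm_iteratedFDeriv_fourier_le (K := 0) (N := 4)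
      (f := fun X => J X (toTorus v)) ((hJ.contDiff_left v).of_le (by exact_mod_cast le_top))
      (fun k n hk _ => by
        have hk0 : k = 0 := by exact_mod_cast nonpos_iff_eq_zero.1 hk
        subst hk0
        simpa using hint n) (k := 0) (n := n) le_rfl (by exact_mod_cast hn) ξ
    simp only [norm_iteratedFDeriv_zero, pow_zero, one_mul, Nat.cast_zero, mul_zero, zero_add,
      Finset.range_one, Finset.sum_product, Finset.sum_singleton] at h1
    refine h1.trans ?_
    gcongr
    calc _ ≤ ∑ b ∈ Finset.range (n + 1), |K b| * I := Finset.sum_le_sum fun b _ => hle b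
      _ ≤ S := Finset.sum_le_sum_of_subset_of_nonneg (Finset.range_mono (by omega))
          fun b _ _ => by positivity
  refine le_rpow_neg_four (norm_nonneg ξ) ?_
  have h0 := key 0 (by norm_num)
  have h4 := key 4 le_rfl
  calc _ ≤ 8 * (1 + ‖ξ‖ ^ 4) * ‖𝓕 (fun X => J X (toTorus v)) ξ‖ := by
        gcongr
        exact one_add_pow_four_le (norm_nonneg ξ)
    _ ≤ _ := by linarith

/-- An integrable majorant of the scaled Fourier transform. -/
noncomputable def majorant (C η : ℝ) (ξ : E3) : ℝ≥0∞ :=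
  ENNReal.ofReal (η ^ 3)⁻¹ * ENNReal.ofReal (C * (1 + ‖η⁻¹ • ξ‖) ^ (-4 : ℝ))

theorem measurable_majorant (C η : ℝ) : Measurable (majorant C η) := by
  unfold majorant
  fun_prop

theorem enorm_scaledFourier_le {C η : ℝ} (hη : 0 < η)
    (hC : ∀ (v : T3) (ξ : E3), ‖𝓕 (fun X => J X v) ξ‖ ≤ C * (1 + ‖ξ‖) ^ (-4 : ℝ)) (ξ : E3)
    (v : T3) : ‖scaledFourier J η ξ v‖ₑ ≤ majorant C η ξ := by
  rw [scaledFourier, enorm_mul, majorant]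
  refine mul_le_mul' ?_ ?_
  · rw [← ofReal_norm, Complex.norm_real, Real.norm_of_nonneg (by positivity)]
  · rw [← ofReal_norm]
    exact ENNReal.ofReal_le_ofReal (hC v _)

/-- The prefactor `η⁻³` is exactly the Jacobian of the rescaling, so the final constant does not
depend on `lam`. -/
theorem lintegral_majorant (C : ℝ) {η : ℝ} (hη : 0 < η) :
    ∫⁻ ξ, majorant C η ξ = ∫⁻ ξ : E3, ENNReal.ofReal (C * (1 + ‖ξ‖) ^ (-4 : ℝ)) := by
  have hm : Measurable fun ξ : E3 => ENNReal.ofReal (C * (1 + ‖ξ‖) ^ (-4 : ℝ)) := by fun_prop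
  have h1 := lintegral_map (μ := (volume : Measure E3)) hm (measurable_const_smul (η⁻¹ : ℝ))
  rw [Measure.map_addHaar_smul _ (inv_ne_zero hη.ne'), lintegral_smul_measure, finrank_E3] at h1
  unfold majorant
  rw [lintegral_const_mul _ (by fun_prop), ← h1, smul_eq_mul, ← mul_assoc,
    ← ENNReal.ofReal_mul (by positivity)]
  have h2 : (η ^ 3)⁻¹ * |((η⁻¹) ^ 3)⁻¹| = 1 := by
    rw [abs_of_pos (by positivity)]
    field_simp
  rw [h2, ENNReal.ofReal_one, one_mul]

theorem lintegral_majorant_ne_top (C : ℝ) :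
    ∫⁻ ξ : E3, ENNReal.ofReal (C * (1 + ‖ξ‖) ^ (-4 : ℝ)) ≠ ⊤ := by
  have h1 := (integrable_one_add_norm_E3.const_mul C).lintegral_lt_top
  exact h1.ne

end FourierDecay

/-! ### Isometry of the lattice Fourier transform -/

section LatticeFourier

theorem haarAddCircle_eq_volume : (AddCircle.haarAddCircle : Measure T1) = volume := by
  rw [AddCircle.volume_eq_smul_haarAddCircle]
  simp

/-- The lattice Fourier transform is isometric. -/
theorem lintegral_latticeFourier_sq (ψ : L2Z3) :
    ∫⁻ k, ‖latticeFourier ψ k‖ₑ ^ 2 = ‖ψ‖ₑ ^ 2 := by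
  set g := (UnitAddTorus.mFourierBasis (d := Fin 3)).repr.symm ψ with hg
  have h1 : ‖g‖ₑ = ‖ψ‖ₑ := by
    rw [← ofReal_norm, ← ofReal_norm, hg, LinearIsometryEquiv.norm_map]
  have h2 : ‖g‖ₑ ^ 2 = ∫⁻ k, ‖g k‖ₑ ^ 2
      ∂(Measure.pi fun _ : Fin 3 => (AddCircle.haarAddCircle : Measure T1)) := by
    have h3 := Lp.enorm_def g
    rw [h3, eLpNorm_eq_lintegral_rpow_enorm_toReal (by norm_num) (by norm_num)]
    rw [← ENNReal.rpow_natCast, ← ENNReal.rpow_mul]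
    norm_num
    rfl
  rw [haarAddCircle_eq_volume] at h2
  rw [← h1, h2]
  exact lintegral_neg_eq_self (μ := (volume : Measure T3)) fun k => ‖g k‖ₑ ^ 2

theorem measurable_latticeFourier (ψ : L2Z3) : Measurable (latticeFourier ψ) :=
  (Lp.stronglyMeasurable _).measurable.comp measurable_neg

end LatticeFourier

/-! ### Contour integrals and resolvents on the contours -/

section Contours

/-- The points of the contour `I`. -/
def OnI (z : ℂ) : Prop :=
  z.re ∈ Icc (-1 : ℝ) 7 ∧ z.im ∈ Icc (-1 : ℝ) 0 ∧ (z.im = 0 ∨ z.im = -1 ∨ z.re = -1 ∨ z.re = 7)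

/-- The points of the complex conjugate of the contour `I`. -/
def OnIbar (z : ℂ) : Prop :=
  z.re ∈ Icc (-1 : ℝ) 7 ∧ z.im ∈ Icc (0 : ℝ) 1 ∧ (z.im = 0 ∨ z.im = 1 ∨ z.re = -1 ∨ z.re = 7)

/-- The measure on the real parts of the points of a contour. -/
noncomputable def contourMeasure : Measure ℝ :=
  (2 : ℝ≥0∞) • volume.restrict (Icc (-1 : ℝ) 7) + Measure.dirac 7 + Measure.dirac (-1)

instance : IsFiniteMeasure contourMeasure := by
  constructor
  simp only [contourMeasure, Measure.coe_add, Measure.coe_smul, Pi.add_apply, Pi.smul_apply,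
    Measure.restrict_apply_univ, Real.volume_Icc, measure_univ, smul_eq_mul]
  exact ENNReal.add_lt_top.2 ⟨ENNReal.add_lt_top.2
    ⟨ENNReal.mul_lt_top (by simp) ENNReal.ofReal_lt_top, by simp⟩, by simp⟩

/-- The factor `2` accounts for the two horizontal sides; the vertical ones have length one and
constant real part, hence the point masses. -/
theorem lintegral_contourMeasure {F : ℝ → ℝ≥0∞} (hF : Measurable F) :
    ∫⁻ a, F a ∂contourMeasure = 2 * (∫⁻ a in Icc (-1 : ℝ) 7, F a) + F 7 + F (-1) := by
  rw [contourMeasure, lintegral_add_measure, lintegral_add_measure, lintegral_smul_measure,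
    lintegral_dirac' _ hF, lintegral_dirac' _ hF, smul_eq_mul]

theorem enorm_segmentIntegral_le {f : ℂ → ℂ} {a b : ℂ} {F : ℝ → ℝ≥0∞}
    (h : ∀ s ∈ Icc (0 : ℝ) 1, ‖f (a + s * (b - a))‖ₑ ≤ F (a.re + s * (b.re - a.re))) :
    ‖segmentIntegral f a b‖ₑ
      ≤ ∫⁻ s in Icc (0 : ℝ) 1, ‖b - a‖ₑ * F (a.re + s * (b.re - a.re)) := by
  rw [segmentIntegral, intervalIntegral.integral_of_le zero_le_one, ← integral_Icc_eq_integral_Ioc]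
  refine (enorm_integral_le_lintegral_enorm _).trans ?_
  refine setLIntegral_mono' measurableSet_Icc fun s hs => ?_
  rw [enorm_mul]
  gcongr
  exact h s hs

theorem enorm_segmentIntegral_vertical_le {f : ℂ → ℂ} {a b : ℂ} (hre : b.re = a.re)
    (hab : ‖b - a‖ = 1) {F : ℝ → ℝ≥0∞}
    (h : ∀ s ∈ Icc (0 : ℝ) 1, ‖f (a + s * (b - a))‖ₑ ≤ F a.re) :
    ‖segmentIntegral f a b‖ₑ ≤ F a.re := by
  refine (enorm_segmentIntegral_le (F := F) (by simpa [hre] using h)).trans ?_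
  have h1 : ‖b - a‖ₑ = 1 := by rw [← ofReal_norm, hab, ENNReal.ofReal_one]
  simp [h1, hre]

theorem lintegral_comp_affine {F : ℝ → ℝ≥0∞} (hF : Measurable F) {r : ℝ} (hr : r ≠ 0) (c : ℝ) :
    ∫⁻ s, ENNReal.ofReal |r| * F (c + s * r) = ∫⁻ x, F x := by
  have h1 : Measurable fun x => F (c + x) := hF.comp (measurable_const.add measurable_id)
  have h2 : Measurable fun s => F (c + s * r) := hF.comp (by fun_prop)
  have h3 : ∫⁻ x, F (c + x) = ENNReal.ofReal |r| * ∫⁻ s, F (c + s * r) := by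
    conv_lhs => rw [← Real.smul_map_volume_mul_right hr]
    rw [lintegral_smul_measure, lintegral_map h1 (by fun_prop : Measurable fun x : ℝ => x * r),
      smul_eq_mul]
  rw [lintegral_const_mul _ h2, ← lintegral_add_left_eq_self F c, h3]

theorem enorm_segmentIntegral_horizontal_le {f : ℂ → ℂ} {a b : ℂ} (him : b.im = a.im)
    {F : ℝ → ℝ≥0∞} (hF : Measurable F) (hab : (a.re = -1 ∧ b.re = 7) ∨ (a.re = 7 ∧ b.re = -1))
    (h : ∀ s ∈ Icc (0 : ℝ) 1, ‖f (a + s * (b - a))‖ₑ ≤ F (a.re + s * (b.re - a.re))) :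
    ‖segmentIntegral f a b‖ₑ ≤ ∫⁻ x in Icc (-1 : ℝ) 7, F x := by
  have hr : b.re - a.re ≠ 0 := by rcases hab with h | h <;> rw [h.1, h.2] <;> norm_num
  have hnorm : ‖b - a‖ₑ = ENNReal.ofReal |b.re - a.re| := by
    have h1 : b - a = ((b.re - a.re : ℝ) : ℂ) := by
      apply Complex.ext <;> simp [him]
    rw [h1, ← ofReal_norm, Complex.norm_real, Real.norm_eq_abs]
  refine (enorm_segmentIntegral_le h).trans (le_of_eq ?_)
  rw [← lintegral_indicator measurableSet_Icc, ← lintegral_indicator measurableSet_Icc,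
    ← lintegral_comp_affine (hF.indicator measurableSet_Icc) hr a.re]
  refine lintegral_congr fun s => ?_
  have hiff : a.re + s * (b.re - a.re) ∈ Icc (-1 : ℝ) 7 ↔ s ∈ Icc (0 : ℝ) 1 := by
    rcases hab with h | h <;> rw [h.1, h.2, mem_Icc, mem_Icc] <;>
      constructor <;> rintro ⟨h1, h2⟩ <;> constructor <;> linarith
  by_cases hs : s ∈ Icc (0 : ℝ) 1
  · rw [indicator_of_mem hs, indicator_of_mem (hiff.2 hs), hnorm]
  · rw [indicator_of_notMem hs, indicator_of_notMem (fun h => hs (hiff.1 h)), mul_zero]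

theorem enorm_add_four_le (a b c d : ℂ) : ‖a + b + c + d‖ₑ ≤ ‖a‖ₑ + ‖b‖ₑ + ‖c‖ₑ + ‖d‖ₑ :=
  (enorm_add_le _ _).trans (add_le_add_left ((enorm_add_le _ _).trans
    (add_le_add_left (enorm_add_le _ _) _)) _)

theorem enorm_integralI_le {f : ℂ → ℂ} {F : ℝ → ℝ≥0∞} (hF : Measurable F)
    (h : ∀ z, OnI z → ‖f z‖ₑ ≤ F z.re) : ‖integralI f‖ₑ ≤ ∫⁻ a, F a ∂contourMeasure := by
  rw [lintegral_contourMeasure hF, integralI]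
  refine (enorm_add_four_le _ _ _ _).trans ?_
  have h1 : ‖segmentIntegral f (-1) 7‖ₑ ≤ ∫⁻ x in Icc (-1 : ℝ) 7, F x := by
    refine enorm_segmentIntegral_horizontal_le (by simp) hF (Or.inl (by simp)) fun s hs => ?_
    refine (h _ ⟨?_, ?_, ?_⟩).trans (le_of_eq (congrArg F ?_)) <;> simp <;> constructor <;>
      linarith [hs.1, hs.2]
  have h2 : ‖segmentIntegral f 7 (7 - Complex.I)‖ₑ ≤ F 7 := by
    refine enorm_segmentIntegral_vertical_le (a := 7) (by simp) (by simp) fun s hs => ?_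
    refine (h _ ⟨?_, ?_, ?_⟩).trans (le_of_eq (congrArg F ?_)) <;> simp <;> try constructor
    all_goals linarith [hs.1, hs.2]
  have h3 : ‖segmentIntegral f (7 - Complex.I) (-1 - Complex.I)‖ₑ
      ≤ ∫⁻ x in Icc (-1 : ℝ) 7, F x := by
    refine enorm_segmentIntegral_horizontal_le (by simp) hF (Or.inr (by simp)) fun s hs => ?_
    refine (h _ ⟨?_, ?_, ?_⟩).trans (le_of_eq (congrArg F ?_)) <;> simp <;> try constructor
    all_goals linarith [hs.1, hs.2]
  have h4 : ‖segmentIntegral f (-1 - Complex.I) (-1)‖ₑ ≤ F (-1) := by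
    refine (enorm_segmentIntegral_vertical_le (F := F) (a := -1 - Complex.I) (by simp) (by simp)
      fun s hs => ?_).trans (le_of_eq (congrArg F (by simp)))
    refine (h _ ⟨?_, ?_, ?_⟩).trans (le_of_eq (congrArg F ?_)) <;> simp <;> try constructor
    all_goals linarith [hs.1, hs.2]
  calc _ ≤ (∫⁻ x in Icc (-1 : ℝ) 7, F x) + F 7 + (∫⁻ x in Icc (-1 : ℝ) 7, F x) + F (-1) := by
        gcongr
    _ = _ := by ring

theorem enorm_integralIbar_le {f : ℂ → ℂ} {F : ℝ → ℝ≥0∞} (hF : Measurable F)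
    (h : ∀ z, OnIbar z → ‖f z‖ₑ ≤ F z.re) : ‖integralIbar f‖ₑ ≤ ∫⁻ a, F a ∂contourMeasure := by
  rw [lintegral_contourMeasure hF, integralIbar]
  refine (enorm_add_four_le _ _ _ _).trans ?_
  have h1 : ‖segmentIntegral f (-1) 7‖ₑ ≤ ∫⁻ x in Icc (-1 : ℝ) 7, F x := by
    refine enorm_segmentIntegral_horizontal_le (by simp) hF (Or.inl (by simp)) fun s hs => ?_
    refine (h _ ⟨?_, ?_, ?_⟩).trans (le_of_eq (congrArg F ?_)) <;> simp <;> try constructor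
    all_goals linarith [hs.1, hs.2]
  have h2 : ‖segmentIntegral f 7 (7 + Complex.I)‖ₑ ≤ F 7 := by
    refine enorm_segmentIntegral_vertical_le (a := 7) (by simp) (by simp) fun s hs => ?_
    refine (h _ ⟨?_, ?_, ?_⟩).trans (le_of_eq (congrArg F ?_)) <;> simp <;> try constructor
    all_goals linarith [hs.1, hs.2]
  have h3 : ‖segmentIntegral f (7 + Complex.I) (-1 + Complex.I)‖ₑ
      ≤ ∫⁻ x in Icc (-1 : ℝ) 7, F x := by
    refine enorm_segmentIntegral_horizontal_le (by simp) hF (Or.inr (by simp)) fun s hs => ?_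
    refine (h _ ⟨?_, ?_, ?_⟩).trans (le_of_eq (congrArg F ?_)) <;> simp <;> try constructor
    all_goals linarith [hs.1, hs.2]
  have h4 : ‖segmentIntegral f (-1 + Complex.I) (-1)‖ₑ ≤ F (-1) := by
    refine (enorm_segmentIntegral_vertical_le (F := F) (a := -1 + Complex.I) (by simp) (by simp)
      fun s hs => ?_).trans (le_of_eq (congrArg F (by simp)))
    refine (h _ ⟨?_, ?_, ?_⟩).trans (le_of_eq (congrArg F ?_)) <;> simp <;> try constructor
    all_goals linarith [hs.1, hs.2]
  calc _ ≤ (∫⁻ x in Icc (-1 : ℝ) 7, F x) + F 7 + (∫⁻ x in Icc (-1 : ℝ) 7, F x) + F (-1) := by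
        gcongr
    _ = _ := by ring

/-- The constant comes from the middle case, where `(|x| + ε) / 12 ≤ (7 + 1/3) / 12 < 2/3 ≤ |y|`. -/
theorem enorm_inv_le_regInv {ε : ℝ} (hε : 0 < ε) (hε3 : ε ≤ 1 / 3) {x y : ℝ} (hx : |x| ≤ 7)
    (h : |y| = ε ∨ 2 / 3 ≤ |y| ∨ 1 ≤ |x|) {w : ℂ} (hre : w.re = x) (him : w.im = y) :
    ‖1 / w‖ₑ ≤ 12 * regInv ε x := by
  have h1 : (|x| + ε) / 12 ≤ ‖w‖ := by
    have h2 := Complex.abs_re_le_norm w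
    have h3 := Complex.abs_im_le_norm w
    rw [hre] at h2
    rw [him] at h3
    rcases h with h | h | h <;> linarith [abs_nonneg x]
  have h2 : 0 < |x| + ε := by positivity
  have h4 : ‖1 / w‖ ≤ 12 * (|x| + ε)⁻¹ := by
    rw [norm_div, norm_one]
    calc 1 / ‖w‖ ≤ 1 / ((|x| + ε) / 12) := one_div_le_one_div_of_le (by positivity) h1
      _ = _ := by field_simp
  rw [← ofReal_norm, regInv]
  calc _ ≤ ENNReal.ofReal (12 * (|x| + ε)⁻¹) := ENNReal.ofReal_le_ofReal h4
    _ = _ := by rw [ENNReal.ofReal_mul (by norm_num)]; norm_num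

theorem abs_energy_sub_le {k : T3} {a : ℝ} (ha : a ∈ Icc (-1 : ℝ) 7) :
    |kineticEnergy k - a| ≤ 7 := by
  have h1 := kineticEnergy_mem k
  rw [abs_le]
  constructor <;> linarith [h1.1, h1.2, ha.1, ha.2]

theorem one_le_abs_energy_sub {k : T3} {a : ℝ} (ha : a = -1 ∨ a = 7) :
    1 ≤ |kineticEnergy k - a| := by
  have h1 := kineticEnergy_mem k
  rcases ha with rfl | rfl
  · rw [le_abs]; left; linarith [h1.1]
  · rw [le_abs]; right; linarith [h1.2]

/-- On the real side the denominator has imaginary part `-ε`, on the opposite side `1 - ε ≥ 2/3`;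
the vertical sides are at distance at least one from the spectrum `[0, 6]`. -/
theorem enorm_resolvent_le_of_onI {ε : ℝ} (hε : 0 < ε) (hε3 : ε ≤ 1 / 3) (k : T3) {z : ℂ}
    (hz : OnI z) : ‖1 / (kineticEnergy k - z - Complex.I * ε)‖ₑ ≤ 12 * res ε z.re k := by
  refine enorm_inv_le_regInv hε hε3 (abs_energy_sub_le hz.1) (y := -z.im - ε) ?_ (by simp) (by simp)
  rcases hz.2.2 with h | h | h
  · left; rw [h, neg_zero, zero_sub, abs_neg, abs_of_pos hε]
  · right; left; rw [h, le_abs]; left; linarith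
  · right; right; exact one_le_abs_energy_sub h

theorem enorm_resolvent_le_of_onIbar {ε : ℝ} (hε : 0 < ε) (hε3 : ε ≤ 1 / 3) (k : T3) {z : ℂ}
    (hz : OnIbar z) : ‖1 / (kineticEnergy k - z + Complex.I * ε)‖ₑ ≤ 12 * res ε z.re k := by
  refine enorm_inv_le_regInv hε hε3 (abs_energy_sub_le hz.1) (y := -z.im + ε) ?_ (by simp) (by simp)
  rcases hz.2.2 with h | h | h
  · left; rw [h, neg_zero, zero_add, abs_of_pos hε]
  · right; left; rw [h, le_abs]; right; linarith
  · right; right; exact one_le_abs_energy_sub h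

theorem lintegral_contour_res_le {ε : ℝ} (hε : 0 < ε) (hε3 : ε ≤ 1 / 3) (k : T3) :
    ∫⁻ a, res ε a k ∂contourMeasure ≤ 26 * ell ε := by
  rw [lintegral_contourMeasure (by fun_prop)]
  have h1 : ∫⁻ a in Icc (-1 : ℝ) 7, res ε a k ≤ (4 + (8 : ℕ)) * ell ε := by
    have h2 := lintegral_regInv_Icc_le hε hε3 (-kineticEnergy k) (a := -1) (b := 7) (n := 8)
      (by norm_num)
    refine le_trans (le_of_eq (lintegral_congr fun a => ?_)) h2
    rw [res, ← regInv_neg]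
    congr 1
    ring
  have h7 : res ε 7 k ≤ 1 := regInv_le_one hε (one_le_abs_energy_sub (Or.inr rfl))
  have h8 : res ε (-1) k ≤ 1 := regInv_le_one hε (one_le_abs_energy_sub (Or.inl rfl))
  have hl := one_le_ell hε hε3
  -- The constant is `26 = 2 * 12 + 1 + 1`, with `8` the length of the horizontal sides.
  calc _ ≤ 2 * ((4 + (8 : ℕ)) * ell ε) + ell ε + ell ε := by
        gcongr
        · exact h7.trans hl
        · exact h8.trans hl
    _ = _ := by push_cast; ring

end Contours

/-! ### Pointwise bound of the integrand and of the amplitude -/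

section Amplitude

open scoped ComplexConjugate

variable {n₁ n₂ : ℕ}

theorem enorm_resolventProduct_le {ε : ℝ} {j : Fin 2} {k : Fin (n₁ + n₂ + 2) → T3} {α β : ℂ}
    (hα : ∀ k, ‖1 / (kineticEnergy k - α + Complex.I * signedEps ε j)‖ₑ ≤ 12 * res ε α.re k)
    (hβ : ∀ k, ‖1 / (kineticEnergy k - β - Complex.I * signedEps ε j)‖ₑ ≤ 12 * res ε β.re k) :
    ‖resolventProduct n₁ n₂ j k α β ε‖ₑ
      ≤ 12 ^ (n₁ + n₂ + 2) * ∏ l : Fin (n₁ + n₂ + 2), res ε (if (l : ℕ) ≤ n₁ then α.re else β.re) (k l) := by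
  have h1 : (12 : ℝ≥0∞) ^ (n₁ + n₂ + 2) = ∏ _l : Fin (n₁ + n₂ + 2), 12 := by simp
  rw [resolventProduct, ← ofReal_norm, norm_prod,
    ENNReal.ofReal_prod_of_nonneg fun _ _ => norm_nonneg _, h1, ← Finset.prod_mul_distrib]
  refine Finset.prod_le_prod' fun l _ => ?_
  rw [ofReal_norm]
  split_ifs
  · exact hα _
  · exact hβ _

theorem enorm_resolventProduct_zero_le {ε : ℝ} (hε : 0 < ε) (hε3 : ε ≤ 1 / 3)
    {k : Fin (n₁ + n₂ + 2) → T3} {α β : ℂ} (hα : OnI α) (hβ : OnIbar β) :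
    ‖resolventProduct n₁ n₂ 0 k α β ε‖ₑ
      ≤ 12 ^ (n₁ + n₂ + 2) * ∏ l : Fin (n₁ + n₂ + 2), res ε (if (l : ℕ) ≤ n₁ then α.re else β.re) (k l) := by
  refine enorm_resolventProduct_le (fun k => ?_) (fun k => ?_)
  · convert enorm_resolvent_le_of_onI hε hε3 k hα using 3
    simp [signedEps]
    ring
  · convert enorm_resolvent_le_of_onIbar hε hε3 k hβ using 3
    simp [signedEps]

theorem enorm_resolventProduct_one_le {ε : ℝ} (hε : 0 < ε) (hε3 : ε ≤ 1 / 3)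
    {k : Fin (n₁ + n₂ + 2) → T3} {α β : ℂ} (hα : OnIbar α) (hβ : OnI β) :
    ‖resolventProduct n₁ n₂ 1 k α β ε‖ₑ
      ≤ 12 ^ (n₁ + n₂ + 2) * ∏ l : Fin (n₁ + n₂ + 2), res ε (if (l : ℕ) ≤ n₁ then α.re else β.re) (k l) := by
  refine enorm_resolventProduct_le (fun k => ?_) (fun k => ?_)
  · convert enorm_resolvent_le_of_onIbar hε hε3 k hα using 3
    simp [signedEps]
  · convert enorm_resolvent_le_of_onI hε hε3 k hβ using 3
    simp [signedEps]

theorem lineProd_vec (ε : ℝ) (a₁ a₂ b₁ b₂ : ℝ) (k : Fin 2 → Fin (n₁ + n₂ + 2) → T3) :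
    lineProd ε n₁ ![a₁, a₂] ![b₁, b₂] k
      = (∏ l : Fin (n₁ + n₂ + 2), res ε (if (l : ℕ) ≤ n₁ then a₁ else b₁) (k 0 l)) *
        ∏ l : Fin (n₁ + n₂ + 2), res ε (if (l : ℕ) ≤ n₁ then a₂ else b₂) (k 1 l) := by
  rw [lineProd, Fintype.prod_prod_type, Fin.prod_univ_two]
  rfl

/-- The real part of the exponent is `t (Im α₁ - Im β₁ - Im α₂ + Im β₂)`, and each variable runs on
the side of the real axis that makes its term nonpositive. -/
theorem enorm_exp_le_one {t : ℝ} (ht : 0 ≤ t) {α₁ β₁ α₂ β₂ : ℂ} (h₁ : OnI α₁) (h₂ : OnIbar β₁)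
    (h₃ : OnIbar α₂) (h₄ : OnI β₂) :
    ‖Complex.exp (-Complex.I * t * (α₁ - β₁ - α₂ + β₂))‖ₑ ≤ 1 := by
  rw [← ofReal_norm, Complex.norm_exp, ← ENNReal.ofReal_one]
  refine ENNReal.ofReal_le_ofReal (Real.exp_le_one_iff.2 ?_)
  have h5 : (-Complex.I * t * (α₁ - β₁ - α₂ + β₂)).re
      = t * (α₁.im - β₁.im - α₂.im + β₂.im) := by
    simp
  rw [h5]
  refine mul_nonpos_of_nonneg_of_nonpos ht ?_
  linarith [h₁.2.1.2, h₂.2.1.1, h₃.2.1.1, h₄.2.1.2]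

/-- With `a`, `c` at the initial and `b`, `d` at the final momenta, this leaves squares at one end
only, for which the `ℓ²` norm suffices. -/
theorem mul_four_le (a b c d : ℝ≥0∞) :
    a * b * c * d ≤ a ^ 2 * c ^ 2 + b ^ 2 * d ^ 2 := by
  have h : a * b * c * d = (a * c) * (b * d) := by ring
  rw [h, ← mul_pow, ← mul_pow, sq, sq]
  rcases le_total (a * c) (b * d) with h1 | h1
  · exact (mul_le_mul_left h1 _).trans le_add_self
  · exact (mul_le_mul_right h1 _).trans le_self_add

variable (π : Pairing n₁ n₂)

/-- The integral over all configurations of the resolvents, weighted with `f` at the momenta with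
index `l` and with `H` at the test functions. -/
noncomputable def configBound (f : T3 → ℝ≥0∞) (H : E3 → ℝ≥0∞) (ε : ℝ) (l : Fin (n₁ + n₂ + 2))
    (α β : Fin 2 → ℝ) : ℝ≥0∞ :=
  ∫⁻ x : π.Config, f (π.momentum x 0 l) * f (π.momentum x 1 l) *
    (H (x.2.2 0) * H (x.2.2 1)) * lineProd ε n₁ α β (π.momentum x)

variable {f : T3 → ℝ≥0∞} {H : E3 → ℝ≥0∞}

theorem measurable_configIntegrand (hf : Measurable f) (hH : Measurable H) (ε : ℝ)
    (l : Fin (n₁ + n₂ + 2)) :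
    Measurable fun z : ((Fin 2 → ℝ) × (Fin 2 → ℝ)) × π.Config =>
      f (π.momentum z.2 0 l) * f (π.momentum z.2 1 l) * (H (z.2.2.2 0) * H (z.2.2.2 1)) *
        lineProd ε n₁ z.1.1 z.1.2 (π.momentum z.2) := by
  have h2 : Measurable fun z : ((Fin 2 → ℝ) × (Fin 2 → ℝ)) × π.Config =>
      lineProd ε n₁ z.1.1 z.1.2 (π.momentum z.2) :=
    measurable_lineProd measurable_fst.fst measurable_fst.snd
      (π.measurable_momentum.comp measurable_snd)
  have h3 : ∀ j l, Measurable fun z : ((Fin 2 → ℝ) × (Fin 2 → ℝ)) × π.Config =>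
      f (π.momentum z.2 j l) :=
    fun j l => (hf.comp (π.measurable_momentum_apply j l)).comp measurable_snd
  have h4 : ∀ i, Measurable fun z : ((Fin 2 → ℝ) × (Fin 2 → ℝ)) × π.Config => H (z.2.2.2 i) :=
    fun i => hH.comp ((measurable_pi_apply i).comp measurable_snd.snd.snd)
  exact (((h3 0 l).mul (h3 1 l)).mul ((h4 0).mul (h4 1))).mul h2

instance : SFinite (volume : Measure π.Config) :=
  @Measure.prod.instSFinite _ _ _ _ _ _ _ _

theorem measurable_configBound (hf : Measurable f) (hH : Measurable H) (ε : ℝ)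
    (l : Fin (n₁ + n₂ + 2)) :
    Measurable fun z : (Fin 2 → ℝ) × (Fin 2 → ℝ) => configBound π f H ε l z.1 z.2 :=
  Measurable.lintegral_prod_right' (measurable_configIntegrand π hf hH ε l)

theorem lintegral_lintegral_add {X : Type*} [MeasurableSpace X] {ν : Measure X} [SFinite ν]
    {A B : X → X → ℝ≥0∞} (hA : Measurable fun z : X × X => A z.1 z.2) :
    ∫⁻ α, ∫⁻ β, (A α β + B α β) ∂ν ∂ν = ∫⁻ α, ∫⁻ β, A α β ∂ν ∂ν + ∫⁻ α, ∫⁻ β, B α β ∂ν ∂ν := by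
  have h2 : ∀ α, Measurable (A α) := fun α => hA.comp (measurable_prodMk_left (x := α))
  simp only [lintegral_add_left (h2 _)]
  exact lintegral_add_left (Measurable.lintegral_prod_right' hA) _

theorem lintegral_configBound_add_le {j : Fin 2} (hπ : π.HasGeneralizedCrossing j) {ε : ℝ}
    (hε : 0 < ε) (hε3 : ε ≤ 1 / 3) {μ : Measure ℝ} [IsFiniteMeasure μ] {E : ℝ≥0∞}
    (hE : ∀ k : T3, ∫⁻ β, res ε β k ∂μ ≤ E) (hf : Measurable f) (hH : Measurable H) :
    ∫⁻ α, ∫⁻ β, (configBound π f H ε 0 α β + configBound π f H ε (Fin.last _) α β)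
        ∂(Measure.pi fun _ => μ) ∂(Measure.pi fun _ => μ)
      ≤ 2 * (gainBound ε E (n₁ + n₂ + 1) * ((∫⁻ k, f k) ^ 2 * (∫⁻ ξ, H ξ) ^ 2)) := by
  rw [lintegral_lintegral_add (measurable_configBound π hf hH ε 0), two_mul]
  exact add_le_add (Pairing.lintegral_config_start_le hπ hε hε3 hE hf hH)
    (Pairing.lintegral_config_last_le hπ hε hε3 hE hf hH)

/-- The four contour integrals, in the order of the amplitude. -/
theorem lintegral_four_eq {μ : Measure ℝ} [IsFiniteMeasure μ]
    {Q : (Fin 2 → ℝ) → (Fin 2 → ℝ) → ℝ≥0∞}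
    (hQ : Measurable fun z : (Fin 2 → ℝ) × (Fin 2 → ℝ) => Q z.1 z.2) :
    ∫⁻ a₁, ∫⁻ b₁, ∫⁻ a₂, ∫⁻ b₂, Q ![a₁, a₂] ![b₁, b₂] ∂μ ∂μ ∂μ ∂μ
      = ∫⁻ α, ∫⁻ β, Q α β ∂(Measure.pi fun _ => μ) ∂(Measure.pi fun _ => μ) := by
  rw [lintegral_pi_two μ (Measurable.lintegral_prod_right' hQ)]
  refine lintegral_congr fun a₁ => ?_
  have h1 : ∀ a₂, ∫⁻ β, Q ![a₁, a₂] β ∂(Measure.pi fun _ => μ)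
      = ∫⁻ b₁, ∫⁻ b₂, Q ![a₁, a₂] ![b₁, b₂] ∂μ ∂μ := fun a₂ =>
    lintegral_pi_two μ (hQ.comp measurable_prodMk_left)
  simp only [h1]
  refine lintegral_lintegral_swap (f := fun b₁ a₂ => ∫⁻ b₂, Q ![a₁, a₂] ![b₁, b₂] ∂μ)
    (Measurable.aemeasurable ?_)
  refine Measurable.lintegral_prod_right' (f := fun z : (ℝ × ℝ) × ℝ => Q ![a₁, z.1.2] ![z.1.1, z.2]) ?_
  exact hQ.comp ((measurable_vec_two measurable_const measurable_fst.snd).prodMk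
    (measurable_vec_two measurable_fst.fst measurable_snd))

theorem enorm_contour_four_le {g : ℂ → ℂ → ℂ → ℂ → ℂ} {Q : (Fin 2 → ℝ) → (Fin 2 → ℝ) → ℝ≥0∞}
    (hQ : Measurable fun z : (Fin 2 → ℝ) × (Fin 2 → ℝ) => Q z.1 z.2)
    (h : ∀ α₁ β₁ α₂ β₂, OnI α₁ → OnIbar β₁ → OnIbar α₂ → OnI β₂ →
      ‖g α₁ β₁ α₂ β₂‖ₑ ≤ Q ![α₁.re, α₂.re] ![β₁.re, β₂.re]) :
    ‖integralI fun α₁ => integralIbar fun β₁ => integralIbar fun α₂ => integralI fun β₂ =>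
      g α₁ β₁ α₂ β₂‖ₑ ≤ ∫⁻ α, ∫⁻ β, Q α β ∂(Measure.pi fun _ => contourMeasure)
        ∂(Measure.pi fun _ => contourMeasure) := by
  rw [← lintegral_four_eq hQ]
  have m4 : Measurable fun z : ((ℝ × ℝ) × ℝ) × ℝ => Q ![z.1.1.1, z.1.2] ![z.1.1.2, z.2] :=
    hQ.comp ((measurable_vec_two measurable_fst.fst.fst measurable_fst.snd).prodMk
      (measurable_vec_two measurable_fst.fst.snd measurable_snd))
  have m3 : Measurable fun z : (ℝ × ℝ) × ℝ =>
      ∫⁻ b₂, Q ![z.1.1, z.2] ![z.1.2, b₂] ∂contourMeasure := m4.lintegral_prod_right'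
  have m2 : Measurable fun z : ℝ × ℝ =>
      ∫⁻ a₂, ∫⁻ b₂, Q ![z.1, a₂] ![z.2, b₂] ∂contourMeasure ∂contourMeasure :=
    m3.lintegral_prod_right'
  have m1 : Measurable fun a₁ : ℝ =>
      ∫⁻ b₁, ∫⁻ a₂, ∫⁻ b₂, Q ![a₁, a₂] ![b₁, b₂] ∂contourMeasure ∂contourMeasure ∂contourMeasure :=
    m2.lintegral_prod_right'
  refine enorm_integralI_le m1 fun α₁ h₁ => ?_
  refine enorm_integralIbar_le (F := fun b₁ => ∫⁻ a₂, ∫⁻ b₂, Q ![α₁.re, a₂] ![b₁, b₂]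
    ∂contourMeasure ∂contourMeasure) (m2.comp measurable_prodMk_left) fun β₁ h₂ => ?_
  refine enorm_integralIbar_le (F := fun a₂ => ∫⁻ b₂, Q ![α₁.re, a₂] ![β₁.re, b₂]
    ∂contourMeasure) (m3.comp (measurable_prodMk_left (x := (α₁.re, β₁.re)))) fun α₂ h₃ => ?_
  exact enorm_integralI_le (F := fun b₂ => Q ![α₁.re, α₂.re] ![β₁.re, b₂])
    (m4.comp (measurable_prodMk_left (x := ((α₁.re, β₁.re), α₂.re)))) fun β₂ h₄ => h α₁ β₁ α₂ β₂ h₁ h₂ h₃ h₄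

theorem enorm_integrand_le {J : E3 → T3 → ℂ} {η ε : ℝ} (hε : 0 < ε)
    (hε3 : ε ≤ 1 / 3) (φ₀ : L2Z3) (hJ : ∀ ξ v, ‖scaledFourier J η ξ v‖ₑ ≤ H ξ)
    {α₁ β₁ α₂ β₂ : ℂ} (h₁ : OnI α₁) (h₂ : OnIbar β₁) (h₃ : OnIbar α₂) (h₄ : OnI β₂)
    (hfφ : ∀ k, f k = ‖latticeFourier φ₀ k‖ₑ ^ 2) (x : π.Config) :
    ‖testFactor J η π x 0 * conj (testFactor J η π x 1) *
          resolventProduct n₁ n₂ 0 (π.momentum x 0) α₁ β₁ ε *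
          resolventProduct n₁ n₂ 1 (π.momentum x 1) α₂ β₂ ε *
          (latticeFourier φ₀ (π.momentum x 0 0) *
            conj (latticeFourier φ₀ (π.momentum x 0 (Fin.last _))) *
            conj (latticeFourier φ₀ (π.momentum x 1 0)) *
            latticeFourier φ₀ (π.momentum x 1 (Fin.last _)))‖ₑ
      ≤ 144 ^ (n₁ + n₂ + 2) * (f (π.momentum x 0 0) * f (π.momentum x 1 0) *
          (H (x.2.2 0) * H (x.2.2 1)) *
            lineProd ε n₁ ![α₁.re, α₂.re] ![β₁.re, β₂.re] (π.momentum x) +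
        f (π.momentum x 0 (Fin.last _)) * f (π.momentum x 1 (Fin.last _)) *
          (H (x.2.2 0) * H (x.2.2 1)) *
            lineProd ε n₁ ![α₁.re, α₂.re] ![β₁.re, β₂.re] (π.momentum x)) := by
  have hr0 := enorm_resolventProduct_zero_le hε hε3 (k := π.momentum x 0) h₁ h₂
  have hr1 := enorm_resolventProduct_one_le hε hε3 (k := π.momentum x 1) h₃ h₄
  have hφ := mul_four_le ‖latticeFourier φ₀ (π.momentum x 0 0)‖ₑ
    ‖latticeFourier φ₀ (π.momentum x 0 (Fin.last _))‖ₑ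
    ‖latticeFourier φ₀ (π.momentum x 1 0)‖ₑ
    ‖latticeFourier φ₀ (π.momentum x 1 (Fin.last _))‖ₑ
  have hconj : ∀ z : ℂ, ‖conj z‖ₑ = ‖z‖ₑ := fun z => by
    rw [← ofReal_norm, ← ofReal_norm, Complex.norm_conj]
  have h144 : (144 : ℝ≥0∞) ^ (n₁ + n₂ + 2) = 12 ^ (n₁ + n₂ + 2) * 12 ^ (n₁ + n₂ + 2) := by
    rw [← mul_pow]
    norm_num
  simp only [enorm_mul, hconj, testFactor]
  refine (mul_le_mul' (mul_le_mul' (mul_le_mul' (mul_le_mul' (hJ _ _) (hJ _ _)) hr0) hr1)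
    hφ).trans (le_of_eq ?_)
  simp only [lineProd_vec, h144, hfφ]
  generalize (12 : ℝ≥0∞) ^ (n₁ + n₂ + 2) = c
  ring

theorem enorm_integral_config_le {J : E3 → T3 → ℂ} {η ε : ℝ} (hε : 0 < ε)
    (hε3 : ε ≤ 1 / 3) (φ₀ : L2Z3) (hf : Measurable f) (hH : Measurable H)
    (hJ : ∀ ξ v, ‖scaledFourier J η ξ v‖ₑ ≤ H ξ)
    {α₁ β₁ α₂ β₂ : ℂ} (h₁ : OnI α₁) (h₂ : OnIbar β₁) (h₃ : OnIbar α₂) (h₄ : OnI β₂)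
    (hfφ : ∀ k, f k = ‖latticeFourier φ₀ k‖ₑ ^ 2) :
    ‖∫ x : π.Config, testFactor J η π x 0 * conj (testFactor J η π x 1) *
          resolventProduct n₁ n₂ 0 (π.momentum x 0) α₁ β₁ ε *
          resolventProduct n₁ n₂ 1 (π.momentum x 1) α₂ β₂ ε *
          (latticeFourier φ₀ (π.momentum x 0 0) *
            conj (latticeFourier φ₀ (π.momentum x 0 (Fin.last _))) *
            conj (latticeFourier φ₀ (π.momentum x 1 0)) *
            latticeFourier φ₀ (π.momentum x 1 (Fin.last _)))‖ₑ
      ≤ 144 ^ (n₁ + n₂ + 2) * (configBound π f H ε 0 ![α₁.re, α₂.re] ![β₁.re, β₂.re] +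
        configBound π f H ε (Fin.last _) ![α₁.re, α₂.re] ![β₁.re, β₂.re]) := by
  have hm1 := (measurable_configIntegrand π hf hH ε 0).comp
    (measurable_prodMk_left (x := (![α₁.re, α₂.re], ![β₁.re, β₂.re])))
  refine (enorm_integral_le_lintegral_enorm _).trans ?_
  refine (lintegral_mono fun x => enorm_integrand_le π hε hε3 φ₀ hJ h₁ h₂ h₃ h₄ hfφ x).trans ?_
  rw [lintegral_const_mul' _ _ (ENNReal.pow_ne_top (by norm_num))]
  exact mul_le_mul' le_rfl (lintegral_add_left hm1 _).le

theorem enorm_amplitude_le {J : E3 → T3 → ℂ} {lam t ε : ℝ} (ht : 0 ≤ t) (hε : 0 < ε)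
    (hε3 : ε ≤ 1 / 3) (φ₀ : L2Z3) (hH : Measurable H)
    (hJ : ∀ ξ v, ‖scaledFourier J (lam ^ 2) ξ v‖ₑ ≤ H ξ) {j : Fin 2}
    (hπ : π.HasGeneralizedCrossing j) :
    ‖amplitude J lam t ε φ₀ π‖ₑ
      ≤ ‖(Real.exp (4 * ε * t) * lam ^ (2 * (n₁ + n₂)) / (2 * Real.pi) ^ 4 : ℝ)‖ₑ *
        (144 ^ (n₁ + n₂ + 2) * (2 * (gainBound ε (26 * ell ε) (n₁ + n₂ + 1) *
          (‖φ₀‖ₑ ^ 4 * (∫⁻ ξ, H ξ) ^ 2)))) := by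
  obtain ⟨f, hfφ⟩ : ∃ f : T3 → ℝ≥0∞, ∀ k, f k = ‖latticeFourier φ₀ k‖ₑ ^ 2 := ⟨_, fun _ => rfl⟩
  have hf : Measurable f := by
    rw [funext hfφ]
    exact (measurable_latticeFourier φ₀).enorm.pow_const 2
  have hf2 : ∫⁻ k, f k = ‖φ₀‖ₑ ^ 2 := by simp only [hfφ, lintegral_latticeFourier_sq]
  have hQ0 : Measurable fun z : (Fin 2 → ℝ) × (Fin 2 → ℝ) =>
      configBound π f H ε 0 z.1 z.2 + configBound π f H ε (Fin.last _) z.1 z.2 :=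
    (measurable_configBound π hf hH ε 0).add (measurable_configBound π hf hH ε _)
  have htop : (144 : ℝ≥0∞) ^ (n₁ + n₂ + 2) ≠ ⊤ := ENNReal.pow_ne_top (by norm_num)
  have hnorm : ‖((Real.exp (4 * ε * t) * lam ^ (2 * (n₁ + n₂)) / (2 * Real.pi) ^ 4 : ℝ) : ℂ)‖ₑ
      = ‖(Real.exp (4 * ε * t) * lam ^ (2 * (n₁ + n₂)) / (2 * Real.pi) ^ 4 : ℝ)‖ₑ := by
    rw [← ofReal_norm, ← ofReal_norm, Complex.norm_real]
  rw [amplitude, enorm_mul, hnorm]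
  refine mul_le_mul' le_rfl ?_
  refine (enorm_contour_four_le (Q := fun α β => 144 ^ (n₁ + n₂ + 2) *
    (configBound π f H ε 0 α β + configBound π f H ε (Fin.last _) α β)) (hQ0.const_mul _)
    fun α₁ β₁ α₂ β₂ h₁ h₂ h₃ h₄ => ?_).trans ?_
  · rw [enorm_mul]
    refine (mul_le_mul' (enorm_exp_le_one ht h₁ h₂ h₃ h₄)
      (enorm_integral_config_le π hε hε3 φ₀ hf hH hJ h₁ h₂ h₃ h₄ hfφ)).trans_eq (one_mul _)
  · simp only [lintegral_const_mul' _ _ htop]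
    refine mul_le_mul' le_rfl ?_
    refine (lintegral_configBound_add_le π hπ hε hε3 (lintegral_contour_res_le hε hε3) hf
      hH).trans_eq ?_
    rw [hf2, ← pow_mul]

end Amplitude

/-! ### Collecting the constants -/

section FinalBound

/-- The constant of the amplitude bound, in terms of the integral of the test function. -/
noncomputable def ampConst (h : ℝ≥0∞) : ℝ≥0∞ :=
  144 * (resConst + 1) * (1 + 2 * 26 ^ 4 * crossConst * h ^ 2)

theorem one_le_ampConst (h : ℝ≥0∞) : 1 ≤ ampConst h := by
  have h1 : (1 : ℝ≥0∞) * 1 * 1 ≤ ampConst h :=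
    mul_le_mul' (mul_le_mul' (by norm_num) le_add_self) le_self_add
  simpa using h1

theorem ampConst_ne_top {h : ℝ≥0∞} (hh : h ≠ ⊤) : ampConst h ≠ ⊤ := by
  have h1 := resConst_ne_top
  have h2 := crossConst_ne_top
  unfold ampConst
  finiteness

/-- There are `N` logarithms from loops and four from energies, those of the crossing being absorbed
in `ε ^ (-4/5)`. All constants are made at least one so that they can be raised to the power `N +
5`. -/
theorem mul_gainBound_le {ε : ℝ} (hε : 0 < ε) (hε3 : ε ≤ 1 / 3) (N : ℕ) (h p : ℝ≥0∞) :
    144 ^ (N + 2) * (2 * (gainBound ε (26 * ell ε) (N + 1) * (p * h ^ 2)))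
      ≤ ENNReal.ofReal ε⁻¹ ^ (N - 1) * ENNReal.ofReal (ε ^ (-(4 / 5) : ℝ)) *
        (ampConst h * ell ε) ^ (N + 5) * p := by
  have hl := one_le_ell hε hε3
  have h1 : (144 : ℝ≥0∞) ^ (N + 2) ≤ 144 ^ (N + 5) := pow_le_pow_right₀ (by norm_num) (by omega)
  have h2 : (resConst + 1) ^ N ≤ (resConst + 1) ^ (N + 5) :=
    pow_le_pow_right₀ le_add_self (by omega)
  have h3 : ell ε ^ (N + 4) ≤ ell ε ^ (N + 5) := pow_le_pow_right₀ hl (by omega)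
  have h4 : 2 * 26 ^ 4 * crossConst * h ^ 2 ≤ (1 + 2 * 26 ^ 4 * crossConst * h ^ 2) ^ (N + 5) :=
    le_add_self.trans (le_self_pow₀ le_self_add (by omega))
  rw [gainBound, loopCost, crossCost, ampConst, show N + 1 - 2 = N - 1 by omega,
    Nat.add_sub_cancel, ENNReal.ofReal_rpow_of_pos hε]
  generalize ENNReal.ofReal ε⁻¹ ^ (N - 1) = e
  calc _ = e * ENNReal.ofReal (ε ^ (-(4 / 5) : ℝ)) *
        (144 ^ (N + 2) * (resConst + 1) ^ N * (2 * 26 ^ 4 * crossConst * h ^ 2) * ell ε ^ (N + 4))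
          * p := by
        rw [mul_pow, mul_pow, pow_add (ell ε) N 4]
        generalize (144 : ℝ≥0∞) ^ (N + 2) = x
        ring
    _ ≤ e * ENNReal.ofReal (ε ^ (-(4 / 5) : ℝ)) *
        (144 ^ (N + 5) * (resConst + 1) ^ (N + 5) *
          (1 + 2 * 26 ^ 4 * crossConst * h ^ 2) ^ (N + 5) * ell ε ^ (N + 5)) * p := by
        gcongr e * ENNReal.ofReal (ε ^ (-(4 / 5) : ℝ)) * (?_ * ?_ * ?_ * ?_) * p
    _ = _ := by rw [← mul_pow, ← mul_pow, ← mul_pow]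

/-- The exponents add up as `-(N - 1) - 4/5 = 1/5 - N`; for `N = 0` the truncated subtraction would
spoil this. -/
theorem ofReal_inv_pow_mul_rpow {ε : ℝ} (hε : 0 < ε) {N : ℕ} (hN : 1 ≤ N) :
    ENNReal.ofReal ε⁻¹ ^ (N - 1) * ENNReal.ofReal (ε ^ (-(4 / 5) : ℝ))
      = ENNReal.ofReal (ε ^ ((1 / 5 : ℝ) - (N : ℝ))) := by
  rw [← ENNReal.ofReal_pow (by positivity), ← ENNReal.ofReal_mul (by positivity),
    ← Real.rpow_natCast, ← Real.rpow_neg_one, ← Real.rpow_mul hε.le, ← Real.rpow_add hε]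
  congr 2
  push_cast [Nat.cast_sub hN]
  ring

theorem enorm_prefactor_le {lam : ℝ} (hlam : 0 < lam) (ε t : ℝ) (m : ℕ) :
    ‖(Real.exp (4 * ε * t) * lam ^ m / (2 * Real.pi) ^ 4 : ℝ)‖ₑ
      ≤ ENNReal.ofReal (Real.exp (4 * ε * t) * lam ^ m) := by
  rw [← ofReal_norm, Real.norm_of_nonneg (by positivity)]
  refine ENNReal.ofReal_le_ofReal (div_le_self (by positivity) (one_le_pow₀ ?_))
  linarith [Real.pi_gt_three]

theorem Pairing.HasGeneralizedCrossing.one_le {n₁ n₂ : ℕ} {π : Pairing n₁ n₂} {j : Fin 2}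
    (h : π.HasGeneralizedCrossing j) : 1 ≤ n₁ + n₂ := by
  obtain ⟨l, i, hli⟩ : ∃ l i : Position n₁ n₂, l < i := by
    rcases h with ⟨l₁, i₁, _, _, _, _, h1, _⟩ | ⟨l₁, i₁, _, _, _, h1, _⟩ <;> exact ⟨l₁, i₁, h1⟩
  have h1 : (l.1 : ℕ) < i.1 := hli
  have h2 := i.1.2
  omega

end FinalBound

end LatticeSchrodinger

end

theorem lemma4p3 (J : LatticeSchrodinger.E3 → LatticeSchrodinger.T3 → ℂ)
    (hJ : LatticeSchrodinger.IsSchwartz J) :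
    ∃ c : ℝ, 0 < c ∧
      ∀ (n₁ n₂ : ℕ) (π : LatticeSchrodinger.Pairing n₁ n₂) (j : Fin 2),
        π.IsConnected → π.HasGeneralizedCrossing j →
        ∀ (lam t ε : ℝ), 0 < lam → 0 ≤ t → 0 < ε → ε ≤ 1 / 3 →
        ∀ φ₀ : LatticeSchrodinger.L2Z3,
          ‖LatticeSchrodinger.amplitude J lam t ε φ₀ π‖ ≤
            Real.exp (4 * ε * t) * lam ^ (2 * (n₁ + n₂)) *
              ε ^ ((1 / 5 : ℝ) - ((n₁ + n₂ : ℕ) : ℝ)) *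
              |c * Real.log ε| ^ (n₁ + n₂ + 5) * ‖φ₀‖ ^ 4 := by
  open LatticeSchrodinger in
  obtain ⟨C, hC⟩ := hJ.exists_fourier_decay
  set h : ENNReal := ∫⁻ ξ : E3, ENNReal.ofReal (C * (1 + ‖ξ‖) ^ (-4 : ℝ)) with hh
  have hA : ampConst h ≠ ⊤ := ampConst_ne_top (lintegral_majorant_ne_top C)
  -- The constant involves `J` only through the integral of the decay majorant of its Fourier
  -- transform.
  refine ⟨(ampConst h).toReal,
    ENNReal.toReal_pos (zero_lt_one.trans_le (one_le_ampConst h)).ne' hA, ?_⟩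
  intro n₁ n₂ π j _ hπ lam t ε hlam ht hε hε3 φ₀
  have hη : 0 < lam ^ 2 := by positivity
  have h1 := enorm_amplitude_le π ht hε hε3 φ₀ (measurable_majorant C (lam ^ 2))
    (enorm_scaledFourier_le hη hC) hπ
  rw [lintegral_majorant C hη, ← hh] at h1
  have h2 := h1.trans (mul_le_mul' (enorm_prefactor_le hlam ε t _)
    (mul_gainBound_le hε hε3 (n₁ + n₂) h (‖φ₀‖ₑ ^ 4)))
  have hlog : ampConst h * ell ε = ENNReal.ofReal |(ampConst h).toReal * Real.log ε| := by
    have h3 := one_le_neg_log hε hε3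
    rw [abs_mul, abs_of_nonneg ENNReal.toReal_nonneg, abs_of_neg (by linarith),
      ENNReal.ofReal_mul ENNReal.toReal_nonneg, ENNReal.ofReal_toReal hA, ell]
  rw [ofReal_inv_pow_mul_rpow hε hπ.one_le, hlog, ← ofReal_norm φ₀, ← ofReal_norm,
    ← ENNReal.ofReal_pow (by positivity), ← ENNReal.ofReal_pow (by positivity),
    ← ENNReal.ofReal_mul (by positivity), ← ENNReal.ofReal_mul (by positivity),
    ← ENNReal.ofReal_mul (by positivity)] at h2
  have h3 := (ENNReal.ofReal_le_ofReal_iff (by positivity)).1 h2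
  simpa only [mul_assoc] using h3
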